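/- **Theorem (Carlson–Thévenaz conjecture).** Let $p$ be a prime and let $G$ be a finite group with non-trivial Sylow $p$-subgroup $S$. For a finite group $H$ put $A^{p'}(H)=O^{p'}(H)[H,H]$, the smallest normal subgroup of $H$ such that the quotient is an abelian $p'$-group. For subgroups $Q$ of $G$ define subgroups $\rho^i(Q)\le N_G(Q)$, $i\ge 1$ (depending on $G$, $p$ and $S$), by $$\rho^1(Q)=A^{p'}(N_G(Q)),\qquad \rho^i(Q)=\langle\, N_G(Q)\cap\rho^{i-1}(R)\;:\;1<R\le S\,\rangle\quad (i\ge 2).$$ Let $\mathscr O_p^*(G)$ be the category whose objects are the $G$-sets $G/P$, for $P$ a non-trivial $p$-subgroup of $G$, and whose morphisms are the $G$-maps, and let $H_1(\mathscr O_p^*(G))$ be the first integral homology group of its nerve. Let $\mathcal B_p(G)$ be the poset of non-trivial $p$-radical subgroups of $G$, i.e. of the non-trivial $p$-subgroups $P\le G$ with $O_p(N_G(P))=P$, ordered by inclusion, so that $1+\dim\mathcal B_p(G)$ is the number of groups in a longest chain in $\mathcal B_p(G)$. Then for every integer $r\ge 1+\dim\mathcal B_p(G)$ the subgroup $\rho^r(S)$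 is normal in $N_G(S)$ and $$H_1(\mathscr O_p^*(G))\;\cong\; N_G(S)/\rho^r(S).$$ Moreover, for every such $r$ and every field $k$ of characteristic $p$, $$T_k(G,S)\;\cong\;\operatorname{Hom}(N_G(S)/\rho^r(S),k^\times)$$ as groups, where $T_k(G,S)$ is the group, under $\otimes_k$, of equivalence classes of $kG$-modules (not necessarily finitely generated) whose restriction to $kS$ is isomorphic to the direct sum of the trivial module $k$ and a projective module; two such modules $M,N$ are equivalent if $M\oplus P\cong N\oplus P'$ for some projective $kG$-modules $P,P'$. -/

import Mathlib

open CategoryTheory CategoryTheory.Limits MonoidalCategory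
open scoped ZeroObject

universe u v

namespace EndotrivialModules

/-! ### Group theory -/

section Groups

variable (p : ℕ) (G : Type v) [Group G]

/-- `O_p(G)`, the largest normal `p`-subgroup of `G`. -/
def pCore : Subgroup G :=
  sSup {N : Subgroup G | N.Normal ∧ IsPGroup p N}

/-- `O^{p'}(G)`, the smallest normal subgroup of `G` whose index is prime to `p`. -/
def pPrimeResidual : Subgroup G :=
  sInf {N : Subgroup G | N.Normal ∧ N.index.Coprime p}

/-- `A^{p'}(G) = O^{p'}(G)[G,G]`, the smallest normal subgroup of `G` such that the quotient is an
abelian `p'`-group. -/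
def abelianPPrimeResidual : Subgroup G :=
  pPrimeResidual p G ⊔ commutator G

theorem abelianPPrimeResidual_normal : (abelianPPrimeResidual p G).Normal :=
  Subgroup.Normal.of_commutator_le G le_sup_right

variable {G}

/-- The normalizer `N_G(Q)` of a subgroup `Q` of `G`. -/
abbrev nrm (Q : Subgroup G) : Subgroup G :=
  Subgroup.normalizer (Q : Set G)

variable (G)

/-- The poset `B_p(G)` of nontrivial `p`-radical subgroups of `G`, i.e. of the nontrivial
`p`-subgroups `P` with `O_p(N_G(P)) = P`, ordered by inclusion. -/
abbrev RadicalSubgroup : Type v :=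
  {P : Subgroup G // P ≠ ⊥ ∧ IsPGroup p P ∧ pCore p (nrm P) = P.subgroupOf (nrm P)}

variable {G}

/-- The subgroups `ρ^i(Q)` of `N_G(Q)`, relative to a fixed subgroup `S` of `G`:
`ρ^1(Q) = A^{p'}(N_G(Q))`, and `ρ^i(Q)` is generated by the subgroups `N_G(Q) ∩ ρ^{i-1}(R)`, where
`R` runs over the nontrivial subgroups of `S`. The index `i = 0` is not used; there the value is
that for `i = 1`. -/
def rho (S : Subgroup G) : ℕ → Subgroup G → Subgroup G
  | 0, Q => (abelianPPrimeResidual p (nrm Q)).map (nrm Q).subtype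
  | 1, Q => (abelianPPrimeResidual p (nrm Q)).map (nrm Q).subtype
  | i + 2, Q => ⨆ R : {R : Subgroup G // R ≠ ⊥ ∧ R ≤ S}, nrm Q ⊓ rho S (i + 1) R.1

theorem rho_le_nrm (S : Subgroup G) (i : ℕ) (Q : Subgroup G) : rho p S i Q ≤ nrm Q := by
  match i with
  | 0 => simpa only [rho] using Subgroup.map_subtype_le _
  | 1 => simpa only [rho] using Subgroup.map_subtype_le _
  | i + 2 =>
    simp only [rho]
    exact iSup_le fun R => inf_le_left

theorem rho_one_le (S Q : Subgroup G) (hQ : Q ≠ ⊥) (hQS : Q ≤ S) (i : ℕ) :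
    rho p S 1 Q ≤ rho p S i Q := by
  match i with
  | 0 => simp only [rho]; exact le_rfl
  | 1 => exact le_rfl
  | i + 2 =>
    have ih := rho_one_le S Q hQ hQS (i + 1)
    conv_rhs => simp only [rho]
    exact le_trans (le_inf (rho_le_nrm p S 1 Q) ih)
      (le_iSup (fun R : {R : Subgroup G // R ≠ ⊥ ∧ R ≤ S} => nrm Q ⊓ rho p S (i + 1) R.1)
        ⟨Q, hQ, hQS⟩)

/-- `ρ^r(S)` as a subgroup of `N_G(S)`. -/
def rhoIn (S : Subgroup G) (r : ℕ) : Subgroup (nrm S) :=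
  (rho p S r S).subgroupOf (nrm S)

/-- The commutator subgroup of `N_G(S)` is contained in `ρ^r(S)`, if `S` is nontrivial. -/
theorem commutator_le_rhoIn (S : Subgroup G) (hS : S ≠ ⊥) (r : ℕ) :
    commutator (nrm S) ≤ rhoIn p S r := by
  intro x hx
  refine Subgroup.mem_subgroupOf.2 (rho_one_le p S S hS le_rfl r ?_)
  simp only [rho]
  exact ⟨x, (le_sup_right : _ ≤ abelianPPrimeResidual p (nrm S)) hx, rfl⟩

instance rhoIn_normal (S : Subgroup G) (r : ℕ) : (rhoIn p S r).Normal := by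
  by_cases hS : S = ⊥
  · match r with
    | 0 =>
      have h := abelianPPrimeResidual_normal p (nrm S)
      simpa only [rhoIn, rho, Subgroup.subgroupOf,
        Subgroup.comap_map_eq_self_of_injective (nrm S).subtype_injective] using h
    | 1 =>
      have h := abelianPPrimeResidual_normal p (nrm S)
      simpa only [rhoIn, rho, Subgroup.subgroupOf,
        Subgroup.comap_map_eq_self_of_injective (nrm S).subtype_injective] using h
    | i + 2 =>
      have : IsEmpty {R : Subgroup G // R ≠ ⊥ ∧ R ≤ S} :=
        ⟨fun R => R.2.1 (le_bot_iff.1 (hS ▸ R.2.2))⟩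
      have h : rhoIn p S (i + 2) = ⊥ := by
        simp only [rhoIn, rho, iSup_of_empty, Subgroup.bot_subgroupOf]
      rw [h]
      infer_instance
  · exact Subgroup.Normal.of_commutator_le _ (commutator_le_rhoIn p S hS r)

end Groups

/-! ### The orbit category and its homology -/

section Orbit

variable (p : ℕ) (G : Type v) [Group G]

/-- The orbit category `O_p^*(G)`: its objects are the transitive `G`-sets `G/P` for `P` a
nontrivial `p`-subgroup of `G`, and its morphisms are all `G`-maps. -/
structure OrbitCategory where
  /-- The subgroup `P` of the object `G/P`. -/
  P : Subgroup G
  ne_bot : P ≠ ⊥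
  isPGroup : IsPGroup p P

instance : SmallCategory (OrbitCategory p G) where
  Hom X Y := (G ⧸ X.P) →[G] (G ⧸ Y.P)
  id X := MulActionHom.id G
  comp f g := MulActionHom.comp g f

/-- `H_1(O_p^*(G))`: the first integral homology group of the nerve of `O_p^*(G)`. -/
noncomputable abbrev orbitHomologyOne : ModuleCat.{v} ℤ :=
  (nerve (OrbitCategory p G)).homology (ModuleCat.of ℤ (ULift.{v} ℤ)) 1

end Orbit

/-! ### Sylow-trivial modules -/

section Modules

variable {k : Type u} [Field k] {G : Type v} [Group G]

/-- Projective modules are stable under tensoring with arbitrary modules. -/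
theorem projective_tensor (M P : Rep.{u} k G) (hP : Projective P) : Projective (M ⊗ P) := by
  have : (ihom M).PreservesEpimorphisms := by
    refine ⟨fun {X Y} f hf => ?_⟩
    rw [Rep.epi_iff_surjective] at hf ⊢
    intro (φ : M.V →ₗ[k] Y.V)
    obtain ⟨s, hs⟩ := f.hom.toLinearMap.exists_rightInverse_of_surjective
      (LinearMap.range_eq_top.2 hf)
    have key : f.hom.toLinearMap ∘ₗ (s ∘ₗ φ) = φ := by
      rw [← LinearMap.comp_assoc, hs, LinearMap.id_comp]
    exact ⟨s ∘ₗ φ, key⟩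
  exact (ihom.adjunction M).map_projective P hP

/-- Tensor products distribute over direct sums. -/
noncomputable def tensorBiprod (M A B : Rep.{u} k G) : M ⊗ (A ⊞ B) ≅ (M ⊗ A) ⊞ (M ⊗ B) :=
  have := preservesBinaryBiproducts_of_preservesBiproducts (tensorLeft M)
  (tensorLeft M).mapBiprod A B

/-- `M` is a direct sum of the trivial module `k` and a projective module. -/
def IsTrivialPlusProjective (M : Rep.{u} k G) : Prop :=
  ∃ P : Rep.{u} k G, Projective P ∧ Nonempty (M ≅ 𝟙_ (Rep.{u} k G) ⊞ P)

/-- `M` and `N` become isomorphic after adding projective `kG`-modules, i.e. they agree after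
discarding projective summands. -/
def StablyIso (M N : Rep.{u} k G) : Prop :=
  ∃ P Q : Rep.{u} k G, Projective P ∧ Projective Q ∧ Nonempty (M ⊞ P ≅ N ⊞ Q)

theorem IsTrivialPlusProjective.unit : IsTrivialPlusProjective (𝟙_ (Rep.{u} k G)) :=
  ⟨0, inferInstance, ⟨isoBiprodZero (isZero_zero _)⟩⟩

theorem IsTrivialPlusProjective.tensor {M N : Rep.{u} k G} (hM : IsTrivialPlusProjective M)
    (hN : IsTrivialPlusProjective N) : IsTrivialPlusProjective (M ⊗ N) := by
  obtain ⟨P, hP, ⟨e⟩⟩ := hM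
  obtain ⟨Q, hQ, ⟨f⟩⟩ := hN
  have hMQ := projective_tensor M Q hQ
  exact ⟨P ⊞ (M ⊗ Q), inferInstance, ⟨whiskerLeftIso M f ≪≫ tensorBiprod M _ Q ≪≫
    biprod.mapIso (ρ_ M ≪≫ e) (Iso.refl _) ≪≫ biprod.associator _ _ _⟩⟩

theorem StablyIso.of_iso {M N : Rep.{u} k G} (e : M ≅ N) : StablyIso M N :=
  ⟨0, 0, inferInstance, inferInstance, ⟨biprod.mapIso e (Iso.refl _)⟩⟩

theorem StablyIso.symm {M N : Rep.{u} k G} (h : StablyIso M N) : StablyIso N M := by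
  obtain ⟨P, Q, hP, hQ, ⟨e⟩⟩ := h
  exact ⟨Q, P, hQ, hP, ⟨e.symm⟩⟩

theorem StablyIso.trans {M N L : Rep.{u} k G} (h : StablyIso M N) (h' : StablyIso N L) :
    StablyIso M L := by
  obtain ⟨P, Q, hP, hQ, ⟨e⟩⟩ := h
  obtain ⟨P', Q', hP', hQ', ⟨e'⟩⟩ := h'
  exact ⟨P ⊞ P', Q' ⊞ Q, inferInstance, inferInstance,
    ⟨(biprod.associator _ _ _).symm ≪≫ biprod.mapIso e (Iso.refl _) ≪≫ biprod.associator _ _ _ ≪≫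
      biprod.mapIso (Iso.refl _) (biprod.braiding _ _) ≪≫ (biprod.associator _ _ _).symm ≪≫
      biprod.mapIso e' (Iso.refl _) ≪≫ biprod.associator _ _ _⟩⟩

theorem StablyIso.tensor_left (M : Rep.{u} k G) {N N' : Rep.{u} k G} (h : StablyIso N N') :
    StablyIso (M ⊗ N) (M ⊗ N') := by
  obtain ⟨P, Q, hP, hQ, ⟨e⟩⟩ := h
  exact ⟨M ⊗ P, M ⊗ Q, projective_tensor M P hP, projective_tensor M Q hQ,
    ⟨(tensorBiprod M N P).symm ≪≫ whiskerLeftIso M e ≪≫ tensorBiprod M N' Q⟩⟩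

theorem StablyIso.tensor {M M' N N' : Rep.{u} k G} (h : StablyIso M M') (h' : StablyIso N N') :
    StablyIso (M ⊗ N) (M' ⊗ N') :=
  (h'.tensor_left M).trans ((StablyIso.of_iso (β_ M N')).trans
    ((h.tensor_left N').trans (StablyIso.of_iso (β_ N' M'))))

/-- Restriction to a subgroup commutes with tensor products. -/
noncomputable def resTensorIso (S : Subgroup G) (M N : Rep.{u} k G) :
    Rep.res S.subtype (M ⊗ N) ≅ Rep.res S.subtype M ⊗ Rep.res S.subtype N :=
  Rep.mkIso (Representation.Equiv.mk (LinearEquiv.refl k (TensorProduct k M.V N.V))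
    fun _ => rfl)

theorem IsTrivialPlusProjective.of_iso {M N : Rep.{u} k G} (e : M ≅ N)
    (hN : IsTrivialPlusProjective N) : IsTrivialPlusProjective M := by
  obtain ⟨P, hP, ⟨f⟩⟩ := hN
  exact ⟨P, hP, ⟨e ≪≫ f⟩⟩

variable (k)

/-- Sylow-trivial `kG`-modules (not assumed finitely generated): the `kG`-modules whose
restriction to `S` is a direct sum of the trivial module `k` and a projective `kS`-module. -/
abbrev SylowTrivialModule (S : Subgroup G) : Type (max (u + 1) v) :=
  {M : Rep.{u} k G // IsTrivialPlusProjective (Rep.res S.subtype M)}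

/-- Two Sylow-trivial modules are equivalent if they become isomorphic after discarding projective
`kG`-summands. -/
instance sylowTrivialSetoid (S : Subgroup G) : Setoid (SylowTrivialModule k S) where
  r M N := StablyIso M.1 N.1
  iseqv := ⟨fun M => StablyIso.of_iso (Iso.refl M.1), StablyIso.symm, StablyIso.trans⟩

/-- `T_k(G,S)`: equivalence classes of Sylow-trivial `kG`-modules. -/
def SylowTrivialGroup (S : Subgroup G) : Type (max (u + 1) v) :=
  Quotient (sylowTrivialSetoid k S)

/-- The multiplication on `T_k(G,S)` is the tensor product over `k` with diagonal `G`-action; the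
identity element is the class of the trivial module `k`. (Inverses exist, by duality; only the
multiplication is needed to speak about isomorphisms from `T_k(G,S)` to a group.) -/
noncomputable instance (S : Subgroup G) : CommMonoid (SylowTrivialGroup k S) where
  mul := Quotient.map₂
    (fun M N => ⟨M.1 ⊗ N.1, (M.2.tensor N.2).of_iso (resTensorIso S M.1 N.1)⟩)
    (fun _ _ h _ _ h' => StablyIso.tensor h h')
  one := Quotient.mk _ ⟨𝟙_ (Rep.{u} k G), IsTrivialPlusProjective.unit⟩
  mul_assoc := by
    rintro ⟨M⟩ ⟨N⟩ ⟨L⟩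
    exact Quotient.sound (StablyIso.of_iso (α_ M.1 N.1 L.1))
  one_mul := by
    rintro ⟨M⟩
    exact Quotient.sound (StablyIso.of_iso (λ_ M.1))
  mul_one := by
    rintro ⟨M⟩
    exact Quotient.sound (StablyIso.of_iso (ρ_ M.1))
  mul_comm := by
    rintro ⟨M⟩ ⟨N⟩
    exact Quotient.sound (StablyIso.of_iso (β_ M.1 N.1))

end Modules

end EndotrivialModules

/-! Both isomorphisms pass through weak homomorphisms: functions `u` from G to an abelian group that
are trivial on S and satisfy u(gh) = u(g)u(h) whenever S ∩ gSg⁻¹ ∩ ghS(gh)⁻¹ is non-trivial. Where S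
∩ gSg⁻¹ ≠ 1, they amount to homomorphisms on N_G(S)/ρ^r(S).

A weak homomorphism is a homomorphism on N_G(Q) for 1 < Q ≤ S. It kills the p-elements there, hence
A^{p'}(N_G(Q)), and by induction every ρ^i(Q) (`IsWeakHom.map_eq_one_of_mem_rho`). By a version of
Alperin's fusion theorem it is determined by its restriction to N_G(S)
(`eq_one_of_eq_one_on_normalizer`).

The heart is the converse extension (`exists_isWeakHom`), by descent on the order of the subgroups
on which multiplicativity is required. A new order n calls for a homomorphism on N_G(P) for one P of
order n in each conjugacy class. If N_G(P) normalizes a larger well-placed Q, it is restricted from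
N_G(Q). If P is radical and N = S ∩ N_G(P), the Frattini argument gives N_G(P) = (N_G(P) ∩
N_G(N))·A^{p'}(N_G(P)), and one extends by 1 on the second factor. This needs `u` to kill N_G(N) ∩
ρ^1(P), which lies in ρ^2(N). Each radical step shifts the ρ-index by one, and the radical subgroups
met form a chain in B_p(G), so r ≥ 1 + dim B_p(G) leaves enough room.

For H_1, weak homomorphisms correspond to additive functions on the arrows of the orbit category.
The differences of the arrows G/U → G/S given by g and by 1 form a weak homomorphism into 1-chains
modulo boundaries, and it factors through N_G(S)/ρ^r(S).

For modules, write the restriction to S as k·m plus a projective, with projection π to k. Modulo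
traces, g multiplies m by π(gm), and this is a weak homomorphism. If it is trivial, averaging over
G/S splits off k over G. Conversely, a weak homomorphism defines an endomorphism of the permutation
module on G/S, and the image of an idempotent power of it realizes the given character. -/

namespace EndotrivialModules

/-! ### Conjugation and fully normalized subgroups -/

section Conjugation

variable {G : Type*} [Group G]

/-- The conjugate `gUg⁻¹`. -/
def cj (g : G) (U : Subgroup G) : Subgroup G :=
  U.map (MulAut.conj g).toMonoidHom

theorem mem_cj {g x : G} {U : Subgroup G} : x ∈ cj g U ↔ g⁻¹ * x * g ∈ U := by
  constructor
  · rintro ⟨y, hy, rfl⟩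
    simpa [mul_assoc] using hy
  · intro h
    exact ⟨_, h, by simp [mul_assoc]⟩

theorem cj_mul (g h : G) (U : Subgroup G) : cj (g * h) U = cj g (cj h U) := by
  ext x
  simp only [mem_cj, mul_inv_rev, mul_assoc]

@[simp] theorem cj_one (U : Subgroup G) : cj 1 U = U := by
  ext x
  simp [mem_cj]

@[simp] theorem cj_inv_cj (g : G) (U : Subgroup G) : cj g⁻¹ (cj g U) = U := by
  rw [← cj_mul, inv_mul_cancel, cj_one]

@[simp] theorem cj_cj_inv (g : G) (U : Subgroup G) : cj g (cj g⁻¹ U) = U := by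
  rw [← cj_mul, mul_inv_cancel, cj_one]

theorem cj_mono (g : G) {U V : Subgroup G} (h : U ≤ V) : cj g U ≤ cj g V :=
  Subgroup.map_mono h

theorem cj_inv_le {g : G} {U V : Subgroup G} : cj g⁻¹ U ≤ V ↔ U ≤ cj g V :=
  ⟨fun h => by simpa using cj_mono g h, fun h => by simpa using cj_mono g⁻¹ h⟩

theorem cj_le_inv {g : G} {U V : Subgroup G} : cj g U ≤ V ↔ U ≤ cj g⁻¹ V :=
  ⟨fun h => by simpa using cj_mono g⁻¹ h, fun h => by simpa using cj_mono g h⟩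

@[simp] theorem card_cj (g : G) (U : Subgroup G) : Nat.card (cj g U) = Nat.card U :=
  Subgroup.card_map_of_injective (MulAut.conj g).injective

theorem isPGroup_cj {p : ℕ} {U : Subgroup G} (h : IsPGroup p U) (g : G) : IsPGroup p (cj g U) :=
  h.map _

theorem cj_ne_bot {U : Subgroup G} (h : U ≠ ⊥) (g : G) : cj g U ≠ ⊥ := by
  intro h'
  exact h ((Subgroup.map_eq_bot_iff_of_injective _ (MulAut.conj g).injective).1 h')

theorem cj_inf (g : G) (U V : Subgroup G) : cj g (U ⊓ V) = cj g U ⊓ cj g V := by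
  ext x
  simp only [mem_cj, Subgroup.mem_inf]

theorem mem_nrm {g : G} {U : Subgroup G} : g ∈ nrm U ↔ cj g U = U :=
  Subgroup.mem_normalizer_iff_map_conj_eq

theorem cj_eq_of_mem {g : G} {U : Subgroup G} (h : g ∈ U) : cj g U = U :=
  mem_nrm.1 (Subgroup.le_normalizer h)

theorem mem_nrm_cj {g x : G} {U : Subgroup G} : x ∈ nrm (cj g U) ↔ g⁻¹ * x * g ∈ nrm U := by
  rw [mem_nrm, mem_nrm, cj_mul, cj_mul]
  constructor
  · intro h
    rw [h, cj_inv_cj]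
  · intro h
    simpa using congrArg (cj g) h

theorem nrm_cj (g : G) (U : Subgroup G) : nrm (cj g U) = cj g (nrm U) := by
  ext x
  rw [mem_nrm_cj, mem_cj]

theorem mem_nrm_of_cj_le [Finite G] {g : G} {U : Subgroup G} (h : U ≤ cj g U) : g ∈ nrm U :=
  mem_nrm.2 (Subgroup.eq_of_le_of_card_ge h (card_cj g U).le).symm

theorem cj_of_conj_mem_nrm {a b g : G} {U W : Subgroup G} (ha : cj a⁻¹ U = W)
    (hb : cj b⁻¹ (cj g⁻¹ U) = W) : a⁻¹ * g * b ∈ nrm W := by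
  rw [mem_nrm, ← hb, ← cj_mul, ← cj_mul]
  simp only [mul_assoc, mul_inv_cancel, mul_one]
  rw [ha, ← hb, ← cj_mul]

/-- Normalizers grow in the nilpotent group T. This drives every induction over larger subgroups
below. -/
theorem lt_inf_nrm [Finite G] {p : ℕ} [Fact p.Prime] {T U : Subgroup G} (hT : IsPGroup p T)
    (h : U < T) : U < T ⊓ nrm U := by
  refine lt_of_le_of_ne (le_inf h.le Subgroup.le_normalizer) fun he => ?_
  have : Group.IsNilpotent T := hT.isNilpotent
  have hlt : U.subgroupOf T < ⊤ := by
    rw [lt_top_iff_ne_top, Ne, Subgroup.subgroupOf_eq_top]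
    exact not_le_of_gt h
  have h2 := Group.normalizerCondition_of_isNilpotent (U.subgroupOf T) hlt
  rw [← Subgroup.subgroupOf_normalizer_eq h.le] at h2
  refine absurd h2 (not_lt_of_ge ?_)
  intro x hx
  have : (x : G) ∈ T ⊓ nrm U := ⟨x.2, hx⟩
  rw [← he] at this
  exact this

theorem card_lt_of_lt [Finite G] {U V : Subgroup G} (h : U < V) : Nat.card U < Nat.card V := by
  by_contra hc
  exact h.ne (Subgroup.eq_of_le_of_card_ge h.le (not_lt.1 hc))

/-- A subgroup `W` is fully normalized in `T` if every `p`-subgroup of its normalizer is conjugate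
in the normalizer to a subgroup of `T`. -/
def FullyNormalized (p : ℕ) (T W : Subgroup G) : Prop :=
  ∀ Q ≤ nrm W, IsPGroup p Q → ∃ x ∈ nrm W, cj x⁻¹ Q ≤ T

theorem FullyNormalized.le {p : ℕ} {T W : Subgroup G} (h : FullyNormalized p T W)
    (hW : IsPGroup p W) : W ≤ T := by
  obtain ⟨x, hx, hxT⟩ := h W Subgroup.le_normalizer hW
  rwa [mem_nrm.1 (inv_mem hx)] at hxT

/-- Here R plays the role of a Sylow subgroup of N(W): moving one such subgroup into T is enough. -/
theorem FullyNormalized.of_cj {p : ℕ} {T W R : Subgroup G}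
    (hR : ∀ Q ≤ nrm W, IsPGroup p Q → ∃ x ∈ nrm W, cj x⁻¹ Q ≤ R) (d : G) (hd : cj d R ≤ T) :
    FullyNormalized p T (cj d W) := by
  intro Q hQ hQp
  rw [nrm_cj, ← cj_inv_le] at hQ
  obtain ⟨x, hx, hxR⟩ := hR _ hQ (isPGroup_cj hQp _)
  refine ⟨d * x * d⁻¹, ?_, ?_⟩
  · rw [mem_nrm_cj]
    simpa [mul_assoc] using hx
  · have : (d * x * d⁻¹)⁻¹ = d * x⁻¹ * d⁻¹ := by group
    rw [this, cj_mul, cj_mul]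
    exact (cj_mono d hxR).trans hd

/-- Sylow subgroups of the normalizer of `W`, as subgroups of the ambient group. -/
theorem exists_sylow_nrm [Finite G] (p : ℕ) [Fact p.Prime] (W : Subgroup G) :
    ∃ R ≤ nrm W, IsPGroup p R ∧
      ∀ Q ≤ nrm W, IsPGroup p Q → ∃ x ∈ nrm W, cj x⁻¹ Q ≤ R := by
  obtain ⟨R⟩ : Nonempty (Sylow p (nrm W)) := inferInstance
  refine ⟨(R : Subgroup (nrm W)).map (nrm W).subtype, Subgroup.map_subtype_le _, R.2.map _, ?_⟩
  intro Q hQ hQp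
  have hQ' : IsPGroup p (Q.subgroupOf (nrm W)) := hQp.comap_of_injective _ (nrm W).subtype_injective
  obtain ⟨R', hR'⟩ := hQ'.exists_le_sylow
  obtain ⟨x, rfl⟩ := MulAction.exists_smul_eq (nrm W) R R'
  refine ⟨x, x.2, ?_⟩
  rw [cj_inv_le]
  intro y hy
  have h1 := hR' (show (⟨y, hQ hy⟩ : nrm W) ∈ Q.subgroupOf (nrm W) from hy)
  rw [Sylow.coe_subgroup_smul, Subgroup.mem_pointwise_smul_iff_inv_smul_mem] at h1
  rw [mem_cj]
  exact ⟨_, h1, by simp [MulAut.smul_def, ← map_inv, mul_assoc]⟩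

theorem exists_cj_le_sylow [Finite G] {p : ℕ} [Fact p.Prime] (T : Sylow p G) {Q : Subgroup G}
    (hQ : IsPGroup p Q) : ∃ x, cj x Q ≤ T := by
  obtain ⟨R, hR⟩ := hQ.exists_le_sylow
  obtain ⟨x, rfl⟩ := MulAction.exists_smul_eq G T R
  refine ⟨x⁻¹, ?_⟩
  rw [cj_inv_le]
  exact hR

theorem exists_fullyNormalized [Finite G] {p : ℕ} [Fact p.Prime] (T : Sylow p G)
    (W : Subgroup G) : ∃ c : G, FullyNormalized p (T : Subgroup G) (cj c W) := by
  obtain ⟨R, -, hRp, hR⟩ := exists_sylow_nrm p W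
  obtain ⟨c, hc⟩ := exists_cj_le_sylow T hRp
  exact ⟨c, .of_cj hR c hc⟩

theorem FullyNormalized.sylow [Finite G] {p : ℕ} [Fact p.Prime] (T : Sylow p G) :
    FullyNormalized p (T : Subgroup G) (T : Subgroup G) := by
  obtain ⟨c, hc⟩ := exists_fullyNormalized T (T : Subgroup G)
  have h1 := hc.le (isPGroup_cj T.2 c)
  have h2 : cj c (T : Subgroup G) = T := Subgroup.eq_of_le_of_card_ge h1 (card_cj _ _).ge
  rwa [h2] at hc

/-- Conjugation onto a fully normalized subgroup can be chosen to map normalizers to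
normalizers. -/
theorem FullyNormalized.exists_cj {p : ℕ} {T W U : Subgroup G} (h : FullyNormalized p T W)
    (hT : IsPGroup p T) {b : G} (hb : cj b⁻¹ U = W) :
    ∃ a : G, cj a⁻¹ U = W ∧ T ⊓ nrm U ≤ cj a T := by
  have hle : cj b⁻¹ (T ⊓ nrm U) ≤ nrm W := by
    rw [← hb, nrm_cj]
    exact cj_mono _ inf_le_right
  obtain ⟨x, hx, hxT⟩ := h _ hle (isPGroup_cj (hT.to_le inf_le_left) _)
  refine ⟨b * x, ?_, ?_⟩
  · rw [mul_inv_rev, cj_mul, hb, mem_nrm.1 (inv_mem hx)]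
  · rw [← cj_inv_le, mul_inv_rev, cj_mul]
    exact hxT

/-- For `W` fully normalized in `T`, the intersection `T ⊓ N(W)` is a Sylow subgroup of `N(W)`. -/
theorem FullyNormalized.exists_sylow [Finite G] {p : ℕ} {T W : Subgroup G}
    (h : FullyNormalized p T W) (hT : IsPGroup p T) :
    ∃ P : Sylow p (nrm W), (P : Subgroup (nrm W)) = T.subgroupOf (nrm W) := by
  refine ⟨⟨T.subgroupOf (nrm W), hT.comap_of_injective _ (nrm W).subtype_injective, ?_⟩, rfl⟩
  intro Q hQ hle
  obtain ⟨x, hx, hxT⟩ := h (Q.map (nrm W).subtype) (Subgroup.map_subtype_le _) (hQ.map _)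
  refine (Subgroup.eq_of_le_of_card_ge hle ?_).symm
  have h1 : Nat.card (cj x⁻¹ (Q.map (nrm W).subtype)) = Nat.card Q := by
    rw [card_cj, Subgroup.card_map_of_injective (nrm W).subtype_injective]
  have h2 : cj x⁻¹ (Q.map (nrm W).subtype) ≤ (T.subgroupOf (nrm W)).map (nrm W).subtype := by
    rw [Subgroup.subgroupOf_map_subtype]
    refine le_inf hxT ?_
    rw [cj_inv_le, cj_eq_of_mem hx]
    exact Subgroup.map_subtype_le _
  calc Nat.card Q = _ := h1.symm
    _ ≤ _ := Subgroup.card_le_of_le h2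
    _ = _ := Subgroup.card_map_of_injective (nrm W).subtype_injective

theorem mem_nrm_inf_of_mem_nrm_subgroupOf {T K : Subgroup G} {t : K}
    (h : t ∈ nrm (T.subgroupOf K)) : (t : G) ∈ nrm (T ⊓ K) := by
  have h' := Subgroup.le_normalizer_map K.subtype ⟨t, h, rfl⟩
  rwa [Subgroup.subgroupOf_map_subtype] at h'

/-- The Frattini argument in the normalizer of a fully normalized subgroup. -/
theorem FullyNormalized.frattini [Finite G] {p : ℕ} [Fact p.Prime] {T W : Subgroup G}
    (h : FullyNormalized p T W) (hT : IsPGroup p T) {K : Subgroup (nrm W)} [K.Normal]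
    (hK : T.subgroupOf (nrm W) ≤ K) (x : nrm W) :
    ∃ t : nrm W, (t : G) ∈ nrm (T ⊓ nrm W) ∧ ∃ k ∈ K, t * k = x := by
  obtain ⟨P, hP⟩ := h.exists_sylow hT
  have h1 := Sylow.normalizer_sup_eq_top' P (hP.trans_le hK)
  have h2 : x ∈ nrm (P : Subgroup (nrm W)) ⊔ K := h1.ge (Subgroup.mem_top x)
  rw [hP] at h2
  obtain ⟨t, ht, k, hk, htk⟩ := Subgroup.mem_sup_of_normal_right.1 h2
  exact ⟨t, mem_nrm_inf_of_mem_nrm_subgroupOf ht, k, hk, htk⟩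

end Conjugation

/-- A partially multiplicative function on a finite group that is trivial on the normalizer of a
Sylow subgroup `T` is trivial on all elements that conjugate a large subgroup of `T` into `T`. This
is a form of Alperin's fusion theorem. -/
theorem eq_one_of_eq_one_on_normalizer {H : Type*} [Group H] [Finite H] {p : ℕ} [Fact p.Prime]
    (T : Sylow p H) (m : ℕ) {B : Type*} [Group B] (w : H → B)
    (hN : ∀ t ∈ nrm (T : Subgroup H), w t = 1)
    (hmul : ∀ (U : Subgroup H) (g h : H), m ≤ Nat.card U → U ≤ T → U ≤ cj g T →
      U ≤ cj (g * h) T → w (g * h) = w g * w h)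
    (U : Subgroup H) (g : H) (hm : m ≤ Nat.card U) (hU : U ≤ T) (hg : U ≤ cj g T) : w g = 1 := by
  induction hn : Nat.card H - Nat.card U using Nat.strong_induction_on generalizing U g with
  | _ n ih =>
  -- The induction hypothesis applies with V replaced by the strictly larger T ⊓ N(V).
  have grow : ∀ {V : Subgroup H}, Nat.card V = Nat.card U → V < T → ∀ x,
      (T : Subgroup H) ⊓ nrm V ≤ cj x T → w x = 1 := by
    intro V hVU hVT x hx
    have h1 := card_lt_of_lt (lt_inf_nrm T.2 hVT)
    have h2 := Subgroup.card_le_card_group ((T : Subgroup H) ⊓ nrm V)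
    exact ih _ (by omega) _ x (by omega) inf_le_left hx rfl
  have ext : ∀ {V : Subgroup H}, Nat.card V = Nat.card U → V ≤ T → ∀ x,
      (T : Subgroup H) ⊓ nrm V ≤ cj x T → w x = 1 := by
    intro V hVU hVT x hx
    rcases hVT.lt_or_eq with h | rfl
    · exact grow hVU h x hx
    · rw [inf_eq_left.2 Subgroup.le_normalizer] at hx
      exact hN _ (mem_nrm_of_cj_le hx)
  have hUp : IsPGroup p U := T.2.to_le hU
  obtain ⟨c, hc⟩ := exists_fullyNormalized T U
  set W := cj c U with hW
  have hWT : W ≤ T := hc.le (isPGroup_cj hUp c)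
  have hWm : m ≤ Nat.card W := by rwa [hW, card_cj]
  -- Factor g as a·(a⁻¹gb)·b⁻¹. Both a and b are compatible with a larger subgroup of T, so `w` is 1
  -- on them, and the middle factor normalizes W.
  obtain ⟨a, ha, haT⟩ := hc.exists_cj T.2 (U := U) (b := c⁻¹) (by rw [inv_inv])
  obtain ⟨b, hb, hbT⟩ := hc.exists_cj T.2 (U := cj g⁻¹ U) (b := g⁻¹ * c⁻¹)
    (by rw [← cj_mul]; simp [hW])
  have ha1 : w a = 1 := ext rfl hU a haT
  have hb1 : w b = 1 := ext (by rw [card_cj]) (cj_inv_le.2 hg) b hbT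
  have hmem := cj_of_conj_mem_nrm ha hb
  have hle : ∀ y ∈ nrm W, W ≤ cj y T := fun y hy => by
    conv_lhs => rw [← mem_nrm.1 hy]
    exact cj_mono _ hWT
  let f : nrm W →* B := MonoidHom.mk' (fun y => w y) fun y z =>
    hmul W y z hWm hWT (hle _ y.2) (hle _ (mul_mem y.2 z.2))
  have hh1 : w (a⁻¹ * g * b) = 1 := by
    -- The kernel contains T ⊓ N(W), so Frattini leaves only a factor t normalizing T ⊓ N(W). This
    -- group is larger than W unless W = T, and both cases are covered by `ext`.
    obtain ⟨t, ht, k, hk, htk⟩ := hc.frattini T.2 (K := f.ker)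
      (fun y hy => hN _ (Subgroup.le_normalizer hy)) ⟨_, hmem⟩
    have h1 : w (a⁻¹ * g * b) = f t * f k := by rw [← map_mul, htk]; rfl
    rw [h1, hk, mul_one]
    refine ext (V := W) (by rw [hW, card_cj]) hWT t ?_
    conv_lhs => rw [← mem_nrm.1 ht]
    exact cj_mono _ inf_le_left
  have haU : U ≤ cj a T := cj_inv_le.1 (ha.trans_le hWT)
  have hgb : U ≤ cj (g * b) T := by
    rw [← cj_inv_le, mul_inv_rev, cj_mul, hb]
    exact hWT
  have e : g * b = a * (a⁻¹ * g * b) := by group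
  have h1 := hmul U g b hm hU hg hgb
  rw [e, hmul U a _ hm hU haU (e ▸ hgb), ha1, hb1, hh1] at h1
  simpa using h1.symm

/-! ### Weak homomorphisms -/

section WeakHom

variable {p : ℕ} {G : Type*} [Group G] {B : Type*} [CommGroup B]

/-- A weak `S`-homomorphism of level `n`: a function that is trivial on `S` and multiplicative on
`g` and `h` whenever `S ∩ gSg⁻¹ ∩ ghSh⁻¹g⁻¹` contains a subgroup of order at least `n`. -/
structure IsWeakHom (S : Subgroup G) (n : ℕ) (u : G → B) : Prop where
  map_of_mem : ∀ s ∈ S, u s = 1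
  map_mul : ∀ (U : Subgroup G) (g h : G), n ≤ Nat.card U → U ≤ S → U ≤ cj g S →
    U ≤ cj (g * h) S → u (g * h) = u g * u h

theorem le_cj_of_mem_nrm {S U : Subgroup G} (hU : U ≤ S) {x : G} (hx : x ∈ nrm U) :
    U ≤ cj x S := by
  conv_lhs => rw [← mem_nrm.1 hx]
  exact cj_mono _ hU

namespace IsWeakHom

variable {S : Subgroup G} {n : ℕ} {u v : G → B}

theorem map_mul_nrm (hu : IsWeakHom S n u) {U : Subgroup G} (hn : n ≤ Nat.card U) (hU : U ≤ S)
    {x y : G} (hx : x ∈ nrm U) (hy : y ∈ nrm U) : u (x * y) = u x * u y :=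
  hu.map_mul U x y hn hU (le_cj_of_mem_nrm hU hx) (le_cj_of_mem_nrm hU (mul_mem hx hy))

/-- A weak homomorphism restricts to a homomorphism on the normalizer of a subgroup of `S`. -/
def nrmHom (hu : IsWeakHom S n u) {U : Subgroup G} (hn : n ≤ Nat.card U) (hU : U ≤ S) :
    nrm U →* B :=
  MonoidHom.mk' (fun x => u x) fun x y => hu.map_mul_nrm hn hU x.2 y.2

theorem comp (hu : IsWeakHom S n u) {C : Type*} [CommGroup C] (f : B →* C) :
    IsWeakHom S n (fun g => f (u g)) :=
  ⟨fun s hs => by rw [hu.map_of_mem s hs, map_one], fun U g k h1 h2 h3 h4 => by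
    rw [hu.map_mul U g k h1 h2 h3 h4, _root_.map_mul]⟩

theorem div (hu : IsWeakHom S n u) (hv : IsWeakHom S n v) :
    IsWeakHom S n (fun g => u g / v g) :=
  ⟨fun s hs => by rw [hu.map_of_mem s hs, hv.map_of_mem s hs, div_one],
    fun U g k h1 h2 h3 h4 => by
      rw [hu.map_mul U g k h1 h2 h3 h4, hv.map_mul U g k h1 h2 h3 h4, mul_div_mul_comm]⟩

theorem map_mul_mem (hu : IsWeakHom S n u) {U : Subgroup G} (hn : n ≤ Nat.card U) (hU : U ≤ S)
    {g s : G} (hg : U ≤ cj g S) (hs : s ∈ S) : u (g * s) = u g := by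
  rw [hu.map_mul U g s hn hU hg (by rwa [cj_mul, cj_eq_of_mem hs]), hu.map_of_mem s hs, mul_one]

theorem map_mem_mul (hu : IsWeakHom S n u) {U : Subgroup G} (hn : n ≤ Nat.card U) (hU : U ≤ S)
    {g s : G} (hg : U ≤ cj (s * g) S) (hs : s ∈ S) : u (s * g) = u g := by
  rw [hu.map_mul U s g hn hU (by rwa [cj_eq_of_mem hs]) hg, hu.map_of_mem s hs, one_mul]

end IsWeakHom

/-- In a quotient of order prime to p, the image of a p-element has order both a power of p and
prime to p. -/
theorem le_abelianPPrimeResidual {H : Type*} [Group H] [Finite H] {T : Subgroup H}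
    (hT : IsPGroup p T) : T ≤ abelianPPrimeResidual p H := by
  refine le_trans (le_sInf ?_) le_sup_left
  rintro N ⟨hN, hNp⟩ x hx
  have h1 : (QuotientGroup.mk' N x) ^ N.index = 1 := pow_card_eq_one'
  obtain ⟨j, hj⟩ := hT ⟨x, hx⟩
  have h2 : (QuotientGroup.mk' N x) ^ p ^ j = 1 := by
    rw [← map_pow]
    have : x ^ p ^ j = 1 := congrArg Subtype.val hj
    rw [this, map_one]
  have h3 := (hNp.pow_right j)
  have h4 : orderOf (QuotientGroup.mk' N x) = 1 :=
    Nat.eq_one_of_dvd_coprimes h3 (orderOf_dvd_of_pow_eq_one h1) (orderOf_dvd_of_pow_eq_one h2)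
  rw [orderOf_eq_one_iff] at h4
  exact (QuotientGroup.eq_one_iff x).1 h4

theorem mem_rho_one {Q S : Subgroup G} {x : G} :
    x ∈ rho p S 1 Q ↔ ∃ h : x ∈ nrm Q, (⟨x, h⟩ : nrm Q) ∈ abelianPPrimeResidual p (nrm Q) := by
  simp [rho]

theorem le_rho_succ {S R Q : Subgroup G} (hR : R ≠ ⊥) (hRS : R ≤ S) {i : ℕ} (hi : 1 ≤ i) :
    nrm Q ⊓ rho p S i R ≤ rho p S (i + 1) Q := by
  obtain ⟨j, rfl⟩ := Nat.exists_eq_add_of_le' hi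
  rw [rho]
  exact le_iSup (fun R : {R : Subgroup G // R ≠ ⊥ ∧ R ≤ S} => nrm Q ⊓ rho p S (j + 1) R.1)
    ⟨R, hR, hRS⟩

variable [Finite G] [Fact p.Prime] {S : Sylow p G} {n : ℕ} {u : G → B}

namespace IsWeakHom

/-- U⟨x⟩ is a p-group, so some g conjugates it into S. Evaluating `u` on xg⁻¹ = g⁻¹(gxg⁻¹) in two
ways gives u(x)u(g⁻¹) = u(g⁻¹). -/
theorem map_eq_one_of_isPGroup (hu : IsWeakHom (S : Subgroup G) n u) {U : Subgroup G}
    (hn : n ≤ Nat.card U) (hU : U ≤ S) {x : G} (hx : x ∈ nrm U)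
    (hxp : IsPGroup p (Subgroup.zpowers x)) : u x = 1 := by
  have hUp : IsPGroup p U := S.2.to_le hU
  have hQ : IsPGroup p (U ⊔ Subgroup.zpowers x : Subgroup G) :=
    hUp.to_sup_of_normal_left' hxp (by simpa using hx)
  obtain ⟨g, hg⟩ := exists_cj_le_sylow S hQ
  have hUg : U ≤ cj g⁻¹ S := cj_le_inv.1 ((cj_mono g le_sup_left).trans hg)
  have hxg : g * x * g⁻¹ ∈ (S : Subgroup G) :=
    hg (mem_cj.2 (by
      have : g⁻¹ * (g * x * g⁻¹) * g = x := by group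
      rw [this]
      exact (le_sup_right : _ ≤ U ⊔ _) (Subgroup.mem_zpowers x)))
  have h1 : u (x * g⁻¹) = u (g⁻¹) := by
    have e : x * g⁻¹ = g⁻¹ * (g * x * g⁻¹) := by group
    rw [e]
    exact hu.map_mul_mem hn hU hUg hxg
  rw [hu.map_mul U x g⁻¹ hn hU (le_cj_of_mem_nrm hU hx)] at h1
  · simpa using h1
  · rw [cj_mul]
    conv_lhs => rw [← mem_nrm.1 hx]
    exact cj_mono _ hUg

end IsWeakHom

/-- A homomorphism to a commutative group that is trivial on a Sylow subgroup is trivial on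
`A^{p'}`. -/
theorem abelianPPrimeResidual_le_ker {H : Type*} [Group H] [Finite H] (T : Sylow p H) (f : H →* B)
    (hT : (T : Subgroup H) ≤ f.ker) : abelianPPrimeResidual p H ≤ f.ker := by
  refine sup_le (sInf_le ⟨inferInstance, ?_⟩) (Abelianization.commutator_subset_ker f)
  have h1 := T.not_dvd_index
  have h2 : ¬ p ∣ f.ker.index := fun h => h1 (h.trans (Subgroup.index_dvd_of_le hT))
  exact ((Nat.Prime.coprime_iff_not_dvd Fact.out).2 h2).symm

namespace IsWeakHom

theorem abelianPPrimeResidual_le_ker (hu : IsWeakHom (S : Subgroup G) n u) {U : Subgroup G}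
    (hn : n ≤ Nat.card U) (hU : U ≤ S) :
    abelianPPrimeResidual p (nrm U) ≤ (hu.nrmHom hn hU).ker := by
  obtain ⟨T⟩ : Nonempty (Sylow p (nrm U)) := inferInstance
  refine EndotrivialModules.abelianPPrimeResidual_le_ker T _ fun x hx => ?_
  refine hu.map_eq_one_of_isPGroup hn hU x.2 ?_
  have h1 : IsPGroup p (Subgroup.zpowers x) := T.2.to_le (Subgroup.zpowers_le.2 hx)
  have h2 := h1.map (nrm U).subtype
  rwa [MonoidHom.map_zpowers] at h2

theorem map_eq_one_of_mem_rho_one (hu : IsWeakHom (S : Subgroup G) n u) {U : Subgroup G}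
    (hn : n ≤ Nat.card U) (hU : U ≤ S) {x : G} (hx : x ∈ rho p (S : Subgroup G) 1 U) :
    u x = 1 := by
  obtain ⟨h, hx⟩ := mem_rho_one.1 hx
  exact hu.abelianPPrimeResidual_le_ker hn hU hx

/-- A weak homomorphism is trivial on all the subgroups `ρ^i(Q)`. -/
theorem map_eq_one_of_mem_rho (hu : IsWeakHom (S : Subgroup G) 2 u) (i : ℕ) (hi : 1 ≤ i)
    {Q : Subgroup G} (hQ : Q ≠ ⊥) (hQS : Q ≤ S) {x : G}
    (hx : x ∈ rho p (S : Subgroup G) i Q) : u x = 1 := by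
  have hn : ∀ {P : Subgroup G}, P ≠ ⊥ → 2 ≤ Nat.card P := fun h =>
    (Subgroup.one_lt_card_iff_ne_bot _).2 h
  induction i, hi using Nat.le_induction generalizing Q x with
  | base => exact hu.map_eq_one_of_mem_rho_one (hn hQ) hQS hx
  | succ i hi ih =>
    obtain ⟨j, rfl⟩ := Nat.exists_eq_add_of_le' hi
    -- `u` is not multiplicative on all of G, so the generators of ρ^{i+1}(Q) are placed in the
    -- kernel of the homomorphism that `u` induces on N_G(Q).
    have hle : rho p (S : Subgroup G) (j + 1 + 1) Q ≤
        (hu.nrmHom (hn hQ) hQS).ker.map (nrm Q).subtype := by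
      rw [rho]
      refine iSup_le fun R y hy => ?_
      have h1 := rho_le_nrm p _ _ _ hy.2
      refine ⟨⟨y, hy.1⟩, ?_, rfl⟩
      exact ih R.2.1 R.2.2 hy.2
    obtain ⟨y, hy, rfl⟩ := hle hx
    exact hy

/-- Weak homomorphisms are determined by their values on the normalizer of `S`. -/
theorem eq_of_eq_on_nrm {v : G → B} (hu : IsWeakHom (S : Subgroup G) n u)
    (hv : IsWeakHom (S : Subgroup G) n v) (h : ∀ x ∈ nrm (S : Subgroup G), u x = v x)
    {U : Subgroup G} {g : G} (hn : n ≤ Nat.card U) (hU : U ≤ S) (hg : U ≤ cj g S) :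
    u g = v g := by
  have hd := hu.div hv
  exact div_eq_one.1 (eq_one_of_eq_one_on_normalizer S n _
    (fun t ht => div_eq_one.2 (h t ht)) hd.map_mul U g hn hU hg)

end IsWeakHom

end WeakHom

/-! ### Well-placed subgroups -/

section WellPlaced

variable {p : ℕ} {G : Type v} [Group G]

/-- `P` contains every normal `p`-subgroup of its normalizer. -/
def IsRadical (p : ℕ) (P : Subgroup G) : Prop :=
  ∀ Q ≤ nrm P, IsPGroup p Q → nrm P ≤ nrm Q → Q ≤ P

theorem IsRadical.cj {P : Subgroup G} (h : IsRadical p P) (g : G) : IsRadical p (cj g P) := by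
  intro Q hQ hQp hn
  rw [nrm_cj] at hQ hn
  rw [← cj_inv_le]
  refine h _ (cj_inv_le.2 hQ) (isPGroup_cj hQp _) ?_
  rw [nrm_cj, ← cj_le_inv]
  exact hn

theorem IsRadical.pCore_eq {P : Subgroup G} (h : IsRadical p P) (hP : IsPGroup p P) :
    pCore p (nrm P) = P.subgroupOf (nrm P) := by
  refine le_antisymm (sSup_le ?_) (le_sSup ⟨inferInstance, ?_⟩)
  · rintro N ⟨hN, hNp⟩ x hx
    have h1 : nrm P ≤ nrm (N.map (nrm P).subtype) := by
      have := Subgroup.le_normalizer_map (nrm P).subtype (H := N)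
      rw [Subgroup.normalizer_eq_top, ← MonoidHom.range_eq_map, Subgroup.range_subtype] at this
      exact this
    exact h _ (Subgroup.map_subtype_le _) (hNp.map _) h1 ⟨x, hx, rfl⟩
  · exact hP.comap_of_injective _ (nrm P).subtype_injective

theorem nrm_cj_mono (g : G) {U V : Subgroup G} (h : nrm U ≤ nrm V) :
    nrm (cj g U) ≤ nrm (cj g V) := by
  rw [nrm_cj, nrm_cj]
  exact cj_mono g h

/-- The subgroups of `S` from which `S` can be reached by passing to larger normal `p`-subgroups of
the normalizer and, from radical subgroups, to a Sylow subgroup of the normalizer contained in `S`;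
the number counts the steps of the latter kind. -/
inductive WellPlaced (p : ℕ) (S : Subgroup G) : Subgroup G → ℕ → Prop
  | top : WellPlaced p S S 0
  | core {P Q : Subgroup G} {m : ℕ} (hP : P ≠ ⊥) (hF : FullyNormalized p S P) (hPQ : P < Q)
      (hn : nrm P ≤ nrm Q) (hQ : WellPlaced p S Q m) : WellPlaced p S P m
  | radical {P : Subgroup G} {m : ℕ} (hP : P ≠ ⊥) (hF : FullyNormalized p S P)
      (hPS : P < S) (hr : IsRadical p P) (hN : WellPlaced p S (S ⊓ nrm P) m) :
      WellPlaced p S P (m + 1)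

theorem WellPlaced.le {S P : Subgroup G} {m : ℕ} (h : WellPlaced p S P m) : P ≤ S := by
  induction h with
  | top => exact le_rfl
  | core _ _ hPQ _ _ ih => exact hPQ.le.trans ih
  | radical _ _ hPS _ _ _ => exact hPS.le

variable [Finite G] [Fact p.Prime] {S : Sylow p G}

theorem WellPlaced.fullyNormalized {P : Subgroup G} {m : ℕ}
    (h : WellPlaced p (S : Subgroup G) P m) : FullyNormalized p (S : Subgroup G) P := by
  cases h with
  | top => exact .sylow S
  | core _ hF => exact hF
  | radical _ hF => exact hF

/-- Induction from larger to smaller subgroups. A non-radical P is enlarged by a p-subgroup that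
N_G(P) normalizes, a radical one to a Sylow subgroup of its normalizer. -/
theorem exists_wellPlaced (P : Subgroup G) (hP : P ≠ ⊥) (hPp : IsPGroup p P) :
    ∃ (c : G) (m : ℕ), WellPlaced p (S : Subgroup G) (cj c P) m := by
  induction hn : Nat.card G - Nat.card P using Nat.strong_induction_on generalizing P with
  | _ n ih =>
  have grow : ∀ {Q : Subgroup G}, Nat.card P < Nat.card Q → IsPGroup p Q →
      ∃ (c : G) (m : ℕ), WellPlaced p (S : Subgroup G) (cj c Q) m := by
    intro Q hPQ hQp
    have h1 := Subgroup.card_le_card_group Q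
    refine ih _ (by omega) Q ?_ hQp rfl
    rintro rfl
    have := Nat.card_pos (α := P)
    rw [Subgroup.card_bot] at hPQ
    omega
  obtain ⟨c, hc⟩ := exists_fullyNormalized S P
  have hW0 := cj_ne_bot hP c
  have hWp := isPGroup_cj hPp c
  have hcard := card_cj c P
  have hWS := hc.le hWp
  rcases hWS.eq_or_lt with hS | hlt
  · exact ⟨c, 0, hS ▸ .top⟩
  by_cases hr : IsRadical p (cj c P)
  -- Radical case: N is Sylow in the normalizer. Its well-placed conjugate dNd⁻¹ lies in S, so
  -- conjugation by d preserves full normalization, and comparing orders shows that dNd⁻¹ is the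
  -- whole intersection of S with the new normalizer.
  · have hlt' := lt_inf_nrm S.2 hlt
    set N := (S : Subgroup G) ⊓ nrm (cj c P) with hN
    have hNp : IsPGroup p N := S.2.to_le inf_le_left
    obtain ⟨d, m, hd⟩ := grow (hcard ▸ card_lt_of_lt hlt') hNp
    have hdS : cj d N ≤ S := hd.le
    refine ⟨d * c, m + 1, ?_⟩
    rw [cj_mul]
    have hF : FullyNormalized p (S : Subgroup G) (cj d (cj c P)) := by
      refine .of_cj (R := N) (fun Q hQ hQp => ?_) d hdS
      obtain ⟨x, hx, hxS⟩ := hc Q hQ hQp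
      refine ⟨x, hx, le_inf hxS ?_⟩
      rw [cj_inv_le, cj_eq_of_mem hx]
      exact hQ
    refine .radical (cj_ne_bot hW0 d) hF (lt_of_lt_of_le ?_ hdS) (hr.cj d) ?_
    · refine lt_of_le_of_ne (cj_mono d hlt'.le) fun h => hlt'.ne ?_
      simpa using congrArg (cj d⁻¹) h
    · have : (S : Subgroup G) ⊓ nrm (cj d (cj c P)) = cj d N := by
        refine (Subgroup.eq_of_le_of_card_ge (le_inf hdS ?_) ?_).symm
        · rw [nrm_cj]
          exact cj_mono d inf_le_right
        · have h1 : cj d⁻¹ ((S : Subgroup G) ⊓ nrm (cj d (cj c P))) ≤ nrm (cj c P) := by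
            rw [cj_inv_le, ← nrm_cj]
            exact inf_le_right
          obtain ⟨x, hx, hxS⟩ := hc _ h1 (isPGroup_cj (S.2.to_le inf_le_left) _)
          have h2 : cj x⁻¹ (cj d⁻¹ ((S : Subgroup G) ⊓ nrm (cj d (cj c P)))) ≤ N := by
            refine le_inf hxS ?_
            rw [cj_inv_le, cj_eq_of_mem hx]
            exact h1
          simpa using Subgroup.card_le_of_le h2
      rw [this]
      exact hd
  · simp only [IsRadical, not_forall] at hr
    obtain ⟨Q, hQ, hQp, hPQ, hQP⟩ := hr
    set R := cj c P ⊔ Q with hR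
    have hRp : IsPGroup p R := hWp.to_sup_of_normal_left' hQp hQ
    have hlt' : cj c P < R := left_lt_sup.2 hQP
    have hnR : nrm (cj c P) ≤ nrm R := by
      intro x hx
      rw [mem_nrm, hR, cj, Subgroup.map_sup]
      exact congrArg₂ _ (mem_nrm.1 hx) (mem_nrm.1 (hPQ hx))
    obtain ⟨d, m, hd⟩ := grow (hcard ▸ card_lt_of_lt hlt') hRp
    -- After conjugation by d, the smaller group need not be fully normalized. A Sylow subgroup T of
    -- its normalizer lies in the normalizer of dRd⁻¹, which is fully normalized, so T can be moved
    -- into S while dRd⁻¹ stays fixed.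
    obtain ⟨T, hT, hTp, hTs⟩ := exists_sylow_nrm p (cj d (cj c P))
    have hTd : T ≤ nrm (cj d R) :=
      hT.trans (nrm_cj_mono d hnR)
    obtain ⟨x, hx, hxT⟩ := hd.fullyNormalized T hTd hTp
    refine ⟨x⁻¹ * (d * c), m, ?_⟩
    rw [cj_mul, cj_mul]
    have hxd : cj x⁻¹ (cj d R) = cj d R := mem_nrm.1 (inv_mem hx)
    refine .core (Q := cj d R) (cj_ne_bot (cj_ne_bot hW0 d) _) (.of_cj hTs _ hxT) ?_ ?_ hd
    · rw [← hxd]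
      refine lt_of_le_of_ne (cj_mono _ (cj_mono d hlt'.le)) fun h => hlt'.ne ?_
      simpa using congrArg (fun U => cj d⁻¹ (cj x U)) h
    · rw [← hxd]
      exact nrm_cj_mono _ (nrm_cj_mono d hnR)

/-- In a radical step P < S ⊓ N(P), which is below the head of the chain built so far, so P can be
put in front. A core step keeps the chain. -/
theorem WellPlaced.exists_lTSeries (hS : (S : Subgroup G) ≠ ⊥) {P : Subgroup G} {m : ℕ}
    (h : WellPlaced p (S : Subgroup G) P m) :
    ∃ s : LTSeries (RadicalSubgroup p G), s.length = m ∧ P ≤ s.head.1 := by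
  induction h with
  | top =>
    have hr : IsRadical p (S : Subgroup G) := by
      intro Q hQ hQp _
      obtain ⟨x, hx, hxS⟩ := FullyNormalized.sylow S Q hQ hQp
      rwa [cj_inv_le, mem_nrm.1 hx] at hxS
    exact ⟨RelSeries.singleton _ ⟨S, hS, S.2, hr.pCore_eq S.2⟩, rfl, le_rfl⟩
  | core _ _ hPQ _ _ ih =>
    obtain ⟨s, hs, hle⟩ := ih
    exact ⟨s, hs, hPQ.le.trans hle⟩
  | @radical P m hP hF hPS hr hN ih =>
    obtain ⟨s, hs, hle⟩ := ih
    have hPp : IsPGroup p P := S.2.to_le hPS.le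
    refine ⟨s.cons ⟨P, hP, hPp, hr.pCore_eq hPp⟩ ?_, ?_, ?_⟩
    · have h1 : P < s.head.1 := lt_of_lt_of_le (lt_inf_nrm S.2 hPS) hle
      exact h1
    · simp [hs]
    · simp

theorem WellPlaced.lt_of_krullDim_le (hS : (S : Subgroup G) ≠ ⊥) {r : ℕ}
    (hr : 1 + Order.krullDim (RadicalSubgroup p G) ≤ (r : WithBot ℕ∞)) {P : Subgroup G} {m : ℕ}
    (h : WellPlaced p (S : Subgroup G) P m) : m < r := by
  obtain ⟨s, rfl, -⟩ := h.exists_lTSeries hS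
  have h1 : (1 : WithBot ℕ∞) + (s.length : WithBot ℕ∞) ≤ r :=
    le_trans (add_le_add_right (Order.LTSeries.length_le_krullDim s) 1) hr
  have h2 : 1 + s.length ≤ r := by exact_mod_cast h1
  omega

end WellPlaced

/-! ### Extension of homomorphisms on `N_G(S)` to weak homomorphisms -/

section Extension

variable {p : ℕ} {G : Type v} [Group G] {B : Type*} [CommGroup B]

/-- A homomorphism on a supplement of a normal subgroup extends to the group if it is trivial on
the intersection. -/
theorem exists_hom_extension {H : Type*} [Group H] (N K : Subgroup H) [K.Normal]
    (hNK : ∀ x : H, ∃ t ∈ N, ∃ k ∈ K, t * k = x) (f : N →* B)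
    (hf : ∀ x : N, (x : H) ∈ K → f x = 1) :
    ∃ θ : H →* B, (∀ x : N, θ x = f x) ∧ ∀ x ∈ K, θ x = 1 := by
  let g : N →* H ⧸ K := (QuotientGroup.mk' K).comp N.subtype
  have hg : Function.Surjective g := by
    rintro ⟨x⟩
    obtain ⟨t, ht, k, hk, rfl⟩ := hNK x
    exact ⟨⟨t, ht⟩, QuotientGroup.eq.2 (by simpa using hk)⟩
  have hker : g.ker ≤ f.ker := fun x hx => hf x ((QuotientGroup.eq_one_iff (x : H)).1 hx)
  refine ⟨(g.liftOfSurjective hg ⟨f, hker⟩).comp (QuotientGroup.mk' K), fun x => ?_, fun x hx => ?_⟩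
  · exact g.liftOfRightInverse_comp_apply _ (Function.rightInverse_surjInv hg) ⟨f, hker⟩ x
  · have : QuotientGroup.mk' K x = 1 := (QuotientGroup.eq_one_iff x).2 hx
    rw [MonoidHom.comp_apply, this, map_one]

variable [Finite G] [Fact p.Prime] {S : Sylow p G} {n r : ℕ} {u : G → B}

/-- Core step: N(P) ≤ N(Q) gives ρ^i(P) ≤ ρ^i(Q) for i ≥ 2, while ρ^1(P) is killed by any weak
homomorphism. Radical step: by Frattini an element of ρ^i(P) is tk with k in A^{p'}(N(P)) ≤ ρ^i(P)
and t in N(N) ∩ ρ^i(P) ≤ ρ^{i+1}(N), so one radical step costs one index. -/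
theorem IsWeakHom.map_eq_one_of_wellPlaced
    (hu : IsWeakHom (S : Subgroup G) n u)
    (hker : ∀ x ∈ rho p (S : Subgroup G) r S, u x = 1) {P : Subgroup G} {m : ℕ}
    (hP : WellPlaced p (S : Subgroup G) P m) (hn : n ≤ Nat.card P) (hm : m < r) :
    ∀ x ∈ rho p (S : Subgroup G) (r - m) P, u x = 1 := by
  induction hP with
  | top => exact hker
  | @core P Q m hP hF hPQ hnPQ hQ ih =>
    intro x hx
    obtain ⟨j, hj⟩ := Nat.exists_eq_add_of_le' (show 1 ≤ r - m by omega)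
    have ih' := ih (hn.trans (card_lt_of_lt hPQ).le) hm
    rw [hj] at ih' hx
    cases j with
    | zero => exact hu.map_eq_one_of_mem_rho_one hn (hPQ.le.trans hQ.le) hx
    | succ j =>
      refine ih' x ?_
      rw [rho] at hx ⊢
      exact iSup_mono (fun R => inf_le_inf_right _ hnPQ) hx
  | @radical P m hP hF hPS hr hN ih =>
    intro x hx
    set N := (S : Subgroup G) ⊓ nrm P with hNdef
    have hPN : P < N := lt_inf_nrm S.2 hPS
    have hxP := rho_le_nrm p _ _ _ hx
    have hK := abelianPPrimeResidual_normal p (nrm P)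
    obtain ⟨t, ht, k, hk, htk⟩ := hF.frattini S.2 (K := abelianPPrimeResidual p (nrm P))
      (le_abelianPPrimeResidual (S.2.comap_of_injective _ (nrm P).subtype_injective)) ⟨x, hxP⟩
    have hk1 : (k : G) ∈ rho p (S : Subgroup G) 1 P := mem_rho_one.2 ⟨k.2, hk⟩
    have hx' : x = t * k := congrArg Subtype.val htk.symm
    rw [hx', hu.map_mul_nrm hn hPS.le t.2 k.2, hu.map_eq_one_of_mem_rho_one hn hPS.le hk1, mul_one]
    refine ih (hn.trans (card_lt_of_lt hPN).le) (by omega) _ ?_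
    have e : r - m = (r - (m + 1)) + 1 := by omega
    rw [e]
    refine le_rho_succ hP hPS.le (by omega) ⟨ht, ?_⟩
    have : (t : G) = x * (k : G)⁻¹ := by rw [hx', mul_inv_cancel_right]
    rw [this]
    exact mul_mem hx (Subgroup.inv_mem _ (rho_one_le p _ _ hP hPS.le _ hk1))

/-- A weak homomorphism of level `n + 1` extends to the normalizer of a well-placed subgroup of
order `n`. -/
theorem IsWeakHom.exists_hom_nrm
    (hu : IsWeakHom (S : Subgroup G) (n + 1) u)
    (hker : ∀ x ∈ rho p (S : Subgroup G) r S, u x = 1) {P : Subgroup G} {m : ℕ}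
    (hP : WellPlaced p (S : Subgroup G) P m) (hn : n ≤ Nat.card P) (hm : m < r)
    (hPS : P < S) : ∃ θ : nrm P →* B, ∀ x : nrm P,
      (x : G) ∈ nrm ((S : Subgroup G) ⊓ nrm P) → θ x = u x := by
  cases hP with
  | top => exact absurd rfl hPS.ne
  | @core P Q m hP hF hPQ hnPQ hQ =>
    have hnQ : n + 1 ≤ Nat.card Q := (Nat.succ_le_succ hn).trans (card_lt_of_lt hPQ)
    exact ⟨(hu.nrmHom hnQ hQ.le).comp (Subgroup.inclusion hnPQ), fun x _ => rfl⟩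
  | @radical P m hP hF hPS hr hN =>
    set N := (S : Subgroup G) ⊓ nrm P with hNdef
    have hPN : P < N := lt_inf_nrm S.2 hPS
    have hnN : n + 1 ≤ Nat.card N := (Nat.succ_le_succ hn).trans (card_lt_of_lt hPN)
    have hK := abelianPPrimeResidual_normal p (nrm P)
    -- Frattini makes N(N) ∩ N(P) a supplement of A^{p'}(N(P)). Their intersection lies in N(N) ∩
    -- ρ^{r-m-1}(P) ≤ ρ^{r-m}(N), where `u` is trivial.
    obtain ⟨θ, hθ, -⟩ := exists_hom_extension ((nrm N).subgroupOf (nrm P))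
      (abelianPPrimeResidual p (nrm P)) (fun x => hF.frattini S.2
        (le_abelianPPrimeResidual (S.2.comap_of_injective _ (nrm P).subtype_injective)) x)
      ((hu.nrmHom hnN inf_le_left).comp (MonoidHom.mk' (fun x => ⟨x.1.1, x.2⟩) fun _ _ => rfl))
      (fun x hx => by
        refine hu.map_eq_one_of_wellPlaced hker hN hnN (by omega) _ ?_
        have e : r - m = (r - (m + 1)) + 1 := by omega
        rw [e]
        exact le_rho_succ hP hPS.le (by omega)
          ⟨x.2, rho_one_le p _ _ hP hPS.le _ (mem_rho_one.2 ⟨x.1.2, hx⟩)⟩)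
    exact ⟨θ, fun x hx => hθ ⟨x, hx⟩⟩

/-- The fusion lemma inside N(P), with Sylow subgroup S ⊓ N(P), applied to u/θ, which is trivial on
the normalizer of that Sylow subgroup. -/
theorem IsWeakHom.hom_nrm_eq (hu : IsWeakHom (S : Subgroup G) n u) {P : Subgroup G}
    (hF : FullyNormalized p (S : Subgroup G) P) (θ : nrm P →* B)
    (hθ : ∀ x : nrm P, (x : G) ∈ nrm ((S : Subgroup G) ⊓ nrm P) → θ x = u x)
    {U : Subgroup G} (hn : n ≤ Nat.card U) (hU : U ≤ (S : Subgroup G) ⊓ nrm P) (x : nrm P)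
    (hx : U ≤ cj (x : G) S) : θ x = u x := by
  obtain ⟨T, hT⟩ := hF.exists_sylow S.2
  have hcj : ∀ y : nrm P, ((cj y (T : Subgroup (nrm P))).map (nrm P).subtype) ≤ cj (y : G) S := by
    rintro y _ ⟨z, hz, rfl⟩
    have := mem_cj.1 hz
    rw [hT] at this
    exact mem_cj.2 this
  have hcard : ∀ V : Subgroup (nrm P), Nat.card (V.map (nrm P).subtype) = Nat.card V :=
    fun V => Subgroup.card_map_of_injective (nrm P).subtype_injective
  have h1 := eq_one_of_eq_one_on_normalizer T n (fun y : nrm P => u y / θ y)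
    (fun t ht => by
      rw [hT] at ht
      rw [hθ t (mem_nrm_inf_of_mem_nrm_subgroupOf ht), div_self'])
    (fun V g h hV hVT hVg hVgh => by
      have h1 := hu.map_mul (V.map (nrm P).subtype) g h (by rwa [hcard])
        (by simpa using (Subgroup.map_mono (hVT.trans (cj_one _).ge)).trans (hcj 1))
        ((Subgroup.map_mono hVg).trans (hcj g)) ((Subgroup.map_mono hVgh).trans (hcj (g * h)))
      rw [Subgroup.coe_mul, h1, _root_.map_mul, mul_div_mul_comm])
    (U.subgroupOf (nrm P)) x ?_ ?_ ?_
  · exact (div_eq_one.1 h1).symm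
  · rwa [← hcard, Subgroup.map_subgroupOf_eq_of_le (hU.trans inf_le_right)]
  · rw [hT]
    intro y hy
    exact (hU hy).1
  · intro y hy
    rw [mem_cj, hT]
    have h := mem_cj.1 (hx hy)
    exact h

end Extension

/-! ### Existence of weak homomorphisms, by descent on the level. -/

section Existence

variable {p : ℕ} {G : Type v} [Group G] {B : Type*} [CommGroup B]
  [Finite G] [Fact p.Prime] {S : Sylow p G} {n r : ℕ} {u : G → B}

/-- A choice of well-placed representatives of conjugacy classes of subgroups. -/
theorem exists_wellPlaced_representative (S : Sylow p G) : ∃ rep : Subgroup G → Subgroup G,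
    (∀ g P, rep (cj g P) = rep P) ∧ ∀ P : Subgroup G, P ≠ ⊥ → IsPGroup p P →
      (∃ b : G, cj b⁻¹ P = rep P) ∧ ∃ m, WellPlaced p (S : Subgroup G) (rep P) m := by
  let s : Setoid (Subgroup G) :=
    { r := fun P Q => ∃ g, cj g P = Q
      iseqv := ⟨fun P => ⟨1, cj_one P⟩, fun {P Q} ⟨g, h⟩ => ⟨g⁻¹, by rw [← h, cj_inv_cj]⟩,
        fun {P Q R} ⟨g, h⟩ ⟨g', h'⟩ => ⟨g' * g, by rw [cj_mul, h, h']⟩⟩ }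
  choose! c m hc using fun (P : Subgroup G) (h : P ≠ ⊥) (h' : IsPGroup p P) =>
    exists_wellPlaced (S := S) P h h'
  let out : Subgroup G → Subgroup G := fun P => (Quotient.mk s P).out
  -- Passing through `out` before choosing the conjugator makes the representative depend only on
  -- the conjugacy class.
  have hout : ∀ P, ∃ g, cj g P = out P := fun P => s.symm (Quotient.mk_out (s := s) P)
  refine ⟨fun P => cj (c (out P)) (out P), fun g P => ?_, fun P hP hPp => ?_⟩
  · have : Quotient.mk s (cj g P) = Quotient.mk s P := Quotient.sound (s := s) (s.symm ⟨g, rfl⟩)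
    simp only [out, this]
  · obtain ⟨g, hg⟩ := hout P
    refine ⟨⟨(c (out P) * g)⁻¹, by rw [inv_inv, cj_mul, hg]⟩, _, hc _ ?_ ?_⟩
    · rw [← hg]; exact cj_ne_bot hP g
    · rw [← hg]; exact isPGroup_cj hPp g

/-- Only the elements g for which S ∩ gSg⁻¹ has order exactly n need a new value. It is obtained by
transport to well-placed representatives W, where `u` yields a homomorphism on N_G(W). -/
theorem IsWeakHom.exists_extension (hu : IsWeakHom (S : Subgroup G) (n + 1) u)
    (hn : 2 ≤ n) (hnS : n < Nat.card S)
    (hr : ∀ P m, WellPlaced p (S : Subgroup G) P m → m < r)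
    (hker : ∀ x ∈ rho p (S : Subgroup G) r S, u x = 1) :
    ∃ u' : G → B, IsWeakHom (S : Subgroup G) n u' ∧ ∀ x ∈ nrm (S : Subgroup G), u' x = u x := by
  classical
  have ne_bot : ∀ {P : Subgroup G}, Nat.card P = n → P ≠ ⊥ := by
    rintro P hP rfl
    rw [Subgroup.card_bot] at hP
    omega
  have lt_S : ∀ {P : Subgroup G}, Nat.card P = n → P ≤ S → P < S := by
    intro P hP hPS
    refine lt_of_le_of_ne hPS ?_
    rintro rfl
    exact hnS.ne' hP
  obtain ⟨rep, hrep, hrep'⟩ := exists_wellPlaced_representative S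
  have ha : ∀ P : Subgroup G, Nat.card P = n → P ≤ S →
      ∃ a : G, cj a⁻¹ P = rep P ∧ (S : Subgroup G) ⊓ nrm P ≤ cj a S := by
    intro P hP hPS
    obtain ⟨⟨b, hb⟩, m, hm⟩ := hrep' P (ne_bot hP) (S.2.to_le hPS)
    exact hm.fullyNormalized.exists_cj S.2 hb
  choose! a ha haS using ha
  have hθ : ∀ W : Subgroup G, (∃ m, WellPlaced p (S : Subgroup G) W m) → Nat.card W = n →
      ∃ θ : G → B, (∀ x ∈ nrm W, ∀ y ∈ nrm W, θ (x * y) = θ x * θ y) ∧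
        ∀ U : Subgroup G, n + 1 ≤ Nat.card U → U ≤ (S : Subgroup G) ⊓ nrm W → ∀ x ∈ nrm W,
          U ≤ cj x S → θ x = u x := by
    rintro W ⟨m, hm⟩ hW
    obtain ⟨θ, hθ⟩ := hu.exists_hom_nrm hker hm hW.ge (hr W m hm) (lt_S hW hm.le)
    refine ⟨fun x => if h : x ∈ nrm W then θ ⟨x, h⟩ else 1, fun x hx y hy => ?_,
      fun U hU hUS x hx hUx => ?_⟩
    · simp only [dif_pos hx, dif_pos hy, dif_pos (mul_mem hx hy)]
      exact _root_.map_mul θ ⟨x, hx⟩ ⟨y, hy⟩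
    · simp only [dif_pos hx]
      exact hu.hom_nrm_eq hm.fullyNormalized θ hθ hU hUS ⟨x, hx⟩ hUx
  choose! θ hθmul hθu using hθ
  have hrep_card : ∀ P : Subgroup G, Nat.card P = n → P ≤ S → Nat.card (rep P) = n := by
    intro P hP hPS
    rw [← ha P hP hPS, card_cj, hP]
  have hrepW : ∀ P : Subgroup G, Nat.card P = n → P ≤ S →
      ∃ m, WellPlaced p (S : Subgroup G) (rep P) m := fun P hP hPS =>
    (hrep' P (ne_bot hP) (S.2.to_le hPS)).2
  -- The value forced by factoring g through the representative of P: the conjugators `a` are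
  -- compatible with S ⊓ N(P), of order above n, so `u` already controls them, and `θ` supplies the
  -- factor in the normalizer.
  let φ : Subgroup G → G → B := fun P g =>
    u (a P) * θ (rep P) ((a P)⁻¹ * g * a (cj g⁻¹ P)) * (u (a (cj g⁻¹ P)))⁻¹
  have hmem : ∀ (P : Subgroup G) (g : G), Nat.card P = n → P ≤ S → P ≤ cj g S →
      (a P)⁻¹ * g * a (cj g⁻¹ P) ∈ nrm (rep P) := by
    intro P g hP hPS hPg
    refine cj_of_conj_mem_nrm (ha P hP hPS) ?_
    rw [ha _ (by rw [card_cj, hP]) (cj_inv_le.2 hPg), hrep]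
  have φ_mul : ∀ (P : Subgroup G) (g h : G), Nat.card P = n → P ≤ S → P ≤ cj g S →
      P ≤ cj (g * h) S → φ P (g * h) = φ P g * φ (cj g⁻¹ P) h := by
    intro P g h hP hPS hPg hPgh
    have h1 := hmem P g hP hPS hPg
    have h2 := hmem (cj g⁻¹ P) h (by rw [card_cj, hP]) (cj_inv_le.2 hPg) (by
      rw [cj_inv_le, ← cj_mul]; exact hPgh)
    have e : cj (g * h)⁻¹ P = cj h⁻¹ (cj g⁻¹ P) := by rw [mul_inv_rev, cj_mul]
    rw [hrep] at h2
    have h3 := hθmul (rep P) (hrepW P hP hPS) (hrep_card P hP hPS) _ h1 _ h2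
    simp only [mul_assoc, mul_inv_cancel_left] at h3
    simp only [φ, e, hrep, mul_assoc, h3]
    rw [inv_mul_cancel_left]
  have φ_eq : ∀ (P Q : Subgroup G) (g : G), Nat.card P = n → P < Q → Q ≤ S → Q ≤ cj g S →
      φ P g = u g := by
    intro P Q g hP hPQ hQS hQg
    have hPS := hPQ.le.trans hQS
    have hPg := hPQ.le.trans hQg
    have hP' : Nat.card (cj g⁻¹ P) = n := by rw [card_cj, hP]
    have hP'S := cj_inv_le.2 hPg
    -- R is larger than P and is compatible with every factor of the factorization, so `u` is
    -- multiplicative along it and φ gives back u(g).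
    set R := Q ⊓ nrm P with hR
    have hPR : P < R := lt_inf_nrm (S.2.to_le hQS) hPQ
    have hRn : n + 1 ≤ Nat.card R := by
      rw [← hP]
      exact card_lt_of_lt hPR
    have hRS : R ≤ S := inf_le_left.trans hQS
    have hRg : R ≤ cj g S := inf_le_left.trans hQg
    have hRa : R ≤ cj (a P) S := le_trans (inf_le_inf_right _ hQS) (haS P hP hPS)
    have hRgb : R ≤ cj (g * a (cj g⁻¹ P)) S := by
      rw [cj_mul, ← cj_inv_le]
      refine le_trans (le_inf (cj_inv_le.2 hRg) ?_) (haS _ hP' hP'S)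
      rw [nrm_cj]
      exact cj_mono _ inf_le_right
    have hx := hmem P g hP hPS hPg
    have hU : cj (a P)⁻¹ R ≤ (S : Subgroup G) ⊓ nrm (rep P) := by
      refine le_inf (cj_inv_le.2 hRa) ?_
      rw [← ha P hP hPS, nrm_cj]
      exact cj_mono _ inf_le_right
    have h1 := hθu (rep P) (hrepW P hP hPS) (hrep_card P hP hPS) (cj (a P)⁻¹ R)
      (by rwa [card_cj]) hU _ hx (by
        rw [cj_inv_le, ← cj_mul]
        simpa [mul_assoc] using hRgb)
    have e : g * a (cj g⁻¹ P) = a P * ((a P)⁻¹ * g * a (cj g⁻¹ P)) := by group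
    have h2 := hu.map_mul R g (a (cj g⁻¹ P)) hRn hRS hRg hRgb
    rw [e, hu.map_mul R _ _ hRn hRS hRa (e ▸ hRgb)] at h2
    simp only [φ, h1, h2, mul_inv_cancel_right]
  let u' : G → B := fun g =>
    if Nat.card ((S : Subgroup G) ⊓ cj g S : Subgroup G) = n then φ (S ⊓ cj g S) g else u g
  have hu'1 : ∀ (U : Subgroup G) (g : G), n + 1 ≤ Nat.card U → U ≤ S → U ≤ cj g S →
      u' g = u g := by
    intro U g hU hUS hUg
    refine if_neg fun h => ?_
    have := Subgroup.card_le_of_le (le_inf hUS hUg)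
    omega
  have hu'2 : ∀ (P : Subgroup G) (g : G), Nat.card P = n → P ≤ S → P ≤ cj g S →
      u' g = φ P g := by
    intro P g hP hPS hPg
    rcases (le_inf hPS hPg).eq_or_lt with h | h
    · simp only [u', ← h, hP, if_true]
    · rw [φ_eq P _ g hP h inf_le_left inf_le_right]
      exact hu'1 _ g (by rw [← hP]; exact card_lt_of_lt h) inf_le_left inf_le_right
  have hnrm : ∀ x ∈ nrm (S : Subgroup G), u' x = u x := fun x hx =>
    hu'1 S x hnS le_rfl (le_cj_of_mem_nrm le_rfl hx)
  refine ⟨u', ⟨fun s hs => ?_, fun U g h hU hUS hUg hUgh => ?_⟩, hnrm⟩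
  · rw [hnrm s (Subgroup.le_normalizer hs), hu.map_of_mem s hs]
  · rcases hU.eq_or_lt with hU | hU
    · rw [hu'2 U (g * h) hU.symm hUS hUgh, hu'2 U g hU.symm hUS hUg,
        hu'2 (cj g⁻¹ U) h (by rw [card_cj, hU]) (cj_inv_le.2 hUg)
          (by rw [cj_inv_le, ← cj_mul]; exact hUgh)]
      exact φ_mul U g h hU.symm hUS hUg hUgh
    · rw [hu'1 U (g * h) hU hUS hUgh, hu'1 U g hU hUS hUg,
        hu'1 (cj g⁻¹ U) h (by rwa [card_cj]) (cj_inv_le.2 hUg)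
          (by rw [cj_inv_le, ← cj_mul]; exact hUgh)]
      exact hu.map_mul U g h hU hUS hUg hUgh

/-- Every homomorphism on `N_G(S)/ρ^r(S)` extends to a weak homomorphism on `G`. -/
theorem exists_isWeakHom (hS : (S : Subgroup G) ≠ ⊥)
    (hr : 1 + Order.krullDim (RadicalSubgroup p G) ≤ (r : WithBot ℕ∞))
    (f : nrm (S : Subgroup G) ⧸ rhoIn p (S : Subgroup G) r →* B) :
    ∃ u : G → B, IsWeakHom (S : Subgroup G) 2 u ∧
      ∀ x : nrm (S : Subgroup G), u x = f (QuotientGroup.mk x) := by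
  classical
  have hr' : ∀ P m, WellPlaced p (S : Subgroup G) P m → m < r := fun P m h =>
    h.lt_of_krullDim_le hS hr
  -- The descent starts at level |S|, where multiplicativity is only required within N_G(S), so the
  -- value 1 outside N_G(S) is harmless.
  have key : ∀ n, n ≤ Nat.card S → 2 ≤ n → ∃ u : G → B, IsWeakHom (S : Subgroup G) n u ∧
      ∀ x : nrm (S : Subgroup G), u x = f (QuotientGroup.mk x) := by
    intro n hn
    induction hn using Nat.decreasingInduction with
    | self =>
      intro _
      have hS1 : ∀ s (hs : s ∈ (S : Subgroup G)),
          f (QuotientGroup.mk ⟨s, Subgroup.le_normalizer hs⟩) = 1 := by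
        intro s hs
        have : (⟨s, Subgroup.le_normalizer hs⟩ : nrm (S : Subgroup G)) ∈
            rhoIn p (S : Subgroup G) r := by
          refine Subgroup.mem_subgroupOf.2 (rho_one_le p _ _ hS le_rfl r (mem_rho_one.2
            ⟨Subgroup.le_normalizer hs, ?_⟩))
          exact le_abelianPPrimeResidual (T := (S : Subgroup G).subgroupOf (nrm S))
            (S.2.comap_of_injective _ (nrm (S : Subgroup G)).subtype_injective) hs
        rw [(QuotientGroup.eq_one_iff _).2 this, map_one]
      refine ⟨fun g => if h : g ∈ nrm (S : Subgroup G) then f (QuotientGroup.mk ⟨g, h⟩) else 1,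
        ⟨fun s hs => ?_, fun U g h hU hUS hUg hUgh => ?_⟩, fun x => ?_⟩
      · rw [dif_pos (Subgroup.le_normalizer hs)]
        exact hS1 s hs
      · have hUS' : U = S := Subgroup.eq_of_le_of_card_ge hUS hU
        have hg : g ∈ nrm (S : Subgroup G) := mem_nrm_of_cj_le (hUS' ▸ hUg)
        have hgh : g * h ∈ nrm (S : Subgroup G) := mem_nrm_of_cj_le (hUS' ▸ hUgh)
        have hh : h ∈ nrm (S : Subgroup G) := (Subgroup.mul_mem_cancel_left _ hg).1 hgh
        rw [dif_pos hg, dif_pos hh, dif_pos hgh, ← map_mul]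
        rfl
      · simp
    | of_succ n hn ih =>
      intro h2
      obtain ⟨u, hu, huf⟩ := ih (by omega)
      obtain ⟨u', hu', huu'⟩ := hu.exists_extension h2 hn hr' fun x hx => by
        have hxS := rho_le_nrm p _ _ _ hx
        have h1 : (⟨x, hxS⟩ : nrm (S : Subgroup G)) ∈ rhoIn p (S : Subgroup G) r := hx
        rw [huf ⟨x, hxS⟩, (QuotientGroup.eq_one_iff _).2 h1, map_one]
      exact ⟨u', hu', fun x => (huu' x x.2).trans (huf x)⟩
  have h2 : 2 ≤ Nat.card S := (Subgroup.one_lt_card_iff_ne_bot _).2 hS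
  exact key 2 h2 le_rfl

end Existence

/-! ### First homology of the nerve of a category -/

section NerveHomology

open Simplicial

/-- The coefficient module `ℤ`. -/
noncomputable abbrev intCoeff : ModuleCat.{v} ℤ := ModuleCat.of ℤ (ULift.{v} ℤ)

/-- The morphism `ℤ ⟶ M` given by an element of `M`. -/
noncomputable def ofElement {M : ModuleCat.{v} ℤ} (m : M) : intCoeff.{v} ⟶ M :=
  ModuleCat.ofHom ((LinearMap.toSpanSingleton ℤ M m).comp ULift.moduleEquiv.toLinearMap)

theorem ofElement_apply {M : ModuleCat.{v} ℤ} (m : M) : (ofElement m).hom ⟨1⟩ = m := by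
  simp only [ofElement, ModuleCat.hom_ofHom, LinearMap.coe_comp, Function.comp_apply,
    LinearEquiv.coe_coe, ULift.moduleEquiv_apply, LinearMap.toSpanSingleton_apply]
  exact (int_smul_eq_zsmul _ _ _).trans (one_zsmul m)

theorem intCoeff_hom_ext {M : ModuleCat.{v} ℤ} {f g : intCoeff.{v} ⟶ M}
    (h : f.hom ⟨1⟩ = g.hom ⟨1⟩) : f = g := by
  ext x
  obtain ⟨x⟩ := x
  have e : (⟨x⟩ : ULift.{v} ℤ) = x • ⟨1⟩ := by
    ext
    simp
  rw [e, map_zsmul, map_zsmul]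
  exact congrArg _ h

variable (C : Type v) [SmallCategory C]

/-- The integral chain complex of the nerve of a category. -/
noncomputable abbrev nerveComplex : ChainComplex (ModuleCat.{v} ℤ) ℕ :=
  (nerve C).chainComplex intCoeff.{v}

variable {C}

/-- The chain of a simplex of the nerve. -/
noncomputable def simplexChain {n : ℕ} (x : ComposableArrows C n) : (nerveComplex C).X n :=
  (SSet.ιChainComplex (X := nerve C) (R := intCoeff.{v}) (n := n) x).hom ⟨1⟩

theorem nerveComplex_hom_ext {n : ℕ} {M : ModuleCat.{v} ℤ} {f g : (nerveComplex C).X n ⟶ M}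
    (h : ∀ x : ComposableArrows C n, f.hom (simplexChain x) = g.hom (simplexChain x)) : f = g :=
  SSet.chainComplex_hom_ext fun x => intCoeff_hom_ext (h x)

/-- The morphism on chains with given values on simplices. -/
noncomputable def chainDesc {n : ℕ} {M : ModuleCat.{v} ℤ} (a : ComposableArrows C n → M) :
    (nerveComplex C).X n ⟶ M :=
  ((nerve C).isColimitChainComplexXCofan intCoeff.{v} n).desc
    (Cofan.mk _ fun x => ofElement (a x))

@[simp] theorem chainDesc_simplexChain {n : ℕ} {M : ModuleCat.{v} ℤ}
    (a : ComposableArrows C n → M) (x : ComposableArrows C n) :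
    (chainDesc a).hom (simplexChain x) = a x := by
  have h := ((nerve C).isColimitChainComplexXCofan intCoeff.{v} n).fac
    (Cofan.mk _ fun x => ofElement (a x)) ⟨x⟩
  have h2 := congrArg (fun f => f.hom ⟨1⟩) h
  exact h2.trans (ofElement_apply _)

theorem d_simplexChain {n : ℕ} (x : ComposableArrows C (n + 1)) :
    ((nerveComplex C).d (n + 1) n).hom (simplexChain x) =
      ∑ i : Fin (n + 2), (-1 : ℤ) ^ i.val • simplexChain ((nerve C).δ i x) := by
  have h := congrArg (fun f => f.hom ⟨1⟩)
    (SSet.ιChainComplex_d (X := nerve C) (R := intCoeff.{v}) x)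
  refine h.trans ?_
  simp only [ModuleCat.hom_sum, LinearMap.sum_apply]
  rfl

theorem d_mk₁ {X Y : C} (f : X ⟶ Y) :
    ((nerveComplex C).d 1 0).hom (simplexChain (ComposableArrows.mk₁ f)) =
      simplexChain (ComposableArrows.mk₀ Y) - simplexChain (ComposableArrows.mk₀ X) := by
  rw [d_simplexChain, Fin.sum_univ_two]
  have h0 : (nerve C).δ (0 : Fin 2) (ComposableArrows.mk₁ f) = ComposableArrows.mk₀ Y :=
    ComposableArrows.ext₀ rfl
  have h1 : (nerve C).δ (1 : Fin 2) (ComposableArrows.mk₁ f) = ComposableArrows.mk₀ X :=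
    ComposableArrows.ext₀ rfl
  rw [h0, h1]
  simp [sub_eq_add_neg]

theorem d_mk₂ {X Y Z : C} (f : X ⟶ Y) (g : Y ⟶ Z) :
    ((nerveComplex C).d 2 1).hom (simplexChain (ComposableArrows.mk₂ f g)) =
      simplexChain (ComposableArrows.mk₁ g) - simplexChain (ComposableArrows.mk₁ (f ≫ g)) +
        simplexChain (ComposableArrows.mk₁ f) := by
  rw [d_simplexChain, Fin.sum_univ_three, nerve.δ₀_mk₂_eq, nerve.δ₁_mk₂_eq, nerve.δ₂_mk₂_eq]
  simp [sub_eq_add_neg]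

variable (C) in
/-- The quotient of the 1-chains by the boundaries. -/
noncomputable abbrev chainQuotient : ModuleCat.{v} ℤ := (nerveComplex C).opcycles 1

/-- The class of an arrow in the quotient of the 1-chains by the boundaries. -/
noncomputable def arrowClass {X Y : C} (f : X ⟶ Y) : chainQuotient C :=
  ((nerveComplex C).pOpcycles 1).hom (simplexChain (ComposableArrows.mk₁ f))

/-- This is the boundary of the 2-simplex (f, g). -/
theorem arrowClass_comp {X Y Z : C} (f : X ⟶ Y) (g : Y ⟶ Z) :
    arrowClass (f ≫ g) = arrowClass f + arrowClass g := by
  have h := congrArg (fun φ => φ.hom (simplexChain (ComposableArrows.mk₂ f g)))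
    ((nerveComplex C).d_pOpcycles 2 1)
  simp only [ModuleCat.hom_comp, LinearMap.comp_apply, d_mk₂, map_add, map_sub] at h
  have h' : arrowClass g - arrowClass (f ≫ g) + arrowClass f = 0 := h
  rw [sub_add_eq_add_sub, sub_eq_zero] at h'
  rw [← h', add_comm]

/-- A computation of the first homology of a category from an additive function on arrows. -/
theorem nonempty_homology_one_addEquiv {A : Type v} [AddCommGroup A]
    (F : ∀ {X Y : C}, (X ⟶ Y) → A)
    (hF : ∀ {X Y Z : C} (f : X ⟶ Y) (g : Y ⟶ Z), F (f ≫ g) = F f + F g)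
    (ψ : A →+ chainQuotient C) (τ : C → chainQuotient C)
    (hψ : ∀ {X Y : C} (f : X ⟶ Y), arrowClass f = ψ (F f) + τ Y - τ X)
    (hsurj : ∀ a, ∃ (X : C) (f : X ⟶ X), F f = a) :
    Nonempty (((nerve C).homology intCoeff.{v} 1 : ModuleCat.{v} ℤ) ≃+ A) := by
  let K := nerveComplex C
  let F₁ : K.X 1 ⟶ ModuleCat.of ℤ A := chainDesc fun x => F (x.map' 0 1)
  have hF₁ : ∀ {X Y : C} (f : X ⟶ Y), F₁.hom (simplexChain (ComposableArrows.mk₁ f)) = F f :=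
    fun f => chainDesc_simplexChain _ _
  have hd : K.d 2 1 ≫ F₁ = 0 := by
    refine nerveComplex_hom_ext fun x => ?_
    obtain ⟨X, Y, Z, f, g, rfl⟩ := ComposableArrows.mk₂_surjective x
    rw [ModuleCat.hom_comp, LinearMap.comp_apply, d_mk₂, map_add, map_sub, hF₁, hF₁, hF₁, hF]
    simp
  let T : K.X 0 ⟶ K.opcycles 1 := chainDesc fun x => τ (x.obj' 0)
  have hT : ∀ X : C, T.hom (simplexChain (ComposableArrows.mk₀ X)) = τ X :=
    fun X => chainDesc_simplexChain _ _
  let Ψ : ModuleCat.of ℤ A ⟶ chainQuotient C := ModuleCat.ofHom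
    { ψ with map_smul' := fun n a => (map_zsmul ψ n a).trans (int_smul_eq_zsmul _ n _).symm }
  -- The τ terms factor through the boundary map and vanish on cycles. Hence Ψ ∘ Θ is the inclusion
  -- of H_1 into chains modulo boundaries, and Θ is injective.
  have key : K.pOpcycles 1 = F₁ ≫ Ψ + K.d 1 0 ≫ T := by
    refine nerveComplex_hom_ext fun x => ?_
    obtain ⟨X, Y, f, rfl⟩ := ComposableArrows.mk₁_surjective x
    rw [ModuleCat.hom_add, LinearMap.add_apply, ModuleCat.hom_comp, LinearMap.comp_apply,
      ModuleCat.hom_comp, LinearMap.comp_apply, d_mk₁, map_sub, hF₁, hT, hT, ← add_sub_assoc]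
    exact hψ f
  let Θ : K.homology 1 ⟶ ModuleCat.of ℤ A := K.homologyι 1 ≫ K.descOpcycles F₁ 2 (by simp) hd
  have hπ : K.homologyπ 1 ≫ Θ = K.iCycles 1 ≫ F₁ := by
    simp [Θ]
  have hι : Θ ≫ Ψ = K.homologyι 1 := by
    rw [← cancel_epi (K.homologyπ 1), ← Category.assoc, hπ, K.homology_π_ι, key,
      Preadditive.comp_add, K.iCycles_d_assoc, zero_comp, add_zero, Category.assoc]
  have : Mono (Θ ≫ Ψ) := hι ▸ inferInstance
  have hmono : Mono Θ := mono_of_mono Θ Ψ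
  have hinj : Function.Injective Θ.hom := (ModuleCat.mono_iff_injective Θ).1 hmono
  refine ⟨AddEquiv.ofBijective Θ.hom.toAddMonoidHom ⟨hinj, fun a => ?_⟩⟩
  obtain ⟨X, f, rfl⟩ := hsurj a
  -- An endomorphism is a 1-cycle, so its value under `F` is attained on homology.
  let z : intCoeff.{v} ⟶ K.X 1 := ofElement (simplexChain (ComposableArrows.mk₁ f))
  have hz : z ≫ K.d 1 0 = 0 := by
    refine intCoeff_hom_ext ?_
    rw [ModuleCat.hom_comp, LinearMap.comp_apply, ofElement_apply, d_mk₁, sub_self]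
    rfl
  refine ⟨(K.liftCycles z 0 (by simp) hz ≫ K.homologyπ 1).hom ⟨1⟩, ?_⟩
  have h1 : (K.liftCycles z 0 (by simp) hz ≫ K.homologyπ 1) ≫ Θ = z ≫ F₁ := by
    rw [Category.assoc, hπ, ← Category.assoc, K.liftCycles_i]
  refine (congrArg (fun φ => φ.hom ⟨1⟩) h1).trans ?_
  rw [ModuleCat.hom_comp, LinearMap.comp_apply, ofElement_apply]
  exact hF₁ f

end NerveHomology

/-! ### First homology of the orbit category -/

section OrbitHomology

variable {p : ℕ} {G : Type v} [Group G]

/-- The map `G/P ⟶ G/Q`, `xP ↦ xgQ`, for `P ≤ gQg⁻¹`. -/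
def orbitMap (X Y : OrbitCategory p G) (g : G) (h : X.P ≤ cj g Y.P) : X ⟶ Y :=
  show (G ⧸ X.P) →[G] (G ⧸ Y.P) from
  { toFun := Quotient.lift (fun x : G => (QuotientGroup.mk (x * g) : G ⧸ Y.P)) fun x y hxy => by
      have h1 : x⁻¹ * y ∈ X.P := QuotientGroup.leftRel_apply.1 hxy
      refine QuotientGroup.eq.2 ?_
      have h2 := mem_cj.1 (h h1)
      simpa [mul_assoc] using h2
    map_smul' := by
      rintro a ⟨x⟩
      exact congrArg QuotientGroup.mk (mul_assoc a x g) }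

theorem orbitMap_apply (X Y : OrbitCategory p G) (g : G) (h : X.P ≤ cj g Y.P) (x : G) :
    (show (G ⧸ X.P) →[G] (G ⧸ Y.P) from orbitMap X Y g h) (QuotientGroup.mk x) =
      QuotientGroup.mk (x * g) := rfl

theorem orbit_hom_ext {X Y : OrbitCategory p G} {f f' : X ⟶ Y}
    (h : (show (G ⧸ X.P) →[G] (G ⧸ Y.P) from f) (QuotientGroup.mk 1) =
      (show (G ⧸ X.P) →[G] (G ⧸ Y.P) from f') (QuotientGroup.mk 1)) : f = f' := by
  refine MulActionHom.ext (f := (show (G ⧸ X.P) →[G] (G ⧸ Y.P) from f)) ?_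
  rintro ⟨x⟩
  have e : (Quot.mk _ x : G ⧸ X.P) = x • (QuotientGroup.mk 1 : G ⧸ X.P) :=
    congrArg QuotientGroup.mk (mul_one x).symm
  rw [e, map_smul]
  exact (congrArg (x • ·) h).trans (map_smul _ _ _).symm

theorem orbitMap_comp {X Y Z : OrbitCategory p G} {g h : G} (hg : X.P ≤ cj g Y.P)
    (hh : Y.P ≤ cj h Z.P) :
    orbitMap X Y g hg ≫ orbitMap Y Z h hh =
      orbitMap X Z (g * h) (by rw [cj_mul]; exact hg.trans (cj_mono g hh)) := by
  refine orbit_hom_ext ?_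
  exact congrArg QuotientGroup.mk (mul_assoc 1 g h)

theorem orbitMap_eq {X Y : OrbitCategory p G} {g g' : G} (hg : X.P ≤ cj g Y.P)
    (hg' : X.P ≤ cj g' Y.P) (h : g⁻¹ * g' ∈ Y.P) : orbitMap X Y g hg = orbitMap X Y g' hg' := by
  refine orbit_hom_ext ?_
  rw [orbitMap_apply, orbitMap_apply, one_mul, one_mul]
  exact QuotientGroup.eq.2 h

/-- A representative `g` of the coset `gQ` to which an arrow `G/P ⟶ G/Q` maps `P`. -/
noncomputable def orbitRep {X Y : OrbitCategory p G} (f : X ⟶ Y) : G :=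
  ((show (G ⧸ X.P) →[G] (G ⧸ Y.P) from f) (QuotientGroup.mk 1)).out

theorem le_cj_orbitRep {X Y : OrbitCategory p G} (f : X ⟶ Y) : X.P ≤ cj (orbitRep f) Y.P := by
  intro x hx
  rw [mem_cj, mul_assoc, ← QuotientGroup.eq]
  let f' := (show (G ⧸ X.P) →[G] (G ⧸ Y.P) from f)
  have h1 : (QuotientGroup.mk (orbitRep f) : G ⧸ Y.P) = f' (QuotientGroup.mk 1) :=
    QuotientGroup.out_eq' _
  have h2 : (QuotientGroup.mk (x * orbitRep f) : G ⧸ Y.P) = x • f' (QuotientGroup.mk 1) := by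
    rw [← h1]
    rfl
  rw [h1, h2, ← map_smul]
  congr 1
  exact QuotientGroup.eq.2 (by simpa using hx)

theorem orbitMap_orbitRep {X Y : OrbitCategory p G} (f : X ⟶ Y) :
    orbitMap X Y (orbitRep f) (le_cj_orbitRep f) = f := by
  refine orbit_hom_ext ?_
  rw [orbitMap_apply, one_mul]
  exact QuotientGroup.out_eq' _

theorem orbitRep_orbitMap {X Y : OrbitCategory p G} {g : G} (h : X.P ≤ cj g Y.P) :
    g⁻¹ * orbitRep (orbitMap X Y g h) ∈ Y.P := by
  rw [← QuotientGroup.eq]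
  refine Eq.trans ?_ (QuotientGroup.out_eq' _).symm
  rw [orbitMap_apply, one_mul]

variable (S : Sylow p G) (hS : (S : Subgroup G) ≠ ⊥)

/-- The object `G/S` of the orbit category. -/
abbrev sylowObj : OrbitCategory p G := ⟨S, hS, S.2⟩

/-- The object `G/U` of the orbit category for a nontrivial subgroup `U` of `S`. -/
abbrev subObj {U : Subgroup G} (hU : U ≠ ⊥) (hUS : U ≤ S) : OrbitCategory p G :=
  ⟨U, hU, S.2.to_le hUS⟩

/-- The difference of the classes of the arrows `G/U ⟶ G/S` given by `g` and `1`. -/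
noncomputable def loopClass {U : Subgroup G} (hU : U ≠ ⊥) (hUS : U ≤ S) (g : G)
    (hg : U ≤ cj g S) : chainQuotient (OrbitCategory p G) :=
  arrowClass (orbitMap (subObj S hU hUS) (sylowObj S hS) g hg) -
    arrowClass (orbitMap (subObj S hU hUS) (sylowObj S hS) 1 (hUS.trans (cj_one _).ge))

variable {S}

/-- Precomposing with G/U → G/V adds the same class to both terms of the difference. -/
theorem loopClass_mono {U V : Subgroup G} (hU : U ≠ ⊥) (hV : V ≠ ⊥) (hUV : U ≤ V) (hVS : V ≤ S)
    {g : G} (hg : V ≤ cj g S) :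
    loopClass S hS hU (hUV.trans hVS) g (hUV.trans hg) = loopClass S hS hV hVS g hg := by
  have key : ∀ (x : G) (hx : V ≤ cj x S),
      arrowClass (orbitMap (subObj S hU (hUV.trans hVS)) (sylowObj S hS) x (hUV.trans hx)) =
        arrowClass (orbitMap (subObj S hU (hUV.trans hVS)) (subObj S hV hVS) 1
          (hUV.trans (cj_one _).ge)) +
        arrowClass (orbitMap (subObj S hV hVS) (sylowObj S hS) x hx) := by
    intro x hx
    rw [← arrowClass_comp, orbitMap_comp (g := 1) (h := x)]
    exact congrArg arrowClass (orbitMap_eq _ _ (by simp [one_mem]))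
  rw [loopClass, loopClass, key g hg, key 1 (hVS.trans (cj_one _).ge), add_sub_add_left_eq_sub]

/-- Precomposing with the isomorphism G/U → G/g⁻¹Ug given by g turns the last difference into [gh] −
[g], and the sum telescopes. -/
theorem loopClass_mul {U : Subgroup G} (hU : U ≠ ⊥) (hUS : U ≤ S) {g h : G} (hg : U ≤ cj g S)
    (hgh : U ≤ cj (g * h) S) :
    loopClass S hS hU hUS (g * h) hgh = loopClass S hS hU hUS g hg +
      loopClass S hS (cj_ne_bot hU g⁻¹) (cj_inv_le.2 hg) h
        (by rw [cj_inv_le, ← cj_mul]; exact hgh) := by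
  have key : ∀ (x : G) (hx : cj g⁻¹ U ≤ cj x S),
      arrowClass (orbitMap (subObj S (cj_ne_bot hU g⁻¹) (cj_inv_le.2 hg)) (sylowObj S hS) x hx) =
        arrowClass (orbitMap (subObj S hU hUS) (sylowObj S hS) (g * x)
          (by rw [cj_mul, ← cj_inv_le]; exact hx)) -
        arrowClass (orbitMap (subObj S hU hUS) (subObj S (cj_ne_bot hU g⁻¹) (cj_inv_le.2 hg)) g
          (cj_cj_inv g U).ge) := by
    intro x hx
    rw [eq_sub_iff_add_eq', ← arrowClass_comp, orbitMap_comp (g := g) (h := x)]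
  rw [loopClass, loopClass, loopClass, key, key]
  simp only [mul_one]
  abel

open Classical in
/-- The universal weak homomorphism, with values in the quotient of the 1-chains by the
boundaries. -/
noncomputable def universalWeakHom (g : G) : Multiplicative (chainQuotient (OrbitCategory p G)) :=
  if h : (S : Subgroup G) ⊓ cj g S ≠ ⊥ then
    Multiplicative.ofAdd (loopClass S hS h inf_le_left g inf_le_right) else 1

theorem universalWeakHom_eq {U : Subgroup G} (hU : U ≠ ⊥) (hUS : U ≤ S) {g : G}
    (hg : U ≤ cj g S) :
    universalWeakHom hS g = Multiplicative.ofAdd (loopClass S hS hU hUS g hg) := by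
  have hle : U ≤ (S : Subgroup G) ⊓ cj g S := le_inf hUS hg
  have h : (S : Subgroup G) ⊓ cj g S ≠ ⊥ := fun h' => hU (le_bot_iff.1 (h' ▸ hle))
  rw [universalWeakHom, dif_pos h, ← loopClass_mono hS hU h hle inf_le_left inf_le_right]

theorem isWeakHom_universalWeakHom [Finite G] :
    IsWeakHom (S : Subgroup G) 2 (universalWeakHom (p := p) (S := S) hS) := by
  refine ⟨fun s hs => ?_, fun U g h hn hUS hUg hUgh => ?_⟩
  · rw [universalWeakHom_eq hS hS le_rfl (cj_eq_of_mem hs).ge, loopClass, sub_eq_zero.2]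
    · rfl
    · exact congrArg arrowClass (orbitMap_eq _ _ (by simpa using inv_mem hs))
  · have hU : U ≠ ⊥ := (Subgroup.one_lt_card_iff_ne_bot _).1 hn
    rw [universalWeakHom_eq hS hU hUS hUgh, universalWeakHom_eq hS hU hUS hUg,
      universalWeakHom_eq hS (cj_ne_bot hU g⁻¹) (cj_inv_le.2 hUg)
        (by rw [cj_inv_le, ← cj_mul]; exact hUgh), loopClass_mul hS hU hUS hUg hUgh]
    rfl

end OrbitHomology

/-- `H_1(O_p^*(G)) ≅ N_G(S)/ρ^r(S)`. -/
theorem nonempty_orbitHomologyOne_addEquiv {p : ℕ} [Fact p.Prime] {G : Type v} [Group G]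
    [Finite G] (S : Sylow p G) (hS : (S : Subgroup G) ≠ ⊥) {r : ℕ}
    (hr : 1 + Order.krullDim (RadicalSubgroup p G) ≤ (r : WithBot ℕ∞)) :
    Nonempty (orbitHomologyOne p G ≃+
      Additive (nrm (S : Subgroup G) ⧸ rhoIn p (S : Subgroup G) r)) := by
  let N := nrm (S : Subgroup G)
  have hcomm : IsMulCommutative (N ⧸ rhoIn p (S : Subgroup G) r) :=
    Subgroup.Normal.quotient_commutative_iff_commutator_le.2 (commutator_le_rhoIn p _ hS r)
  let _ : CommGroup (N ⧸ rhoIn p (S : Subgroup G) r) := { mul_comm := hcomm.is_comm.comm }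
  -- `u` extends the quotient map of N_G(S) itself. The universal weak homomorphism kills ρ^r(S) and
  -- so induces `ψ` on the quotient. It agrees with ψ ∘ u on N_G(S), hence wherever S ∩ gSg⁻¹ ≠ 1.
  obtain ⟨u, hu, huA⟩ := exists_isWeakHom hS hr (MonoidHom.id _)
  have hr1 : 1 ≤ r := (WellPlaced.top (p := p) (S := (S : Subgroup G))).lt_of_krullDim_le hS hr
  have hv := isWeakHom_universalWeakHom (p := p) hS
  have h2 : 2 ≤ Nat.card S := (Subgroup.one_lt_card_iff_ne_bot _).2 hS
  let ψ : N ⧸ rhoIn p (S : Subgroup G) r →*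
      Multiplicative (chainQuotient (OrbitCategory p G)) :=
    QuotientGroup.lift _ (hv.nrmHom h2 le_rfl) fun x hx =>
      hv.map_eq_one_of_mem_rho r hr1 hS le_rfl hx
  have hψ : ∀ {U : Subgroup G} {g : G}, U ≠ ⊥ → U ≤ S → U ≤ cj g S →
      universalWeakHom hS g = ψ (u g) := by
    intro U g hU hUS hUg
    refine hv.eq_of_eq_on_nrm (hu.comp ψ) (fun x hx => ?_)
      ((Subgroup.one_lt_card_iff_ne_bot _).2 hU) hUS hUg
    have := huA ⟨x, hx⟩
    rw [this]
    rfl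
  have ht : ∀ X : OrbitCategory p G, ∃ t : G, X.P ≤ cj t S := fun X => by
    obtain ⟨t, ht⟩ := exists_cj_le_sylow S X.isPGroup
    exact ⟨t⁻¹, cj_le_inv.1 ht⟩
  choose t ht using ht
  have hmem : ∀ {X Y : OrbitCategory p G} (g : G), X.P ≤ cj g Y.P →
      cj (t X)⁻¹ X.P ≤ S ∧ cj (t X)⁻¹ X.P ≤ cj ((t X)⁻¹ * g * t Y) S := by
    intro X Y g hg
    refine ⟨cj_inv_le.2 (ht X), ?_⟩
    rw [mul_assoc, cj_mul, cj_mul]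
    exact cj_mono _ (hg.trans (cj_mono g (ht Y)))
  have hF : ∀ {X Y : OrbitCategory p G} (g : G) (hg : X.P ≤ cj g Y.P),
      u ((t X)⁻¹ * orbitRep (orbitMap X Y g hg) * t Y) = u ((t X)⁻¹ * g * t Y) := by
    intro X Y g hg
    have h1 := orbitRep_orbitMap hg
    have e : (t X)⁻¹ * orbitRep (orbitMap X Y g hg) * t Y = ((t X)⁻¹ * g * t Y) *
        ((t Y)⁻¹ * (g⁻¹ * orbitRep (orbitMap X Y g hg)) * t Y) := by group
    rw [e]
    refine hu.map_mul_mem ((Subgroup.one_lt_card_iff_ne_bot _).2 (cj_ne_bot X.ne_bot _))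
      (hmem g hg).1 (hmem g hg).2 ?_
    exact mem_cj.1 (ht Y h1)
  -- The chosen elements t move each object into S: the arrow given by g has value u(t_X⁻¹ g t_Y),
  -- and the correction τ at X is minus the class of the arrow X → G/S given by t_X.
  refine nonempty_homology_one_addEquiv
    (fun {X Y} f => Additive.ofMul (u ((t X)⁻¹ * orbitRep f * t Y))) ?_
    (MonoidHom.toAdditiveLeft ψ)
    (fun X => -arrowClass (orbitMap X (sylowObj S hS) (t X) (ht X))) ?_ ?_
  · intro X Y Z f g
    rw [← ofMul_mul]
    congr 1
    conv_lhs => rw [← orbitMap_orbitRep f, ← orbitMap_orbitRep g, orbitMap_comp, hF]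
    have hf := le_cj_orbitRep f
    have hg := le_cj_orbitRep g
    have e : (t X)⁻¹ * (orbitRep f * orbitRep g) * t Z =
        ((t X)⁻¹ * orbitRep f * t Y) * ((t Y)⁻¹ * orbitRep g * t Z) := by group
    rw [e]
    refine hu.map_mul (cj (t X)⁻¹ X.P) _ _
      ((Subgroup.one_lt_card_iff_ne_bot _).2 (cj_ne_bot X.ne_bot _)) (hmem _ hf).1 (hmem _ hf).2 ?_
    rw [← e]
    exact (hmem (Y := Z) _ (by rw [cj_mul]; exact hf.trans (cj_mono _ hg))).2
  · intro X Y f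
    obtain ⟨g, hg, rfl⟩ : ∃ g hg, f = orbitMap X Y g hg :=
      ⟨_, le_cj_orbitRep f, (orbitMap_orbitRep f).symm⟩
    have hU := cj_ne_bot X.ne_bot (t X)⁻¹
    have h1 : MonoidHom.toAdditiveLeft ψ
        (Additive.ofMul (u ((t X)⁻¹ * orbitRep (orbitMap X Y g hg) * t Y))) =
        loopClass S hS hU (hmem g hg).1 _ (hmem g hg).2 := by
      have h2 := (hψ hU (hmem g hg).1 (hmem g hg).2).symm.trans
        (universalWeakHom_eq hS hU (hmem g hg).1 (hmem g hg).2)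
      rw [hF]
      exact h2
    have key : ∀ (x : G) (hx : cj (t X)⁻¹ X.P ≤ cj x S),
        arrowClass (orbitMap (subObj S hU (hmem g hg).1) (sylowObj S hS) x hx) =
          arrowClass (orbitMap X (sylowObj S hS) (t X * x)
            (by rw [cj_mul, ← cj_inv_le]; exact hx)) -
          arrowClass (orbitMap X (subObj S hU (hmem g hg).1) (t X) (cj_cj_inv _ _).ge) := by
      intro x hx
      rw [eq_sub_iff_add_eq', ← arrowClass_comp, orbitMap_comp (g := t X) (h := x)]
    have h3 : arrowClass (orbitMap X (sylowObj S hS) (g * t Y)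
        (by rw [cj_mul]; exact hg.trans (cj_mono g (ht Y)))) =
        arrowClass (orbitMap X Y g hg) +
          arrowClass (orbitMap Y (sylowObj S hS) (t Y) (ht Y)) := by
      rw [← arrowClass_comp, orbitMap_comp (g := g) (h := t Y)]
    rw [h1, loopClass, key, key]
    simp only [mul_one, mul_assoc, mul_inv_cancel_left]
    rw [h3]
    abel
  -- The element t chosen for G/S need not be 1, but it lies in N_G(S) and conjugation by it is
  -- invisible in the abelian quotient.
  · rintro ⟨x⟩
    let X := sylowObj S hS
    have htX : t X ∈ N := mem_nrm_of_cj_le (ht X)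
    have hxx : (x : G) ∈ N := x.2
    refine ⟨X, orbitMap X X x (mem_nrm.1 x.2).ge, ?_⟩
    refine congrArg Additive.ofMul ((hF _ _).trans ?_)
    have h1 : u ((t X)⁻¹ * x * t X) = QuotientGroup.mk ((⟨t X, htX⟩ : N)⁻¹ * x * ⟨t X, htX⟩) :=
      huA ((⟨t X, htX⟩ : N)⁻¹ * x * ⟨t X, htX⟩)
    rw [h1, QuotientGroup.mk_mul, QuotientGroup.mk_mul, mul_right_comm, QuotientGroup.mk_inv,
      inv_mul_cancel, one_mul]
    rfl

/-! ### Relative traces -/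

section Trace

variable {k : Type*} [Field k] {G : Type*} [Group G] [Finite G]
  {V : Type*} [AddCommGroup V] [Module k V] {W : Type*} [AddCommGroup W] [Module k W]

/-- The elements of a subgroup of a finite group, as a finset. -/
noncomputable def elems (P : Subgroup G) : Finset G := (P : Set G).toFinite.toFinset

@[simp] theorem mem_elems {P : Subgroup G} {x : G} : x ∈ elems P ↔ x ∈ P := by
  simp [elems]

theorem card_elems (P : Subgroup G) : (elems P).card = Nat.card P := by
  rw [elems, ← Nat.card_eq_card_finite_toFinset]
  rfl

theorem sum_elems_eq_sum_subtype {M : Type*} [AddCommMonoid M] (P : Subgroup G) [Fintype P]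
    (f : G → M) : ∑ x ∈ elems P, f x = ∑ x : P, f x :=
  Finset.sum_subtype _ (fun _ => mem_elems) f

/-- The trace `∑ x ∈ P, x v` of the action of a subgroup. -/
noncomputable def relTrace (ρ : Representation k G V) (P : Subgroup G) : V →ₗ[k] V :=
  ∑ x ∈ elems P, ρ x

theorem relTrace_apply (ρ : Representation k G V) (P : Subgroup G) (v : V) :
    relTrace ρ P v = ∑ x ∈ elems P, ρ x v := by
  rw [relTrace, LinearMap.sum_apply]

/-- The image of the trace of a subgroup. -/
noncomputable def traceRange (ρ : Representation k G V) (P : Subgroup G) : Submodule k V :=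
  LinearMap.range (relTrace ρ P)

variable (ρ : Representation k G V) (σ : Representation k G W)

theorem mem_traceRange {P : Subgroup G} {v : V} :
    v ∈ traceRange ρ P ↔ ∃ w, ∑ x ∈ elems P, ρ x w = v := by
  simp only [traceRange, LinearMap.mem_range, relTrace_apply]

theorem traceRange_bot : traceRange ρ (⊥ : Subgroup G) = ⊤ := by
  refine eq_top_iff.2 fun v _ => (mem_traceRange ρ).2 ⟨v, ?_⟩
  have : elems (⊥ : Subgroup G) = {1} := by
    ext x
    simp [Subgroup.mem_bot]
  simp [this]

variable {ρ σ}

theorem map_mem_traceRange {P : Subgroup G} (f : V →ₗ[k] W)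
    (hf : ∀ x ∈ P, ∀ v, f (ρ x v) = σ x (f v)) {v : V} (hv : v ∈ traceRange ρ P) :
    f v ∈ traceRange σ P := by
  obtain ⟨w, rfl⟩ := (mem_traceRange ρ).1 hv
  refine (mem_traceRange σ).2 ⟨f w, ?_⟩
  rw [map_sum]
  exact Finset.sum_congr rfl fun x hx => (hf x (mem_elems.1 hx) w).symm

theorem apply_mem_traceRange_cj {P : Subgroup G} (g : G) {v : V} (hv : v ∈ traceRange ρ P) :
    ρ g v ∈ traceRange ρ (cj g P) := by
  obtain ⟨w, rfl⟩ := (mem_traceRange ρ).1 hv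
  refine (mem_traceRange ρ).2 ⟨ρ g w, ?_⟩
  rw [map_sum]
  refine Finset.sum_nbij' (fun x => g⁻¹ * x * g) (fun x => g * x * g⁻¹) ?_ ?_ ?_ ?_ ?_
  · intro x hx
    exact mem_elems.2 (mem_cj.1 (mem_elems.1 hx))
  · intro x hx
    refine mem_elems.2 (mem_cj.2 ?_)
    simpa [mul_assoc] using hx
  · intro x _
    group
  · intro x _
    group
  · intro x _
    rw [← Module.End.mul_apply, ← Module.End.mul_apply, ← map_mul, ← map_mul]
    congr 2
    group

/-- A sum of an equivariant family of vectors, each of which is a trace from a stabilizer, is a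
trace. -/
theorem sum_mem_traceRange {X : Type*} [Fintype X] [MulAction G X] (Q : Subgroup G) (F : X → V)
    (hF : ∀ q ∈ Q, ∀ x, F (q • x) = ρ q (F x))
    (hst : ∀ x, F x ∈ traceRange ρ (Q ⊓ MulAction.stabilizer G x)) :
    ∑ x, F x ∈ traceRange ρ Q := by
  classical
  let s : Setoid X := MulAction.orbitRel Q X
  have : Fintype (Quotient s) := Fintype.ofFinite _
  rw [← Finset.sum_fiberwise Finset.univ (fun x => Quotient.mk s x) F]
  refine Submodule.sum_mem _ fun ω _ => ?_
  induction ω using Quotient.inductionOn with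
  | _ x₀ =>
  obtain ⟨w, hw⟩ := (mem_traceRange ρ).1 (hst x₀)
  refine (mem_traceRange ρ).2 ⟨w, ?_⟩
  have hmaps : ∀ q ∈ elems Q, q • x₀ ∈ ({x | Quotient.mk s x = Quotient.mk s x₀} : Finset X) := by
    intro q hq
    rw [Finset.mem_filter_univ]
    exact Quotient.sound (s := s) ⟨⟨q, mem_elems.1 hq⟩, rfl⟩
  rw [← Finset.sum_fiberwise_of_maps_to hmaps]
  refine Finset.sum_congr rfl fun x hx => ?_
  obtain ⟨⟨q, hq⟩, hqx⟩ : ∃ q : Q, q • x₀ = x :=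
    Quotient.exact ((Finset.mem_filter_univ x).1 hx)
  replace hqx : q • x₀ = x := hqx
  rw [← hqx, hF q hq, ← hw, map_sum]
  refine Finset.sum_nbij' (fun y => q⁻¹ * y) (fun y => q * y) ?_ ?_ ?_ ?_ ?_
  · intro y hy
    rw [Finset.mem_filter, mem_elems] at hy
    rw [mem_elems, Subgroup.mem_inf, MulAction.mem_stabilizer_iff, mul_smul, hy.2,
      inv_smul_smul]
    exact ⟨mul_mem (inv_mem hq) hy.1, rfl⟩
  · intro y hy
    rw [mem_elems, Subgroup.mem_inf, MulAction.mem_stabilizer_iff] at hy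
    rw [Finset.mem_filter, mem_elems, mul_smul, hy.2]
    exact ⟨mul_mem hq hy.1, rfl⟩
  · intro y _
    exact mul_inv_cancel_left _ _
  · intro y _
    exact inv_mul_cancel_left _ _
  · intro y _
    rw [← Module.End.mul_apply, ← map_mul, mul_inv_cancel_left]

/-- Extend x ↦ xw by zero from P to G. Left multiplication by Q is free, so the sum is a trace from
Q. -/
theorem traceRange_mono {P Q : Subgroup G} (h : Q ≤ P) : traceRange ρ P ≤ traceRange ρ Q := by
  classical
  intro v hv
  obtain ⟨w, rfl⟩ := (mem_traceRange ρ).1 hv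
  have : Fintype G := Fintype.ofFinite G
  have e : ∑ x ∈ elems P, ρ x w = ∑ x : G, if x ∈ P then ρ x w else 0 := by
    rw [← Finset.sum_filter]
    exact Finset.sum_congr (by ext; simp) fun _ _ => rfl
  rw [e]
  refine sum_mem_traceRange Q _ (fun q hq x => ?_) fun x => ?_
  · rw [smul_eq_mul, Subgroup.mul_mem_cancel_left _ (h hq)]
    split_ifs
    · rw [map_mul, Module.End.mul_apply]
    · rw [map_zero]
  · have : Q ⊓ MulAction.stabilizer G x = ⊥ := by
      refine eq_bot_iff.2 fun y hy => ?_
      have h2 : y * x = x := hy.2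
      rw [Subgroup.mem_bot]
      exact mul_eq_right.1 h2
    rw [this, traceRange_bot]
    exact Submodule.mem_top

/-- An invariant form takes the value |P|·f(w) on the trace of w, and p divides |P|. -/
theorem eq_zero_of_mem_traceRange {p : ℕ} [Fact p.Prime] [CharP k p] {P : Subgroup G}
    (hP : IsPGroup p P) (hP0 : P ≠ ⊥) (f : V →ₗ[k] k) (hf : ∀ x ∈ P, ∀ v, f (ρ x v) = f v) {v : V}
    (hv : v ∈ traceRange ρ P) : f v = 0 := by
  obtain ⟨w, rfl⟩ := (mem_traceRange ρ).1 hv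
  rw [map_sum, Finset.sum_congr rfl fun x hx => hf x (mem_elems.1 hx) w, Finset.sum_const,
    card_elems]
  have h1 : p ∣ Nat.card P := by
    have : Nontrivial P := (Subgroup.nontrivial_iff_ne_bot P).2 hP0
    obtain ⟨n, hn, hc⟩ := hP.nontrivial_iff_card.1 this
    rw [hc]
    exact dvd_pow_self p hn.ne'
  rw [nsmul_eq_mul, (CharP.cast_eq_zero_iff k p _).2 h1, zero_mul]

theorem mem_traceRange_linHom {P : Subgroup G} {f : V →ₗ[k] W} :
    f ∈ traceRange (Representation.linHom ρ σ) P ↔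
      ∃ h : V →ₗ[k] W, ∀ v, ∑ x ∈ elems P, σ x (h (ρ x⁻¹ v)) = f v := by
  rw [mem_traceRange]
  refine exists_congr fun h => ?_
  rw [LinearMap.ext_iff]
  simp [LinearMap.sum_apply]

theorem apply_mem_traceRange {P : Subgroup G} {f : V →ₗ[k] W}
    (hf : f ∈ traceRange (Representation.linHom ρ σ) P) {v : V} (hv : ∀ x ∈ P, ρ x v = v) :
    f v ∈ traceRange σ P := by
  obtain ⟨h, hh⟩ := mem_traceRange_linHom.1 hf
  refine (mem_traceRange σ).2 ⟨h v, ?_⟩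
  rw [← hh]
  exact Finset.sum_congr rfl fun x hx => by rw [hv _ (inv_mem (mem_elems.1 hx))]

end Trace

/-! ### Splitting off the trivial module -/

section Splitting

variable {k : Type*} [Field k] {G : Type*} [Group G] [Finite G]
  {V : Type*} [AddCommGroup V] [Module k V] {W : Type*} [AddCommGroup W] [Module k W]
  {V' : Type*} [AddCommGroup V'] [Module k V'] {W' : Type*} [AddCommGroup W'] [Module k W']
  {ρ : Representation k G V} {σ : Representation k G W}
  {ρ' : Representation k G V'} {σ' : Representation k G W'} {S : Subgroup G}

theorem apply_of_mem_traceRange {v : V} (hv : v ∈ traceRange ρ S) {g : G} (hg : g ∈ S) :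
    ρ g v = v := by
  obtain ⟨w, rfl⟩ := (mem_traceRange ρ).1 hv
  rw [map_sum]
  refine Finset.sum_nbij' (fun x => g * x) (fun x => g⁻¹ * x) ?_ ?_ ?_ ?_ ?_
  · intro x hx
    exact mem_elems.2 (mul_mem hg (mem_elems.1 hx))
  · intro x hx
    exact mem_elems.2 (mul_mem (inv_mem hg) (mem_elems.1 hx))
  · intro x _
    exact inv_mul_cancel_left _ _
  · intro x _
    exact mul_inv_cancel_left _ _
  · intro x _
    rw [map_mul, Module.End.mul_apply]

theorem map_apply_of_mem_traceRange_linHom {f : V →ₗ[k] W}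
    (hf : f ∈ traceRange (Representation.linHom ρ σ) S) {g : G} (hg : g ∈ S) (v : V) :
    f (ρ g v) = σ g (f v) := by
  have h := congrArg (fun f : V →ₗ[k] W => f (ρ g v)) (apply_of_mem_traceRange hf hg)
  simpa [← Module.End.mul_apply, ← map_mul] using h.symm

/-- S-equivariant maps can be moved inside the trace on either side. -/
theorem comp_mem_traceRange {f : V →ₗ[k] W} (hf : f ∈ traceRange (Representation.linHom ρ σ) S)
    (b : V' →ₗ[k] V) (a : W →ₗ[k] W') (hb : ∀ x ∈ S, ∀ v, b (ρ' x v) = ρ x (b v))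
    (ha : ∀ x ∈ S, ∀ w, a (σ x w) = σ' x (a w)) :
    a ∘ₗ f ∘ₗ b ∈ traceRange (Representation.linHom ρ' σ') S := by
  obtain ⟨h, hh⟩ := mem_traceRange_linHom.1 hf
  refine mem_traceRange_linHom.2 ⟨a ∘ₗ h ∘ₗ b, fun v => ?_⟩
  simp only [LinearMap.comp_apply, ← hh, map_sum]
  exact Finset.sum_congr rfl fun x hx => by
    rw [ha x (mem_elems.1 hx), hb _ (inv_mem (mem_elems.1 hx))]

/-- The vector `m` and the linear form `π` split off a trivial summand of the restriction of `ρ`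
to `S`, with a complement on which the identity is a trace. -/
structure IsSylowTrivial (ρ : Representation k G V) (S : Subgroup G) (m : V) (π : V →ₗ[k] k) :
    Prop where
  smul_eq : ∀ s ∈ S, ρ s m = m
  map_smul : ∀ s ∈ S, ∀ v, π (ρ s v) = π v
  map_eq_one : π m = 1
  split : LinearMap.id - π.smulRight m ∈ traceRange (Representation.linHom ρ ρ) S

theorem IsSylowTrivial.sub_mem {m : V} {π : V →ₗ[k] k} (h : IsSylowTrivial ρ S m π)
    {P : Subgroup G} (hP : P ≤ S) {v : V} (hv : ∀ x ∈ P, ρ x v = v) :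
    v - π v • m ∈ traceRange ρ P :=
  apply_mem_traceRange (traceRange_mono hP h.split) hv

end Splitting

/-! ### Higman's criterion: projectivity and trivial summands in terms of traces. -/

section Rep

variable {k : Type u} [Field k] {H : Type v} [Group H] [Finite H]

/-- The identity of a projective module is a trace. -/
theorem id_mem_traceRange_of_projective (Q : Rep.{u} k H) (hQ : Projective Q) :
    LinearMap.id ∈ traceRange (Representation.linHom Q.ρ Q.ρ) ⊤ := by
  have hsmall : Small.{u} H := inferInstance
  have : Fintype (Shrink.{u} H) := Fintype.ofFinite _
  have : Fintype H := Fintype.ofFinite _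
  -- Projectivity splits the sum map onto Q from the functions H → Q with diagonal action. The
  -- component at 1 of a splitting has trace the identity. `Shrink` places these functions in the
  -- universe of Q.
  let ε : Shrink.{u} H ≃ H := (@equivShrink H hsmall).symm
  let σ : Representation k H (Shrink.{u} H → Q.V) :=
    { toFun := fun g => LinearMap.pi fun x => Q.ρ g ∘ₗ LinearMap.proj (ε.symm (g⁻¹ * ε x))
      map_one' := by
        ext f x
        simp
      map_mul' := fun g h => by
        ext f x
        simp [mul_assoc] }
  have hσ : ∀ g f x, σ g f x = Q.ρ g (f (ε.symm (g⁻¹ * ε x))) := fun _ _ _ => rfl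
  let q : σ.IntertwiningMap Q.ρ := LinearMap.intertwiningMap_of_isIntertwiningMap _ _
    (∑ x : Shrink.{u} H, LinearMap.proj x) fun g f => by
      simp only [LinearMap.sum_apply, LinearMap.proj_apply, hσ, ← map_sum]
      congr 1
      exact Fintype.sum_equiv ((ε.trans (Equiv.mulLeft g⁻¹)).trans ε.symm) _ _ fun x => rfl
  have hq : ∀ f, q f = ∑ x, f x := fun f => by
    change (∑ x : Shrink.{u} H, LinearMap.proj (φ := fun _ => Q.V) (R := k) x) f = _
    simp
  have : Epi (Rep.ofHom q) := by
    classical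
    refine (Rep.epi_iff_surjective _).2 fun v => ⟨Pi.single (ε.symm 1) v, ?_⟩
    refine (hq _).trans ?_
    simp
  let s : Q ⟶ Rep.of σ := Projective.factorThru (𝟙 Q) (Rep.ofHom q)
  have hs : ∀ v, q (s.hom v) = v := fun v => by
    have := Projective.factorThru_comp (𝟙 Q) (Rep.ofHom q)
    exact congrArg (fun f : Q ⟶ Q => f.hom v) this
  refine mem_traceRange_linHom.2 ⟨LinearMap.proj (ε.symm 1) ∘ₗ s.hom.toLinearMap, fun v => ?_⟩
  have key : ∀ x : H, Q.ρ x ((LinearMap.proj (ε.symm 1) ∘ₗ s.hom.toLinearMap) (Q.ρ x⁻¹ v)) =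
      s.hom v (ε.symm x) := by
    intro x
    have h1 : s.hom (Q.ρ x⁻¹ v) = σ x⁻¹ (s.hom v) := Rep.hom_comm_apply s x⁻¹ v
    have h2 : (LinearMap.proj (ε.symm 1) ∘ₗ s.hom.toLinearMap) (Q.ρ x⁻¹ v) =
        s.hom (Q.ρ x⁻¹ v) (ε.symm 1) := rfl
    rw [h2, h1, hσ, ← Module.End.mul_apply, ← map_mul]
    simp
  have hel : elems (⊤ : Subgroup H) = Finset.univ := by
    ext
    simp
  rw [Finset.sum_congr rfl fun x _ => key x, hel, LinearMap.id_apply]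
  refine Eq.trans ?_ ((hq _).symm.trans (hs v))
  exact Fintype.sum_equiv ε.symm _ _ fun _ => rfl

/-- Lift linearly, precompose with the map h whose trace is the identity, and take the trace: the
result is an equivariant lift. -/
theorem projective_of_id_mem_traceRange (Q : Rep.{u} k H)
    (hQ : LinearMap.id ∈ traceRange (Representation.linHom Q.ρ Q.ρ) ⊤) : Projective Q := by
  obtain ⟨h, hh⟩ := mem_traceRange_linHom.1 hQ
  refine ⟨fun {Y X} f e he => ?_⟩
  rw [Rep.epi_iff_surjective] at he
  obtain ⟨s, hs⟩ := e.hom.toLinearMap.exists_rightInverse_of_surjective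
    (LinearMap.range_eq_top.2 he)
  have hs' : ∀ y, e.hom (s y) = y := fun y => congrArg (fun φ => φ y) hs
  let g : Q.V →ₗ[k] Y.V := relTrace (Representation.linHom Q.ρ Y.ρ) ⊤
    (s ∘ₗ f.hom.toLinearMap ∘ₗ h)
  have hg : ∀ v, g v = ∑ x ∈ elems (⊤ : Subgroup H), Y.ρ x (s (f.hom (h (Q.ρ x⁻¹ v)))) := by
    intro v
    simp only [g, relTrace_apply, LinearMap.sum_apply]
    rfl
  refine ⟨Rep.ofHom (LinearMap.intertwiningMap_of_isIntertwiningMap _ _ g fun x v =>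
    map_apply_of_mem_traceRange_linHom ⟨_, rfl⟩ (Subgroup.mem_top x) v), ?_⟩
  ext v
  change e.hom (g v) = f.hom v
  rw [hg, map_sum]
  conv_rhs => rw [← LinearMap.id_apply (R := k) v, ← hh, map_sum]
  refine Finset.sum_congr rfl fun x _ => ?_
  rw [Rep.hom_comm_apply, hs', Rep.hom_comm_apply]

theorem IsTrivialPlusProjective.exists_isSylowTrivial {M : Rep.{u} k H}
    (hM : IsTrivialPlusProjective M) : ∃ m π, IsSylowTrivial M.ρ ⊤ m π := by
  obtain ⟨P, hP, ⟨e⟩⟩ := hM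
  let i : 𝟙_ (Rep.{u} k H) ⟶ M := biprod.inl ≫ e.inv
  let r : M ⟶ 𝟙_ (Rep.{u} k H) := e.hom ≫ biprod.fst
  let j : P ⟶ M := biprod.inr ≫ e.inv
  let q : M ⟶ P := e.hom ≫ biprod.snd
  have hir : i ≫ r = 𝟙 _ := by simp [i, r]
  have htot : r ≫ i + q ≫ j = 𝟙 M := by
    have h := congrArg (fun φ => e.hom ≫ φ ≫ e.inv) (biprod.total (X := 𝟙_ (Rep.{u} k H)) (Y := P))
    simp only [Preadditive.add_comp, Preadditive.comp_add, Category.assoc, Category.id_comp,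
      e.hom_inv_id] at h
    simp only [i, r, j, q, Category.assoc]
    exact h
  have hr : ∀ x v, r.hom (M.ρ x v) = r.hom v := fun x v => Rep.hom_comm_apply r x v
  refine ⟨i.hom (1 : k), r.hom.toLinearMap, ?_, ?_, ?_, ?_⟩
  · intro s _
    exact (Rep.hom_comm_apply i s (1 : k)).symm
  · intro s _ v
    exact hr s v
  · exact congrArg (fun φ => φ.hom (1 : k)) hir
  · have h1 := comp_mem_traceRange (ρ' := M.ρ) (σ' := M.ρ) (id_mem_traceRange_of_projective P hP)
      q.hom.toLinearMap j.hom.toLinearMap (fun x _ v => Rep.hom_comm_apply q x v)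
      (fun x _ v => Rep.hom_comm_apply j x v)
    convert h1 using 1
    ext v
    have h2 : i.hom (r.hom v) + j.hom (q.hom v) = v := congrArg (fun φ => φ.hom v) htot
    have h3 : i.hom (r.hom v) = (r.hom v : k) • i.hom (1 : k) := by
      have := map_smul i.hom (r.hom v : k) (1 : k)
      rw [← this]
      congr 1
      exact (mul_one _).symm
    change v - (r.hom v : k) • i.hom (1 : k) = j.hom (q.hom v)
    rw [← h3, sub_eq_iff_eq_add', h2]

/-- The complement is the kernel of π. Its identity is the compression of id − π⊗m, hence a trace,
so it is projective. -/
theorem IsSylowTrivial.isTrivialPlusProjective {M : Rep.{u} k H} {m : M.V} {π : M.V →ₗ[k] k}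
    (h : IsSylowTrivial M.ρ ⊤ m π) : IsTrivialPlusProjective M := by
  have hmap : ∀ x, ∀ v ∈ LinearMap.ker π, M.ρ x v ∈ LinearMap.ker π := fun x v hv => by
    rw [LinearMap.mem_ker] at hv ⊢
    rw [h.map_smul x (Subgroup.mem_top x), hv]
  let σ : Representation k H (LinearMap.ker π) :=
    { toFun := fun x => (M.ρ x).restrict (hmap x)
      map_one' := by
        ext v
        simp
      map_mul' := fun x y => by
        ext v
        simp }
  have hσ : ∀ x v, (σ x v : M.V) = M.ρ x v := fun _ _ => rfl
  let ι : LinearMap.ker π →ₗ[k] M.V := (LinearMap.ker π).subtype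
  let κ : M.V →ₗ[k] LinearMap.ker π := (LinearMap.id - π.smulRight m).codRestrict _ fun v => by
    simp [h.map_eq_one]
  have hκ : ∀ v, (κ v : M.V) = v - π v • m := fun _ => rfl
  have hκeq : ∀ x v, κ (M.ρ x v) = σ x (κ v) := fun x v => by
    ext
    rw [hσ, hκ, hκ, map_sub, _root_.map_smul, h.smul_eq x (Subgroup.mem_top x),
      h.map_smul x (Subgroup.mem_top x)]
  have hκι : ∀ v, κ (ι v) = v := fun v => by
    ext
    rw [hκ]
    simp [ι]
  let P : Rep.{u} k H := Rep.of σ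
  have hP : Projective P := by
    refine projective_of_id_mem_traceRange P ?_
    have h1 := comp_mem_traceRange (ρ' := σ) (σ' := σ) h.split ι κ (fun x _ v => rfl)
      (fun x _ v => hκeq x v)
    convert h1 using 1
    ext v
    have h2 : κ ((ι v : M.V) - π (ι v) • m) = v := by
      have h3 : π (ι v) = 0 := v.2
      rw [h3, zero_smul, sub_zero, hκι]
    exact congrArg Subtype.val h2.symm
  let b : BinaryBicone (𝟙_ (Rep.{u} k H)) P :=
    { pt := M
      fst := Rep.ofHom (σ := Representation.trivial k H k)
        (LinearMap.intertwiningMap_of_isIntertwiningMap _ _ π fun x v =>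
          h.map_smul x (Subgroup.mem_top x) v)
      snd := Rep.ofHom (LinearMap.intertwiningMap_of_isIntertwiningMap _ _ κ hκeq)
      inl := Rep.ofHom (ρ := Representation.trivial k H k)
        (LinearMap.intertwiningMap_of_isIntertwiningMap _ _
          ((LinearMap.id : k →ₗ[k] k).smulRight m) fun x a => by
            simp [h.smul_eq x (Subgroup.mem_top x)])
      inr := Rep.ofHom (LinearMap.intertwiningMap_of_isIntertwiningMap _ _ ι fun x v => rfl)
      inl_fst := by
        ext
        change π ((1 : k) • m) = 1
        rw [one_smul, h.map_eq_one]
      inl_snd := by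
        ext
        change (1 : k) • m - π ((1 : k) • m) • m = 0
        rw [one_smul, h.map_eq_one, one_smul, sub_self]
      inr_fst := by
        ext a
        exact a.2
      inr_snd := by
        ext a
        exact congrArg Subtype.val (hκι a) }
  have hb : b.IsBilimit := isBinaryBilimitOfTotal b (by
    ext v
    change π v • m + (v - π v • m) = v
    abel)
  exact ⟨P, hP, ⟨biprod.uniqueUpToIso _ _ hb⟩⟩

theorem isSylowTrivial_res_iff {M : Rep.{u} k H} {S : Subgroup H} {m : M.V} {π : M.V →ₗ[k] k} :
    IsSylowTrivial (Rep.res S.subtype M).ρ ⊤ m π ↔ IsSylowTrivial M.ρ S m π := by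
  have hsum : ∀ f : M.V →ₗ[k] M.V,
      f ∈ traceRange (Representation.linHom (Rep.res S.subtype M).ρ (Rep.res S.subtype M).ρ) ⊤ ↔
        f ∈ traceRange (Representation.linHom M.ρ M.ρ) S := by
    intro f
    refine mem_traceRange_linHom.trans (Iff.trans ?_ mem_traceRange_linHom.symm)
    refine exists_congr fun h => forall_congr' fun v => ?_
    have : Fintype S := Fintype.ofFinite _
    have hel : elems (⊤ : Subgroup S) = Finset.univ := by
      ext
      simp
    rw [hel, sum_elems_eq_sum_subtype S]
    rfl
  constructor
  · intro h
    exact ⟨fun s hs => h.smul_eq ⟨s, hs⟩ (Subgroup.mem_top _),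
      fun s hs v => h.map_smul ⟨s, hs⟩ (Subgroup.mem_top _) v, h.map_eq_one, (hsum _).1 h.split⟩
  · intro h
    exact ⟨fun s _ => h.smul_eq s s.2, fun s _ v => h.map_smul s s.2 v, h.map_eq_one,
      (hsum _).2 h.split⟩

end Rep

/-! ### The character of a Sylow-trivial module -/

section Character

variable {p : ℕ} {k : Type*} [Field k] {G : Type v} [Group G] [Finite G]
  {V : Type*} [AddCommGroup V] [Module k V] {W : Type*} [AddCommGroup W] [Module k W]
  {ρ : Representation k G V} {σ : Representation k G W} {S : Sylow p G}
  {m : V} {π : V →ₗ[k] k} {m' : W} {π' : W →ₗ[k] k}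

namespace IsSylowTrivial

/-- U fixes gm, because g⁻¹Ug ≤ S fixes m. -/
theorem sub_smul_mem (h : IsSylowTrivial ρ (S : Subgroup G) m π) {U : Subgroup G} (hU : U ≤ S)
    {g : G} (hg : U ≤ cj g S) : ρ g m - π (ρ g m) • m ∈ traceRange ρ U := by
  refine h.sub_mem hU fun x hx => ?_
  have h1 := h.smul_eq _ (mem_cj.1 (hg hx))
  rw [← Module.End.mul_apply, ← map_mul]
  have e : x * g = g * (g⁻¹ * x * g) := by group
  rw [e, map_mul, Module.End.mul_apply, h1]

/-- Write id⊗id − (π⊗m)⊗(π'⊗m') as (id − π⊗m)⊗id + (π⊗m)⊗(id − π'⊗m'). Each summand is the trace of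
a tensor product of maps. -/
theorem tprod (h : IsSylowTrivial ρ (S : Subgroup G) m π)
    (h' : IsSylowTrivial σ (S : Subgroup G) m' π') :
    IsSylowTrivial (ρ.tprod σ) (S : Subgroup G) (m ⊗ₜ[k] m')
      ((TensorProduct.lid k k).toLinearMap ∘ₗ TensorProduct.map π π') := by
  refine ⟨fun s hs => ?_, fun s hs v => ?_, ?_, ?_⟩
  · simp [h.smul_eq s hs, h'.smul_eq s hs]
  · induction v with
    | zero => simp
    | add v w hv hw => simp only [map_add, hv, hw]
    | tmul v w => simp [h.map_smul s hs, h'.map_smul s hs]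
  · simp [h.map_eq_one, h'.map_eq_one]
  · obtain ⟨a, ha⟩ := mem_traceRange_linHom.1 h.split
    obtain ⟨b, hb⟩ := mem_traceRange_linHom.1 h'.split
    refine mem_traceRange_linHom.2
      ⟨TensorProduct.map a LinearMap.id + TensorProduct.map (π.smulRight m) b, fun v => ?_⟩
    induction v with
    | zero => simp
    | add v w hv hw => simp only [map_add, Finset.sum_add_distrib, hv, hw]
    | tmul v w =>
      have e : ∀ x ∈ elems (S : Subgroup G), (ρ.tprod σ) x
          ((TensorProduct.map a LinearMap.id + TensorProduct.map (π.smulRight m) b :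
            TensorProduct k V W →ₗ[k] TensorProduct k V W) ((ρ.tprod σ) x⁻¹ (v ⊗ₜ w))) =
          (ρ x (a (ρ x⁻¹ v))) ⊗ₜ w + (π v • m) ⊗ₜ (σ x (b (σ x⁻¹ w))) := by
        intro x hx
        have hx' := mem_elems.1 hx
        have hw : σ x (σ x⁻¹ w) = w := by simp
        simp only [Representation.tprod_apply, TensorProduct.map_tmul, LinearMap.add_apply, map_add,
          LinearMap.id_apply, hw, LinearMap.smulRight_apply, h.map_smul _ (inv_mem hx'),
          _root_.map_smul, h.smul_eq x hx']
      rw [Finset.sum_congr rfl e, Finset.sum_add_distrib, ← TensorProduct.sum_tmul, ha,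
        ← TensorProduct.tmul_sum, hb]
      simp [TensorProduct.sub_tmul, TensorProduct.tmul_sub, TensorProduct.smul_tmul',
        TensorProduct.tmul_smul, smul_smul, mul_comm]

variable [Fact p.Prime] [CharP k p]

theorem map_eq_zero (h : IsSylowTrivial ρ (S : Subgroup G) m π) {U : Subgroup G} (hU : U ≤ S)
    (hU0 : U ≠ ⊥) {v : V} (hv : v ∈ traceRange ρ U) : π v = 0 :=
  eq_zero_of_mem_traceRange (S.2.to_le hU) hU0 π (fun x hx => h.map_smul x (hU hx)) hv

/-- Modulo traces from g⁻¹Ug, g'm is π(g'm)m. Apply g, then π, which kills traces from U. -/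
theorem map_mul (h : IsSylowTrivial ρ (S : Subgroup G) m π) {U : Subgroup G} (hU : U ≤ S)
    (hU0 : U ≠ ⊥) {g g' : G} (hg : U ≤ cj g S) (hg' : U ≤ cj (g * g') S) :
    π (ρ (g * g') m) = π (ρ g m) * π (ρ g' m) := by
  have h1 := h.sub_smul_mem (cj_inv_le.2 hg) (g := g') (by rw [cj_inv_le, ← cj_mul]; exact hg')
  have h2 := apply_mem_traceRange_cj g h1
  rw [cj_cj_inv] at h2
  have h3 := h.map_eq_zero hU hU0 h2
  rw [map_sub, map_sub, _root_.map_smul, _root_.map_smul, sub_eq_zero, ← Module.End.mul_apply,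
    ← _root_.map_mul, smul_eq_mul] at h3
  rw [h3, mul_comm]

theorem map_ne_zero (h : IsSylowTrivial ρ (S : Subgroup G) m π) {U : Subgroup G} (hU : U ≤ S)
    (hU0 : U ≠ ⊥) {g : G} (hg : U ≤ cj g S) : π (ρ g m) ≠ 0 := by
  have h1 := h.map_mul hU hU0 hg (g' := g⁻¹) (by simpa using hU)
  rw [mul_inv_cancel, map_one, Module.End.one_apply, h.map_eq_one] at h1
  exact left_ne_zero_of_mul (h1 ▸ one_ne_zero)

open Classical in
/-- The weak homomorphism attached to a Sylow-trivial module. -/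
noncomputable def weakHom (ρ : Representation k G V) (m : V) (π : V →ₗ[k] k) (g : G) : kˣ :=
  if h : π (ρ g m) ≠ 0 then Units.mk0 _ h else 1

theorem coe_weakHom (h : IsSylowTrivial ρ (S : Subgroup G) m π) {U : Subgroup G} (hU : U ≤ S)
    (hU0 : U ≠ ⊥) {g : G} (hg : U ≤ cj g S) : (weakHom ρ m π g : k) = π (ρ g m) := by
  rw [weakHom, dif_pos (h.map_ne_zero hU hU0 hg), Units.val_mk0]

theorem isWeakHom (h : IsSylowTrivial ρ (S : Subgroup G) m π) (hS : (S : Subgroup G) ≠ ⊥) :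
    IsWeakHom (S : Subgroup G) 2 (weakHom ρ m π) := by
  refine ⟨fun s hs => Units.ext ?_, fun U g g' hn hU hg hg' => Units.ext ?_⟩
  · rw [h.coe_weakHom le_rfl hS (cj_eq_of_mem hs).ge, h.smul_eq s hs, h.map_eq_one, Units.val_one]
  · have hU0 : U ≠ ⊥ := (Subgroup.one_lt_card_iff_ne_bot _).1 hn
    rw [Units.val_mul, h.coe_weakHom hU hU0 hg', h.coe_weakHom hU hU0 hg,
      h.coe_weakHom (cj_inv_le.2 hg) (cj_ne_bot hU0 g⁻¹) (g := g')
        (by rw [cj_inv_le, ← cj_mul]; exact hg'), h.map_mul hU hU0 hg hg']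

/-- Computing π'(n·f(m)) by reducing nm to a multiple of m, or f(m) to a multiple of m', gives two
expressions with the common factor π'(f(m)). -/
theorem map_eq_of_map (h : IsSylowTrivial ρ (S : Subgroup G) m π)
    (h' : IsSylowTrivial σ (S : Subgroup G) m' π') (hS : (S : Subgroup G) ≠ ⊥)
    (f : V →ₗ[k] W) (hf : ∀ g v, f (ρ g v) = σ g (f v)) (hfm : π' (f m) ≠ 0) {n : G}
    (hn : n ∈ nrm (S : Subgroup G)) : π (ρ n m) = π' (σ n m') := by
  have hnS : cj n (S : Subgroup G) = S := mem_nrm.1 hn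
  have h1 := map_mem_traceRange f (fun x _ v => hf x v) (h.sub_smul_mem le_rfl hnS.ge)
  have h2 := h'.map_eq_zero le_rfl hS h1
  rw [map_sub, map_sub, _root_.map_smul, _root_.map_smul, hf, sub_eq_zero, smul_eq_mul] at h2
  have h3 := h'.sub_mem le_rfl (v := f m) fun x hx => by rw [← hf, h.smul_eq x hx]
  have h4 := apply_mem_traceRange_cj n h3
  rw [hnS] at h4
  have h5 := h'.map_eq_zero le_rfl hS h4
  rw [map_sub, map_sub, _root_.map_smul, _root_.map_smul, sub_eq_zero, smul_eq_mul, h2,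
    mul_comm] at h5
  exact mul_left_cancel₀ hfm h5

end IsSylowTrivial

end Character

/-! ### The homomorphism from T_k(G,S) to characters. -/

section CharacterMap

variable {p : ℕ} {k : Type u} [Field k] {G : Type v} [Group G] [Finite G]
  {S : Sylow p G} {r : ℕ}

/-- The homomorphism `χ` describes the action of `N_G(S)` on the trivial summand of `M`. -/
def HasCharacter (S : Sylow p G) (r : ℕ) (M : Rep.{u} k G)
    (χ : nrm (S : Subgroup G) ⧸ rhoIn p (S : Subgroup G) r →* kˣ) : Prop :=
  ∃ m π, IsSylowTrivial M.ρ (S : Subgroup G) m π ∧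
    ∀ n : nrm (S : Subgroup G), π (M.ρ n m) = χ (QuotientGroup.mk n)

theorem isTrivialPlusProjective_res_iff {M : Rep.{u} k G} :
    IsTrivialPlusProjective (Rep.res (S : Subgroup G).subtype M) ↔
      ∃ m π, IsSylowTrivial M.ρ (S : Subgroup G) m π :=
  ⟨fun h => by
    obtain ⟨m, π, h⟩ := h.exists_isSylowTrivial
    exact ⟨m, π, isSylowTrivial_res_iff.1 h⟩,
  fun ⟨_, _, h⟩ => (isSylowTrivial_res_iff.2 h).isTrivialPlusProjective⟩

theorem HasCharacter.one : HasCharacter S r (𝟙_ (Rep.{u} k G)) 1 := by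
  refine ⟨(1 : k), LinearMap.id, ⟨fun _ _ => rfl, fun _ _ _ => rfl, rfl, ?_⟩, fun _ => rfl⟩
  have : (LinearMap.id - (LinearMap.id : k →ₗ[k] k).smulRight (1 : k)) = 0 := by
    ext
    simp
  rw [this]
  exact Submodule.zero_mem _

theorem HasCharacter.tensor {M N : Rep.{u} k G}
    {χ χ' : nrm (S : Subgroup G) ⧸ rhoIn p (S : Subgroup G) r →* kˣ}
    (h : HasCharacter S r M χ) (h' : HasCharacter S r N χ') :
    HasCharacter S r (M ⊗ N) (χ * χ') := by
  obtain ⟨m, π, hm, hχ⟩ := h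
  obtain ⟨m', π', hm', hχ'⟩ := h'
  refine ⟨_, _, hm.tprod hm', fun n => ?_⟩
  rw [MonoidHom.mul_apply, Units.val_mul, ← hχ, ← hχ']
  rfl

variable [Fact p.Prime] [CharP k p]

theorem exists_hasCharacter (hS : (S : Subgroup G) ≠ ⊥) (hr : 1 ≤ r) {M : Rep.{u} k G}
    (hM : IsTrivialPlusProjective (Rep.res (S : Subgroup G).subtype M)) :
    ∃ χ, HasCharacter S r M χ := by
  obtain ⟨m, π, h⟩ := isTrivialPlusProjective_res_iff.1 hM
  have hu := h.isWeakHom hS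
  have h2 : 2 ≤ Nat.card S := (Subgroup.one_lt_card_iff_ne_bot _).2 hS
  refine ⟨QuotientGroup.lift _ (hu.nrmHom h2 le_rfl) fun x hx =>
      hu.map_eq_one_of_mem_rho r hr hS le_rfl hx, m, π, h, fun n => ?_⟩
  exact (h.coe_weakHom le_rfl hS (mem_nrm.1 n.2).ge).symm

theorem HasCharacter.eq_of_stablyIso (hS : (S : Subgroup G) ≠ ⊥) {M N : Rep.{u} k G}
    {χ χ' : nrm (S : Subgroup G) ⧸ rhoIn p (S : Subgroup G) r →* kˣ}
    (h : HasCharacter S r M χ) (h' : HasCharacter S r N χ') (hMN : StablyIso M N) : χ = χ' := by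
  obtain ⟨m, π, hm, hχ⟩ := h
  obtain ⟨m', π', hm', hχ'⟩ := h'
  obtain ⟨P, Q, hP, hQ, ⟨e⟩⟩ := hMN
  let f : M ⟶ N := biprod.inl ≫ e.hom ≫ biprod.fst
  let f' : N ⟶ M := biprod.inl ≫ e.inv ≫ biprod.fst
  let g : M ⟶ Q := biprod.inl ≫ e.hom ≫ biprod.snd
  let g' : Q ⟶ M := biprod.inr ≫ e.inv ≫ biprod.fst
  have hid : f ≫ f' + g ≫ g' = 𝟙 M := by
    have h := congrArg (fun φ => (biprod.inl ≫ e.hom) ≫ φ ≫ e.inv ≫ biprod.fst)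
      (biprod.total (X := N) (Y := Q))
    simp only [Preadditive.add_comp, Preadditive.comp_add, Category.assoc, Category.id_comp,
      e.hom_inv_id_assoc, biprod.inl_fst] at h
    simp only [f, f', g, g', Category.assoc]
    exact h
  have hf : ∀ x v, f.hom (M.ρ x v) = N.ρ x (f.hom v) := fun x v => Rep.hom_comm_apply f x v
  have hg : ∀ x v, g.hom (M.ρ x v) = Q.ρ x (g.hom v) := fun x v => Rep.hom_comm_apply g x v
  -- Otherwise f(m) is a trace from S. So is g(m), as Q is projective, and then so is m = f'f(m) +
  -- g'g(m), contradicting π(m) = 1.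
  have hfm : π' (f.hom m) ≠ 0 := by
    intro h0
    have h1 := hm'.sub_mem le_rfl (v := f.hom m) fun x hx => by rw [← hf, hm.smul_eq x hx]
    rw [h0, zero_smul, sub_zero] at h1
    have h2 : g.hom m ∈ traceRange Q.ρ (S : Subgroup G) :=
      apply_mem_traceRange (traceRange_mono le_top (id_mem_traceRange_of_projective Q hQ))
        fun x hx => (hg x m).symm.trans (congrArg g.hom (hm.smul_eq x hx))
    have h3 := map_mem_traceRange (σ := M.ρ) f'.hom.toLinearMap
      (fun x _ v => Rep.hom_comm_apply f' x v) h1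
    have h4 := map_mem_traceRange (σ := M.ρ) g'.hom.toLinearMap
      (fun x _ v => Rep.hom_comm_apply g' x v) h2
    have h5 : f'.hom (f.hom m) + g'.hom (g.hom m) = m := congrArg (fun φ => φ.hom m) hid
    have h6 : m ∈ traceRange M.ρ (S : Subgroup G) := h5 ▸ Submodule.add_mem _ h3 h4
    have h7 := hm.map_eq_zero le_rfl hS h6
    rw [hm.map_eq_one] at h7
    exact one_ne_zero h7
  refine MonoidHom.ext fun x => ?_
  induction x using QuotientGroup.induction_on with
  | H n =>
  refine Units.ext ?_
  exact (hχ n).symm.trans ((hm.map_eq_of_map hm' hS f.hom.toLinearMap hf hfm n.2).trans (hχ' n))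

/-- The character of `N_G(S)/ρ^r(S)` attached to an equivalence class of Sylow-trivial modules. -/
noncomputable def sylowCharacter (hS : (S : Subgroup G) ≠ ⊥) (hr : 1 ≤ r) :
    SylowTrivialGroup k (S : Subgroup G) →
      (nrm (S : Subgroup G) ⧸ rhoIn p (S : Subgroup G) r →* kˣ) :=
  Quotient.lift (fun M => (exists_hasCharacter (r := r) hS hr M.2).choose)
    fun M N h => (exists_hasCharacter hS hr M.2).choose_spec.eq_of_stablyIso hS
      (exists_hasCharacter hS hr N.2).choose_spec h

theorem hasCharacter_sylowCharacter (hS : (S : Subgroup G) ≠ ⊥) (hr : 1 ≤ r)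
    (M : SylowTrivialModule k (S : Subgroup G)) :
    HasCharacter S r M.1 (sylowCharacter hS hr (Quotient.mk _ M)) :=
  (exists_hasCharacter hS hr M.2).choose_spec

theorem sylowCharacter_eq (hS : (S : Subgroup G) ≠ ⊥) (hr : 1 ≤ r)
    (M : SylowTrivialModule k (S : Subgroup G))
    {χ : nrm (S : Subgroup G) ⧸ rhoIn p (S : Subgroup G) r →* kˣ} (h : HasCharacter S r M.1 χ) :
    sylowCharacter hS hr (Quotient.mk _ M) = χ :=
  (hasCharacter_sylowCharacter hS hr M).eq_of_stablyIso hS h (StablyIso.of_iso (Iso.refl _))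

/-- The homomorphism from `T_k(G,S)` to the character group of `N_G(S)/ρ^r(S)`. -/
noncomputable def characterMap (hS : (S : Subgroup G) ≠ ⊥) (hr : 1 ≤ r) :
    SylowTrivialGroup k (S : Subgroup G) →*
      (nrm (S : Subgroup G) ⧸ rhoIn p (S : Subgroup G) r →* kˣ) where
  toFun := sylowCharacter hS hr
  map_one' := sylowCharacter_eq hS hr ⟨𝟙_ (Rep.{u} k G), IsTrivialPlusProjective.unit⟩ .one
  map_mul' := by
    rintro ⟨M⟩ ⟨N⟩
    exact sylowCharacter_eq hS hr
      ⟨M.1 ⊗ N.1, (M.2.tensor N.2).of_iso (resTensorIso (S : Subgroup G) M.1 N.1)⟩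
      ((hasCharacter_sylowCharacter hS hr M).tensor (hasCharacter_sylowCharacter hS hr N))

end CharacterMap

/-! ### Modules with trivial character -/

section TrivialCharacter

variable {k : Type*} [Field k] {G : Type v} [Group G]
  {V : Type*} [AddCommGroup V] [Module k V] {ρ : Representation k G V}

/-- The action of a coset of `S` on a vector; meaningful if the vector is fixed by `S`. -/
noncomputable def cosetAct (ρ : Representation k G V) {S : Subgroup G} (v : V) (x : G ⧸ S) : V :=
  ρ x.out v

theorem cosetAct_mk {S : Subgroup G} {v : V} (hv : ∀ s ∈ S, ρ s v = v) (g : G) :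
    cosetAct ρ v (QuotientGroup.mk g : G ⧸ S) = ρ g v := by
  obtain ⟨s, hs⟩ := QuotientGroup.mk_out_eq_mul S g
  rw [cosetAct, hs, map_mul, Module.End.mul_apply, hv s s.2]

theorem cosetAct_smul {S : Subgroup G} {v : V} (hv : ∀ s ∈ S, ρ s v = v) (g : G) (x : G ⧸ S) :
    cosetAct ρ v (g • x) = ρ g (cosetAct ρ v x) := by
  induction x using QuotientGroup.induction_on with
  | H x =>
    rw [cosetAct_mk hv, MulAction.Quotient.smul_mk, cosetAct_mk hv, smul_eq_mul, map_mul,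
      Module.End.mul_apply]

theorem apply_sum_cosetAct {S : Subgroup G} [Fintype (G ⧸ S)] {v : V} (hv : ∀ s ∈ S, ρ s v = v)
    (g : G) : ρ g (∑ x : G ⧸ S, cosetAct ρ v x) = ∑ x : G ⧸ S, cosetAct ρ v x := by
  simp only [map_sum, ← cosetAct_smul hv]
  exact Fintype.sum_equiv (MulAction.toPerm g) _ _ fun _ => rfl

/-- Transitivity of traces. -/
theorem sum_cosetAct_mem_traceRange [Finite G] {S : Subgroup G} [Fintype (G ⧸ S)] {v : V}
    (hv : v ∈ traceRange ρ S) : ∑ x : G ⧸ S, cosetAct ρ v x ∈ traceRange ρ ⊤ := by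
  have hv' : ∀ s ∈ S, ρ s v = v := fun s hs => apply_of_mem_traceRange hv hs
  refine sum_mem_traceRange ⊤ _ (fun g _ x => cosetAct_smul hv' g x) fun x => ?_
  induction x using QuotientGroup.induction_on with
  | H g =>
    rw [cosetAct_mk hv']
    refine traceRange_mono (fun y hy => ?_) (apply_mem_traceRange_cj g hv)
    have h1 : y • (QuotientGroup.mk g : G ⧸ S) = QuotientGroup.mk g := hy.2
    rw [MulAction.Quotient.smul_mk, eq_comm, QuotientGroup.eq] at h1
    rw [mem_cj, mul_assoc]
    exact h1

end TrivialCharacter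

/-! ### Averaging over G/S: a trivial character splits off k over G. -/

section Invariant

variable {k : Type*} [Field k] {G : Type v} [Group G]
  {V : Type*} [AddCommGroup V] [Module k V] {ρ : Representation k G V}

theorem inf_stabilizer_mk {S : Subgroup G} (Q : Subgroup G) (g : G) :
    Q ⊓ MulAction.stabilizer G (QuotientGroup.mk g : G ⧸ S) = Q ⊓ cj g S := by
  ext y
  have h : (QuotientGroup.mk (y * g) : G ⧸ S) = QuotientGroup.mk g ↔ g⁻¹ * y * g ∈ S := by
    rw [eq_comm, QuotientGroup.eq, mul_assoc]
  rw [Subgroup.mem_inf, Subgroup.mem_inf, MulAction.mem_stabilizer_iff,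
    MulAction.Quotient.smul_mk, mem_cj, smul_eq_mul, h]

theorem exists_mul_card_quotient_eq_one [Finite G] {p : ℕ} [Fact p.Prime] [CharP k p]
    (S : Sylow p G) [Fintype (G ⧸ (S : Subgroup G))] :
    ∃ c : k, c * (Fintype.card (G ⧸ (S : Subgroup G)) : k) = 1 := by
  refine ⟨(Fintype.card (G ⧸ (S : Subgroup G)) : k)⁻¹, inv_mul_cancel₀ fun h => ?_⟩
  rw [CharP.cast_eq_zero_iff k p, ← Nat.card_eq_fintype_card, ← Subgroup.index_eq_card] at h
  exact S.not_dvd_index h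

/-- The difference is c times the sum of gv − v over the cosets gS, an S-equivariant family of
traces from the stabilizers S ∩ gSg⁻¹. -/
theorem smul_sum_cosetAct_sub_mem [Finite G] {S : Subgroup G} [Fintype (G ⧸ S)] {v : V} {c : k}
    (hc : c * (Fintype.card (G ⧸ S) : k) = 1)
    (hv : ∀ s ∈ S, ρ s v = v) (h : ∀ g, ρ g v - v ∈ traceRange ρ (S ⊓ cj g S)) :
    c • ∑ x : G ⧸ S, cosetAct ρ v x - v ∈ traceRange ρ S := by
  have e : c • ∑ x : G ⧸ S, cosetAct ρ v x - v = c • ∑ x : G ⧸ S, (cosetAct ρ v x - v) := by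
    rw [Finset.sum_sub_distrib, smul_sub, Finset.sum_const, Finset.card_univ,
      ← Nat.cast_smul_eq_nsmul k, smul_smul, hc, one_smul]
  rw [e]
  refine Submodule.smul_mem _ _ (sum_mem_traceRange S _ (fun q hq x => ?_) fun x => ?_)
  · rw [cosetAct_smul hv, map_sub, hv q hq]
  · induction x using QuotientGroup.induction_on with
    | H g =>
      rw [cosetAct_mk hv, inf_stabilizer_mk]
      exact h g

variable [Finite G] {p : ℕ} [Fact p.Prime] [CharP k p] {S : Sylow p G} {m : V} {π : V →ₗ[k] k}

theorem IsSylowTrivial.exists_top (h : IsSylowTrivial ρ (S : Subgroup G) m π)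
    (hS : (S : Subgroup G) ≠ ⊥) (hπ : ∀ n ∈ nrm (S : Subgroup G), π (ρ n m) = 1) :
    ∃ m' π', IsSylowTrivial ρ ⊤ m' π' := by
  have : Fintype (G ⧸ (S : Subgroup G)) := Fintype.ofFinite _
  obtain ⟨c, hc⟩ := exists_mul_card_quotient_eq_one (k := k) S
  have h2 : 2 ≤ Nat.card S := (Subgroup.one_lt_card_iff_ne_bot _).2 hS
  have hπ1 : ∀ {U : Subgroup G} {g : G}, U ≠ ⊥ → U ≤ S → U ≤ cj g S → π (ρ g m) = 1 := by
    intro U g hU0 hU hg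
    rw [← h.coe_weakHom hU hU0 hg, (h.isWeakHom hS).eq_of_eq_on_nrm
      (v := fun _ => 1) ⟨fun _ _ => rfl, fun _ _ _ _ _ _ _ => (one_mul 1).symm⟩ (fun x hx => ?_)
      ((Subgroup.one_lt_card_iff_ne_bot _).2 hU0) hU hg, Units.val_one]
    refine Units.ext ?_
    rw [h.coe_weakHom le_rfl hS (mem_nrm.1 hx).ge, hπ x hx, Units.val_one]
  let m' := c • ∑ x : G ⧸ (S : Subgroup G), cosetAct ρ m x
  have hm' : ∀ g, ρ g m' = m' := fun g => by
    simp only [m', _root_.map_smul, apply_sum_cosetAct h.smul_eq]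
  have hsub : m' - m ∈ traceRange ρ (S : Subgroup G) := by
    refine smul_sum_cosetAct_sub_mem hc h.smul_eq fun g => ?_
    by_cases hU0 : (S : Subgroup G) ⊓ cj g S = ⊥
    · rw [hU0, traceRange_bot]
      exact Submodule.mem_top
    · have h1 := h.sub_smul_mem (U := (S : Subgroup G) ⊓ cj g S) inf_le_left inf_le_right
      rwa [hπ1 hU0 inf_le_left inf_le_right, one_smul] at h1
  have hπm' : π m' = 1 := by
    have h1 := h.map_eq_zero le_rfl hS hsub
    rwa [map_sub, h.map_eq_one, sub_eq_zero] at h1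
  have hπS : ∀ s ∈ (S : Subgroup G), ρ.dual s π = π := fun s hs =>
    LinearMap.ext fun v => h.map_smul _ (inv_mem hs) v
  let π' : V →ₗ[k] k := c • ∑ x : G ⧸ (S : Subgroup G), cosetAct ρ.dual π x
  have hπ' : ∀ g v, π' (ρ g v) = π' v := fun g v => by
    have h1 : ρ.dual g⁻¹ π' = π' := by
      simp only [π', _root_.map_smul, apply_sum_cosetAct hπS]
    conv_rhs => rw [← h1]
    simp [Representation.dual_apply, Module.Dual.transpose_apply]
  have hact : ∀ x : G ⧸ (S : Subgroup G), cosetAct ρ.dual π x m' = 1 := fun x =>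
    (congrArg π (hm' _)).trans hπm'
  -- Replacing m by the G-fixed m' changes the projection by π⊗(m' − m), a trace from S. Averaging
  -- over G/S then replaces π by π' and yields a trace from G.
  have hsplit : LinearMap.id - π.smulRight m' ∈
      traceRange (Representation.linHom ρ ρ) (S : Subgroup G) := by
    have h1 := map_mem_traceRange (σ := Representation.linHom ρ ρ) (LinearMap.smulRightₗ π)
      (fun x hx w => LinearMap.ext fun v => by
        simp [h.map_smul _ (inv_mem hx)]) hsub
    have h3 := Submodule.sub_mem _ h.split h1
    convert h3 using 1
    ext v
    simp [smul_sub]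
  have h4 := Submodule.smul_mem _ c (sum_cosetAct_mem_traceRange hsplit)
  refine ⟨m', π', fun s _ => hm' s, fun s _ => hπ' s, ?_, ?_⟩
  · simp only [π', LinearMap.smul_apply, LinearMap.sum_apply, hact, Finset.sum_const,
      Finset.card_univ, nsmul_eq_mul, mul_one, smul_eq_mul]
    exact hc
  · convert h4 using 1
    ext v
    have h5 : ∀ x : G ⧸ (S : Subgroup G),
        cosetAct (Representation.linHom ρ ρ) (LinearMap.id - π.smulRight m') x v =
          v - (cosetAct ρ.dual π x v) • m' := fun x => by
      have h6 : ρ x.out (ρ x.out⁻¹ v) = v := by simp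
      simp only [cosetAct, Representation.linHom_apply, LinearMap.comp_apply, LinearMap.sub_apply,
        LinearMap.id_apply, LinearMap.smulRight_apply, map_sub, _root_.map_smul, h6, hm']
      rfl
    simp only [LinearMap.smul_apply, LinearMap.sum_apply, h5, Finset.sum_sub_distrib, smul_sub,
      Finset.sum_const, Finset.card_univ, LinearMap.sub_apply, LinearMap.id_apply,
      LinearMap.smulRight_apply, π', ← Finset.sum_smul, smul_smul, smul_eq_mul,
      ← Nat.cast_smul_eq_nsmul k, hc, one_smul]

end Invariant

/-! ### Injectivity of the character map. -/

section Kernel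

variable {p : ℕ} {k : Type u} [Field k] {G : Type v} [Group G] [Finite G]
  {S : Sylow p G} {r : ℕ} [Fact p.Prime] [CharP k p]

theorem HasCharacter.stablyIso_unit (hS : (S : Subgroup G) ≠ ⊥) {M : Rep.{u} k G}
    (h : HasCharacter S r M 1) : StablyIso M (𝟙_ (Rep.{u} k G)) := by
  obtain ⟨m, π, hm, hχ⟩ := h
  obtain ⟨m', π', h'⟩ := hm.exists_top hS fun n hn => hχ ⟨n, hn⟩
  obtain ⟨P, hP, ⟨e⟩⟩ := h'.isTrivialPlusProjective
  exact ⟨0, P, inferInstance, hP, ⟨(isoBiprodZero (isZero_zero _)).symm ≪≫ e⟩⟩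

/-- T_k(G,S) is only known to be a monoid here, so a trivial kernel does not suffice. Surjectivity
supplies a class c mapping to the inverse character, which is then inverse to both a and b. -/
theorem characterMap_injective_of_surjective (hS : (S : Subgroup G) ≠ ⊥) (hr : 1 ≤ r)
    (hsurj : Function.Surjective (characterMap (k := k) (S := S) hS hr)) :
    Function.Injective (characterMap (k := k) (S := S) hS hr) := by
  have hker : ∀ a, characterMap (k := k) (S := S) hS hr a = 1 → a = 1 := by
    rintro ⟨M⟩ hM
    refine Quotient.sound (HasCharacter.stablyIso_unit (r := r) hS ?_)
    have := hasCharacter_sylowCharacter hS hr M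
    rwa [show sylowCharacter hS hr (Quotient.mk _ M) = 1 from hM] at this
  intro a b hab
  obtain ⟨c, hc⟩ := hsurj (characterMap hS hr a)⁻¹
  have h1 : c * a = 1 := hker _ (by rw [map_mul, hc]; exact MonoidHom.ext fun _ => inv_mul_cancel _)
  have h2 : c * b = 1 := hker _ (by rw [map_mul, hc, hab]; exact MonoidHom.ext fun _ => inv_mul_cancel _)
  calc a = a * (c * b) := by rw [h2, mul_one]
    _ = c * a * b := by rw [← mul_assoc, mul_comm a c]
    _ = b := by rw [h1, one_mul]

end Kernel

/-! ### Splitting off a summand by an idempotent -/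

section Retract

variable {p : ℕ} {k : Type u} [Field k] {G : Type v} [Group G] [Finite G]
  {V : Type*} [AddCommGroup V] [Module k V] {ρ : Representation k G V} {S : Sylow p G}
  {m : V} {π : V →ₗ[k] k}

/-- With q = π⊗m idempotent, E^{n+2} − q = E(E^{n+1} − q) + (E − q)q. -/
theorem pow_succ_sub_mem_traceRange {S : Subgroup G} (hm : ∀ s ∈ S, ρ s m = m)
    (hπ : ∀ s ∈ S, ∀ v, π (ρ s v) = π v) (h1 : π m = 1) {E : V →ₗ[k] V}
    (hE : ∀ g v, E (ρ g v) = ρ g (E v))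
    (hT : E - π.smulRight m ∈ traceRange (Representation.linHom ρ ρ) S) (n : ℕ) :
    E ^ (n + 1) - π.smulRight m ∈ traceRange (Representation.linHom ρ ρ) S := by
  induction n with
  | zero => simpa using hT
  | succ n ih =>
    have h2 := comp_mem_traceRange (ρ' := ρ) (σ' := ρ) ih LinearMap.id E (fun _ _ _ => rfl)
      (fun x _ v => hE x v)
    have h3 := comp_mem_traceRange (ρ' := ρ) (σ' := ρ) hT (π.smulRight m) LinearMap.id
      (fun x hx v => by simp [hπ x hx, hm x hx]) (fun _ _ _ => rfl)
    convert Submodule.add_mem _ h2 h3 using 1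
    ext v
    simp only [pow_succ' E (n + 1), h1, LinearMap.sub_apply, LinearMap.comp_apply, LinearMap.add_apply,
      LinearMap.smulRight_apply, LinearMap.id_apply, Module.End.mul_apply, map_sub, map_smul, one_smul,
      smul_sub]
    abel

variable [Fact p.Prime] [CharP k p]

/-- The module is the image of e. Since em − m is a trace from S, π reads off the same values on
N_G(S). -/
theorem exists_rep_of_idempotent [FiniteDimensional k V] (hS : (S : Subgroup G) ≠ ⊥)
    (hm : ∀ s ∈ (S : Subgroup G), ρ s m = m) (hπ : ∀ s ∈ (S : Subgroup G), ∀ v, π (ρ s v) = π v)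
    (h1 : π m = 1) {e : V →ₗ[k] V} (he : ∀ v, e (e v) = e v) (heq : ∀ g v, e (ρ g v) = ρ g (e v))
    (hT : e - π.smulRight m ∈ traceRange (Representation.linHom ρ ρ) (S : Subgroup G)) :
    ∃ (M : Rep.{u} k G) (m' : M.V) (π' : M.V →ₗ[k] k),
      IsSylowTrivial M.ρ (S : Subgroup G) m' π' ∧
      ∀ n ∈ nrm (S : Subgroup G), π' (M.ρ n m') = π (ρ n m) := by
  -- Coordinates put the image of e in the universe of k, whatever the universe of V.
  let b := (Module.finBasis k (LinearMap.range e)).equivFun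
  let κ : V →ₗ[k] (Fin (Module.finrank k (LinearMap.range e)) → k) :=
    b.toLinearMap ∘ₗ e.rangeRestrict
  let ι : (Fin (Module.finrank k (LinearMap.range e)) → k) →ₗ[k] V :=
    (LinearMap.range e).subtype ∘ₗ b.symm.toLinearMap
  have hικ : ∀ v, ι (κ v) = e v := fun v => by simp [ι, κ]
  have heι : ∀ w, e (ι w) = ι w := fun w => by
    obtain ⟨v, hv⟩ := (b.symm w).2
    change e (b.symm w : V) = (b.symm w : V)
    rw [← hv, he]
  have hκe : ∀ v, κ (e v) = κ v := fun v => by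
    have : e.rangeRestrict (e v) = e.rangeRestrict v := Subtype.ext (he v)
    simp only [κ, LinearMap.comp_apply, this]
  have hκι : ∀ w, κ (ι w) = w := fun w => by
    have : e.rangeRestrict (ι w) = b.symm w := Subtype.ext (heι w)
    simp [κ, this]
  let σ : Representation k G (Fin (Module.finrank k (LinearMap.range e)) → k) :=
    { toFun := fun g => κ ∘ₗ ρ g ∘ₗ ι
      map_one' := by
        refine LinearMap.ext fun w => ?_
        simp [hκι]
      map_mul' := fun g h => by
        refine LinearMap.ext fun w => ?_
        simp only [LinearMap.comp_apply, Module.End.mul_apply, hικ, ← heq, hκe, map_mul] }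
  have hσ : ∀ g w, σ g w = κ (ρ g (ι w)) := fun _ _ => rfl
  have hισ : ∀ g w, ι (σ g w) = ρ g (ι w) := fun g w => by rw [hσ, hικ, heq, heι]
  have hκσ : ∀ g v, κ (ρ g v) = σ g (κ v) := fun g v => by rw [hσ, hικ, ← heq, hκe]
  have hem : e m - m ∈ traceRange ρ (S : Subgroup G) := by
    have := apply_mem_traceRange hT hm
    simpa [h1] using this
  have hker : ∀ v ∈ traceRange ρ (S : Subgroup G), π v = 0 := fun v hv =>
    eq_zero_of_mem_traceRange S.2 hS π hπ hv
  have hπem : ∀ n ∈ nrm (S : Subgroup G), π (ρ n (e m)) = π (ρ n m) := fun n hn => by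
    have h2 := apply_mem_traceRange_cj n hem
    rw [mem_nrm.1 hn] at h2
    have h3 := hker _ h2
    rwa [map_sub, map_sub, sub_eq_zero] at h3
  refine ⟨Rep.of σ, κ m, π ∘ₗ ι, ⟨fun s hs => ?_, fun s hs w => ?_, ?_, ?_⟩, fun n hn => ?_⟩
  · exact (hκσ s m).symm.trans (by rw [hm s hs])
  · exact (congrArg π (hισ s w)).trans (hπ s hs _)
  · have := hπem 1 (one_mem _)
    simpa [hικ, h1] using this
  · have h2 := comp_mem_traceRange (ρ' := σ) (σ' := σ) hT ι κ (fun x _ v => hισ x v)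
      (fun x _ v => hκσ x v)
    convert h2 using 1
    refine LinearMap.ext fun w => ?_
    simp [heι, hκι]
  · refine (congrArg π (hισ n (κ m))).trans ?_
    rw [hικ, hπem n hn]

end Retract

/-! ### Idempotent powers -/

theorem exists_pow_mul_pow_eq {R : Type*} [Monoid R] [Finite R] (a : R) :
    ∃ n, a ^ (n + 1) * a ^ (n + 1) = a ^ (n + 1) := by
  obtain ⟨i, j, hij, h⟩ : ∃ i j, i < j ∧ a ^ i = a ^ j := by
    obtain ⟨i, j, hne, h⟩ := Finite.exists_ne_map_eq_of_infinite (fun n : ℕ => a ^ n)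
    rcases lt_or_gt_of_ne hne with h' | h'
    exacts [⟨i, j, h', h⟩, ⟨j, i, h', h.symm⟩]
  obtain ⟨d, rfl⟩ := Nat.exists_eq_add_of_lt hij
  have hper : ∀ t l, i ≤ l → a ^ (l + t * (d + 1)) = a ^ l := by
    intro t l hl
    induction t with
    | zero => simp
    | succ t ih =>
      obtain ⟨l, rfl⟩ := Nat.exists_eq_add_of_le hl
      rw [show i + l + (t + 1) * (d + 1) = (i + d + 1) + (l + t * (d + 1)) by ring, pow_add, ← h,
        ← pow_add, ← ih]
      congr 1
      ring
  -- The exponent n + 1 = (i + 1)(d + 1) is at least i and a multiple of the period d + 1, so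
  -- doubling it changes nothing.
  refine ⟨i * (d + 1) + d, ?_⟩
  rw [← pow_add]
  have h2 := hper (i + 1) (i * (d + 1) + d + 1) (by nlinarith)
  rw [← h2]
  congr 1
  ring

/-- Roots of unity are integral, so finitely many of them generate a finite module over the prime
field. -/
theorem exists_finite_subring {p : ℕ} [Fact p.Prime] {k : Type*} [Field k] [Algebra (ZMod p) k]
    {s : Set k} (hs : s.Finite) (h : ∀ x ∈ s, ∃ n, 0 < n ∧ x ^ n = 1) :
    Finite (Algebra.adjoin (ZMod p) s) := by
  have hfg := fg_adjoin_of_finite (R := ZMod p) hs fun x hx => by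
    obtain ⟨n, hn, h1⟩ := h x hx
    exact IsIntegral.of_pow hn (h1 ▸ isIntegral_one)
  have : Module.Finite (ZMod p) (Algebra.adjoin (ZMod p) s) := Module.Finite.iff_fg.2 hfg
  exact Module.finite_of_finite (ZMod p)

/-! ### Modules with a given character -/

section PermutationModule

variable {k : Type*} [Field k] {G : Type v} [Group G]

/-- The action of `G` on the functions on a `G`-set. -/
def functionRep (k : Type*) [Field k] (G : Type v) [Group G] (X : Type*) [MulAction G X] :
    Representation k G (X → k) where
  toFun g := LinearMap.funLeft k k (g⁻¹ • ·)
  map_one' := by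
    ext f x
    simp [LinearMap.funLeft_apply]
  map_mul' g h := by
    refine LinearMap.ext fun f => funext fun x => ?_
    simp [LinearMap.funLeft_apply, mul_smul]

variable {X : Type*} [MulAction G X]

theorem functionRep_apply (g : G) (f : X → k) (x : X) :
    functionRep k G X g f x = f (g⁻¹ • x) := rfl

theorem functionRep_single [DecidableEq X] (g : G) (x : X) (a : k) :
    functionRep k G X g (Pi.single x a) = Pi.single (g • x) a := by
  funext y
  simp only [functionRep_apply, Pi.single_apply, inv_smul_eq_iff]

variable [Finite G] {V : Type*} [AddCommGroup V] [Module k V] {ρ : Representation k G V}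

/-- Only points with trivial stabilizer in Q contribute, and a sum over free orbits is a trace. -/
theorem sum_smul_mem_traceRange [Fintype X] {Q : Subgroup G} (a : X → k) (F : X → V)
    (ha : ∀ q ∈ Q, ∀ x, a (q • x) = a x) (hF : ∀ q x, F (q • x) = ρ q (F x))
    (h0 : ∀ x, Q ⊓ MulAction.stabilizer G x ≠ ⊥ → a x = 0) :
    ∑ x, a x • F x ∈ traceRange ρ Q := by
  refine sum_mem_traceRange Q _ (fun q hq x => ?_) fun x => ?_
  · rw [ha q hq, hF q, map_smul]
  · by_cases hx : Q ⊓ MulAction.stabilizer G x = ⊥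
    · rw [hx, traceRange_bot]
      exact Submodule.mem_top
    · rw [h0 x hx, zero_smul]
      exact Submodule.zero_mem _

theorem mem_traceRange_functionRep [Fintype X] {Q : Subgroup G} (a : X → k)
    (ha : ∀ q ∈ Q, ∀ x, a (q • x) = a x)
    (h0 : ∀ x, Q ⊓ MulAction.stabilizer G x ≠ ⊥ → a x = 0) :
    a ∈ traceRange (functionRep k G X) Q := by
  classical
  rw [pi_eq_sum_univ' a]
  convert sum_smul_mem_traceRange (ρ := functionRep k G X) a (fun x => Pi.single x 1) ha
    (fun q x => (functionRep_single q x 1).symm) h0 using 2 with x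

/-- Expand A in elementary matrices, which are permuted like the points of X × X. -/
theorem mulVecLin_mem_traceRange [Fintype X] {Q : Subgroup G} (A : Matrix X X k)
    (hA : ∀ q ∈ Q, ∀ y x, A (q • y) (q • x) = A y x)
    (h0 : ∀ y x, Q ⊓ MulAction.stabilizer G (y, x) ≠ ⊥ → A y x = 0) :
    A.mulVecLin ∈ traceRange (Representation.linHom (functionRep k G X) (functionRep k G X)) Q := by
  classical
  have h1 := sum_smul_mem_traceRange
    (ρ := Representation.linHom (functionRep k G X) (functionRep k G X))
    (fun z : X × X => A z.1 z.2)
    (fun z => (LinearMap.proj z.2 : (X → k) →ₗ[k] k).smulRight (Pi.single z.1 1))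
    (fun q hq z => hA q hq _ _) (fun q z => LinearMap.ext fun f => by
      simp [functionRep_apply, functionRep_single]) fun z hz => h0 z.1 z.2 hz
  convert h1 using 1
  refine LinearMap.ext fun f => funext fun y => ?_
  simp [LinearMap.sum_apply, Finset.sum_apply, Fintype.sum_prod_type, Matrix.mulVec, dotProduct,
    Pi.single_apply]

end PermutationModule

/-! ### Bi-invariant weak homomorphisms with values of finite order. -/

section WeakHom

variable {p : ℕ} [Fact p.Prime] {G : Type v} [Group G] [Finite G] {S : Sylow p G} {r : ℕ}
  {B : Type*} [CommGroup B]

theorem exists_isWeakHom_invariant (hS : (S : Subgroup G) ≠ ⊥)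
    (hr : 1 + Order.krullDim (RadicalSubgroup p G) ≤ (r : WithBot ℕ∞))
    (f : nrm (S : Subgroup G) ⧸ rhoIn p (S : Subgroup G) r →* B) :
    ∃ u : G → B, IsWeakHom (S : Subgroup G) 2 u ∧
      (∀ x : nrm (S : Subgroup G), u x = f (QuotientGroup.mk x)) ∧
      (∀ g, ∀ s ∈ (S : Subgroup G), u (g * s) = u g) ∧
      (∀ g, ∀ s ∈ (S : Subgroup G), u (s * g) = u g) ∧ ∀ g, ∃ n, 0 < n ∧ u g ^ n = 1 := by
  classical
  -- Taking values in the finite range of f bounds the orders of all values.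
  obtain ⟨u, hu, hf⟩ := exists_isWeakHom hS hr f.rangeRestrict
  have hcard : ∀ {U : Subgroup G}, U ≠ ⊥ → 2 ≤ Nat.card U := fun h =>
    (Subgroup.one_lt_card_iff_ne_bot _).2 h
  -- The axioms do not constrain `u` where S ∩ gSg⁻¹ = 1. Setting it to 1 there gives invariance
  -- under S on both sides.
  let w : G → B := fun g => if (S : Subgroup G) ⊓ cj g S = ⊥ then 1 else u g
  have hw : ∀ {U : Subgroup G} {g : G}, 2 ≤ Nat.card U → U ≤ S → U ≤ cj g S → w g = u g := by
    intro U g hU hUS hg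
    refine if_neg fun h => ?_
    have hU0 : U = ⊥ := eq_bot_iff.2 (h ▸ le_inf hUS hg)
    exact (Subgroup.one_lt_card_iff_ne_bot _).1 hU hU0
  refine ⟨w, ⟨fun s hs => ?_, fun U g h hn h1 h2 h3 => ?_⟩, fun x => ?_, fun g s hs => ?_,
    fun g s hs => ?_, fun g => ?_⟩
  · rw [hw (hcard hS) le_rfl (cj_eq_of_mem hs).ge, hu.map_of_mem s hs, OneMemClass.coe_one]
  · rw [hw hn h1 h3, hw hn h1 h2, hw (U := cj g⁻¹ U) (by rwa [card_cj]) (cj_inv_le.2 h2)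
      (by rw [cj_inv_le, ← cj_mul]; exact h3), hu.map_mul U g h hn h1 h2 h3, Subgroup.coe_mul]
  · rw [hw (hcard hS) le_rfl (mem_nrm.1 x.2).ge, hf]
    rfl
  · have e : cj (g * s) (S : Subgroup G) = cj g S := by rw [cj_mul, cj_eq_of_mem hs]
    by_cases h : (S : Subgroup G) ⊓ cj g S = ⊥
    · simp only [w, e, h, if_true]
    · simp only [w, e, h, if_false]
      rw [hu.map_mul_mem (hcard h) inf_le_left inf_le_right hs]
  · have e : (S : Subgroup G) ⊓ cj (s * g) S = cj s ((S : Subgroup G) ⊓ cj g S) := by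
      rw [cj_inf, cj_eq_of_mem hs, cj_mul]
    by_cases h : (S : Subgroup G) ⊓ cj g S = ⊥
    · have h' : (S : Subgroup G) ⊓ cj (s * g) S = ⊥ := by
        rw [e, h, Subgroup.eq_bot_iff_card, card_cj, Subgroup.card_bot]
      simp only [w, h, h', if_true]
    · have h' : (S : Subgroup G) ⊓ cj (s * g) S ≠ ⊥ := e ▸ cj_ne_bot h s
      simp only [w, h, h', if_false]
      rw [hu.map_mem_mul (hcard h') inf_le_left inf_le_right hs]
  · by_cases h : (S : Subgroup G) ⊓ cj g S = ⊥
    · exact ⟨1, one_pos, by simp [w, h]⟩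
    · have : Finite f.range := Set.finite_range f
      refine ⟨orderOf (u g), orderOf_pos _, ?_⟩
      simp only [w, h, if_false]
      rw [← Subgroup.coe_pow, pow_orderOf_eq_one, OneMemClass.coe_one]

end WeakHom

/-! ### Realizing every character on a summand of the permutation module on G/S. -/

section Existence

variable {G : Type v} [Group G] {k : Type u} [Field k]

/-- A bi-invariant function as a matrix indexed by the cosets. -/
noncomputable def cosetMatrix (S : Subgroup G) (c : k) (u : G → kˣ) : Matrix (G ⧸ S) (G ⧸ S) k :=
  Matrix.of fun y x => c * u (x.out⁻¹ * y.out)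

theorem cosetMatrix_mk {S : Subgroup G} {c : k} {u : G → kˣ}
    (hr : ∀ g, ∀ s ∈ S, u (g * s) = u g) (hl : ∀ g, ∀ s ∈ S, u (s * g) = u g) (g h : G) :
    cosetMatrix S c u (QuotientGroup.mk g) (QuotientGroup.mk h) = c * u (h⁻¹ * g) := by
  obtain ⟨s, hs⟩ := QuotientGroup.mk_out_eq_mul S g
  obtain ⟨t, ht⟩ := QuotientGroup.mk_out_eq_mul S h
  rw [cosetMatrix, Matrix.of_apply, hs, ht, mul_inv_rev, mul_assoc, hl _ _ (inv_mem t.2),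
    ← mul_assoc, hr _ _ s.2]

variable [Finite G] {p : ℕ} [Fact p.Prime] {S : Sylow p G} {r : ℕ}

/-- The entries lie in a finite subring, as c comes from the prime field and the values of u are
roots of unity. Some power in the finite matrix monoid is therefore idempotent. -/
theorem exists_pow_mul_pow_eq_cosetMatrix (S : Subgroup G) [Fintype (G ⧸ S)] [Algebra (ZMod p) k]
    (c : ZMod p) {u : G → kˣ} (hu : ∀ g, ∃ n, 0 < n ∧ u g ^ n = 1) :
    ∃ n, (cosetMatrix S (algebraMap (ZMod p) k c) u).mulVecLin ^ (n + 1) *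
      (cosetMatrix S (algebraMap (ZMod p) k c) u).mulVecLin ^ (n + 1) =
      (cosetMatrix S (algebraMap (ZMod p) k c) u).mulVecLin ^ (n + 1) := by
  classical
  let s : Set k := Set.range fun g => (u g : k)
  have hfin : Finite (Algebra.adjoin (ZMod p) s) := by
    refine exists_finite_subring (Set.finite_range _) ?_
    rintro _ ⟨g, rfl⟩
    obtain ⟨n, hn, h⟩ := hu g
    exact ⟨n, hn, by rw [← Units.val_pow_eq_pow_val, h, Units.val_one]⟩
  have hmem : ∀ g, (u g : k) ∈ Algebra.adjoin (ZMod p) s := fun g =>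
    Algebra.subset_adjoin ⟨g, rfl⟩
  let A : Matrix (G ⧸ S) (G ⧸ S) (Algebra.adjoin (ZMod p) s) :=
    Matrix.of fun y x => algebraMap (ZMod p) _ c * ⟨_, hmem (x.out⁻¹ * y.out)⟩
  let φ : Matrix (G ⧸ S) (G ⧸ S) (Algebra.adjoin (ZMod p) s) →* ((G ⧸ S → k) →ₗ[k] (G ⧸ S → k)) :=
    (Matrix.toLinAlgEquiv' : Matrix (G ⧸ S) (G ⧸ S) k ≃ₐ[k] _).toMonoidHom.comp
      (Algebra.adjoin (ZMod p) s).val.toRingHom.mapMatrix.toMonoidHom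
  have hφ : φ A = (cosetMatrix S (algebraMap (ZMod p) k c) u).mulVecLin := rfl
  obtain ⟨n, hn⟩ := exists_pow_mul_pow_eq A
  refine ⟨n, ?_⟩
  rw [← hφ, ← map_pow, ← map_mul, hn]

variable [CharP k p]

/-- The matrix c·u(x⁻¹y) commutes with G and, modulo traces from S, equals the rank one map π⊗m with
m(y) = c·u(y) and π(f) = ∑ u(x)⁻¹f(x). An idempotent power of it cuts out the module. -/
theorem exists_hasCharacter_eq (hS : (S : Subgroup G) ≠ ⊥)
    (hr : 1 + Order.krullDim (RadicalSubgroup p G) ≤ (r : WithBot ℕ∞))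
    (χ : nrm (S : Subgroup G) ⧸ rhoIn p (S : Subgroup G) r →* kˣ) :
    ∃ M : Rep.{u} k G, HasCharacter S r M χ := by
  classical
  have : Fintype (G ⧸ (S : Subgroup G)) := Fintype.ofFinite _
  let _ : Algebra (ZMod p) k := ZMod.algebra k p
  -- The inverse of χ enters because t acts on functions by x ↦ t⁻¹x.
  obtain ⟨u, hu, huχ, hur, hul, hfin⟩ := exists_isWeakHom_invariant hS hr χ⁻¹
  obtain ⟨c₀, hc₀⟩ := exists_mul_card_quotient_eq_one (k := ZMod p) S
  let c : k := algebraMap (ZMod p) k c₀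
  have hc : c * (Fintype.card (G ⧸ (S : Subgroup G)) : k) = 1 := by
    rw [← map_natCast (algebraMap (ZMod p) k), ← map_mul, hc₀, map_one]
  let X := G ⧸ (S : Subgroup G)
  let w : X → kˣ := fun x => u x.out
  have hw : ∀ g : G, w (QuotientGroup.mk g) = u g := fun g => by
    obtain ⟨s, hs⟩ := QuotientGroup.mk_out_eq_mul (S : Subgroup G) g
    exact (congrArg u hs).trans (hur g s s.2)
  have hwS : ∀ s ∈ (S : Subgroup G), ∀ x, w (s • x) = w x := fun s hs x => by
    induction x using QuotientGroup.induction_on with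
    | H g => rw [MulAction.Quotient.smul_mk, hw, hw, smul_eq_mul, hul _ _ hs]
  have hcard : ∀ {U : Subgroup G}, U ≠ ⊥ → 2 ≤ Nat.card U := fun h =>
    (Subgroup.one_lt_card_iff_ne_bot _).2 h
  let E := (cosetMatrix (S : Subgroup G) c u).mulVecLin
  let m : X → k := fun x => c * w x
  let π : (X → k) →ₗ[k] k := ∑ x, ((w x)⁻¹ : kˣ).val • LinearMap.proj x
  have hπ_apply : ∀ f, π f = ∑ x, ((w x)⁻¹ : kˣ).val * f x := fun f => by
    simp [π, LinearMap.sum_apply]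
  have hm : ∀ s ∈ (S : Subgroup G), functionRep k G X s m = m := fun s hs => funext fun x => by
    rw [functionRep_apply]
    simp only [m, hwS _ (inv_mem hs)]
  have hπ : ∀ s ∈ (S : Subgroup G), ∀ f, π (functionRep k G X s f) = π f := fun s hs f => by
    rw [hπ_apply, hπ_apply]
    refine (Fintype.sum_equiv (MulAction.toPerm s) _ _ fun x => ?_).symm
    rw [MulAction.toPerm_apply, functionRep_apply, inv_smul_smul, hwS s hs]
  have h1 : π m = 1 := by
    rw [hπ_apply, Finset.sum_congr rfl fun x _ => show ((w x)⁻¹ : kˣ).val * m x = c by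
      simp only [m]
      rw [mul_left_comm, Units.inv_mul, mul_one], Finset.sum_const, Finset.card_univ, nsmul_eq_mul,
      mul_comm]
    exact hc
  have hA : ∀ (g : G) (y x : X), cosetMatrix (S : Subgroup G) c u (g • y) (g • x) =
      cosetMatrix (S : Subgroup G) c u y x := fun g y x => by
    induction x using QuotientGroup.induction_on with
    | H x =>
    induction y using QuotientGroup.induction_on with
    | H y =>
    rw [MulAction.Quotient.smul_mk, MulAction.Quotient.smul_mk, cosetMatrix_mk hur hul,
      cosetMatrix_mk hur hul, smul_eq_mul, smul_eq_mul]
    congr 3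
    group
  have hE : ∀ g f, E (functionRep k G X g f) = functionRep k G X g (E f) := fun g f =>
    funext fun y => by
      rw [functionRep_apply]
      simp only [E, Matrix.mulVecLin_apply, Matrix.mulVec, dotProduct, functionRep_apply]
      refine (Fintype.sum_equiv (MulAction.toPerm g) _ _ fun x => ?_).symm
      rw [MulAction.toPerm_apply, inv_smul_smul, ← hA g, smul_inv_smul]
  -- The (y, x) entry vanishes as soon as S ∩ ySy⁻¹ ∩ xSx⁻¹ ≠ 1, because then u(y) = u(x)u(x⁻¹y).
  have hT : E - π.smulRight m ∈ traceRange
      (Representation.linHom (functionRep k G X) (functionRep k G X)) (S : Subgroup G) := by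
    have h2 := mulVecLin_mem_traceRange (k := k) (Q := (S : Subgroup G))
      (cosetMatrix (S : Subgroup G) c u - Matrix.of fun y x => m y * ((w x)⁻¹ : kˣ).val)
      (fun q hq y x => by
        simp only [Matrix.sub_apply, Matrix.of_apply, hA, m, hwS q hq]) fun y x h => by
        induction x using QuotientGroup.induction_on with
        | H x =>
        induction y using QuotientGroup.induction_on with
        | H y =>
        have hU : ∀ z ∈ (S : Subgroup G) ⊓ MulAction.stabilizer G
            ((QuotientGroup.mk y, QuotientGroup.mk x) : X × X),
            z ∈ cj y (S : Subgroup G) ∧ z ∈ cj x (S : Subgroup G) := fun z hz => by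
          have h3 := Prod.ext_iff.1 (MulAction.mem_stabilizer_iff.1 hz.2)
          have h4 := (inf_stabilizer_mk (S : Subgroup G) y).le ⟨hz.1, h3.1⟩
          have h5 := (inf_stabilizer_mk (S : Subgroup G) x).le ⟨hz.1, h3.2⟩
          exact ⟨h4.2, h5.2⟩
        have h3 := hu.map_mul _ x (x⁻¹ * y) (hcard h) inf_le_left (fun z hz => (hU z hz).2)
          (by rw [mul_inv_cancel_left]; exact fun z hz => (hU z hz).1)
        rw [mul_inv_cancel_left] at h3
        simp only [Matrix.sub_apply, Matrix.of_apply, m]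
        rw [cosetMatrix_mk hur hul, hw, hw, h3, mul_assoc, ← Units.val_mul, mul_right_comm,
          mul_inv_cancel, one_mul, sub_self]
    convert h2 using 1
    refine LinearMap.ext fun f => funext fun y => ?_
    simp only [E, LinearMap.sub_apply, LinearMap.smulRight_apply, Matrix.mulVecLin_apply,
      Matrix.sub_mulVec, Pi.sub_apply, Pi.smul_apply, hπ_apply, smul_eq_mul]
    congr 1
    simp only [Matrix.mulVec, dotProduct, Matrix.of_apply, Finset.sum_mul]
    exact Finset.sum_congr rfl fun x _ => by ring
  obtain ⟨n, hn⟩ := exists_pow_mul_pow_eq_cosetMatrix (k := k) (S : Subgroup G) c₀ hfin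
  have hEn : ∀ n g f, (E ^ n) (functionRep k G X g f) = functionRep k G X g ((E ^ n) f) := by
    intro n g f
    induction n with
    | zero => simp
    | succ n ih => rw [pow_succ', Module.End.mul_apply, ih, hE, Module.End.mul_apply]
  obtain ⟨M, m', π', h', hχ⟩ := exists_rep_of_idempotent hS hm hπ h1 (e := E ^ (n + 1))
    (fun v => congrArg (fun φ => φ v) hn) (hEn _) (pow_succ_sub_mem_traceRange hm hπ h1 hE hT n)
  refine ⟨M, m', π', h', fun t => ?_⟩
  rw [hχ t t.2]
  have htS : cj (t : G)⁻¹ (S : Subgroup G) = S := mem_nrm.1 (inv_mem t.2)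
  have hut : u (t : G)⁻¹ = χ (QuotientGroup.mk t) := by
    have h2 := huχ t⁻¹
    rw [Subgroup.coe_inv] at h2
    rw [h2, QuotientGroup.mk_inv, MonoidHom.inv_apply, map_inv, inv_inv]
  -- Where the stabilizer in S is non-trivial, u(t⁻¹x) = u(t⁻¹)u(x) = χ(t)u(x), so tm − χ(t)m is
  -- supported on free S-orbits.
  have h3 : functionRep k G X t m - (χ (QuotientGroup.mk t) : k) • m ∈
      traceRange (functionRep k G X) (S : Subgroup G) := by
    refine mem_traceRange_functionRep _ (fun q hq x => ?_) fun x hx => ?_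
    · have h4 : (t : G)⁻¹ * q * t ∈ (S : Subgroup G) :=
        htS.le (mem_cj.2 (by simpa [mul_assoc] using hq))
      have h5 : (t : G)⁻¹ • q • x = ((t : G)⁻¹ * q * t) • (t : G)⁻¹ • x := by
        simp [smul_smul]
      simp only [Pi.sub_apply, Pi.smul_apply, functionRep_apply, m, h5, hwS _ h4, hwS q hq]
    · induction x using QuotientGroup.induction_on with
      | H x =>
      rw [inf_stabilizer_mk] at hx
      have h4 := hu.map_mul (cj (t : G)⁻¹ ((S : Subgroup G) ⊓ cj x S)) (t : G)⁻¹ x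
        (hcard (cj_ne_bot hx _)) ((cj_mono _ inf_le_left).trans htS.le) (cj_mono _ inf_le_left)
        (by rw [cj_mul]; exact cj_mono _ inf_le_right)
      have h5 : w ((t : G)⁻¹ • (QuotientGroup.mk x : X)) = χ (QuotientGroup.mk t) * u x :=
        (hw ((t : G)⁻¹ * x)).trans (by rw [h4, hut])
      simp only [Pi.sub_apply, Pi.smul_apply, functionRep_apply, m, hw, smul_eq_mul, h5,
        Units.val_mul]
      ring
  have h4 := eq_zero_of_mem_traceRange S.2 hS π hπ h3
  rwa [map_sub, map_smul, h1, smul_eq_mul, mul_one, sub_eq_zero] at h4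

theorem characterMap_surjective (hS : (S : Subgroup G) ≠ ⊥)
    (hr : 1 + Order.krullDim (RadicalSubgroup p G) ≤ (r : WithBot ℕ∞)) (hr1 : 1 ≤ r) :
    Function.Surjective (characterMap (k := k) (S := S) hS hr1) := fun χ => by
  obtain ⟨M, hM⟩ := exists_hasCharacter_eq hS hr χ
  obtain ⟨m, π, h, hχ⟩ := hM
  exact ⟨Quotient.mk _ ⟨M, isTrivialPlusProjective_res_iff.2 ⟨m, π, h⟩⟩,
    sylowCharacter_eq hS hr1 ⟨M, isTrivialPlusProjective_res_iff.2 ⟨m, π, h⟩⟩ ⟨m, π, h, hχ⟩⟩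

/-- `T_k(G,S) ≅ Hom(N_G(S)/ρ^r(S), kˣ)`. -/
theorem nonempty_sylowTrivialGroup_mulEquiv (hS : (S : Subgroup G) ≠ ⊥)
    (hr : 1 + Order.krullDim (RadicalSubgroup p G) ≤ (r : WithBot ℕ∞)) :
    Nonempty (SylowTrivialGroup k (S : Subgroup G) ≃*
      (nrm (S : Subgroup G) ⧸ rhoIn p (S : Subgroup G) r →* kˣ)) := by
  have hr1 : 1 ≤ r := (WellPlaced.top (p := p) (S := (S : Subgroup G))).lt_of_krullDim_le hS hr
  have hsurj := characterMap_surjective (k := k) hS hr hr1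
  exact ⟨MulEquiv.ofBijective (characterMap hS hr1)
    ⟨characterMap_injective_of_surjective hS hr1 hsurj, hsurj⟩⟩

end Existence

end EndotrivialModules

theorem mainTheorem2 {p : ℕ} [Fact p.Prime] {G : Type v} [Group G] [Finite G]
    (S : Sylow p G) (hS : (S : Subgroup G) ≠ ⊥) (r : ℕ)
    (hr : 1 + Order.krullDim (EndotrivialModules.RadicalSubgroup p G) ≤ (r : WithBot ℕ∞)) :
    Nonempty (EndotrivialModules.orbitHomologyOne p G ≃+
      Additive (EndotrivialModules.nrm (S : Subgroup G) ⧸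
        EndotrivialModules.rhoIn p (S : Subgroup G) r)) ∧
    ∀ (k : Type u) [Field k] [CharP k p],
      Nonempty (EndotrivialModules.SylowTrivialGroup k (S : Subgroup G) ≃*
        ((EndotrivialModules.nrm (S : Subgroup G) ⧸
          EndotrivialModules.rhoIn p (S : Subgroup G) r) →* kˣ)) := by
  exact ⟨EndotrivialModules.nonempty_orbitHomologyOne_addEquiv S hS hr, fun k _ _ =>
    EndotrivialModules.nonempty_sylowTrivialGroup_mulEquiv hS hr⟩
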